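/- **Setting.** Let $\mathcal G$ be a connected $\phi^{\star4}$ ribbon graph: $n$ vertices, each with four corners numbered $1,2,3,4$ cyclically, and $L$ oriented internal lines joining disjoint pairs of corners. The remaining corners are external, and a root vertex $\bar V$ is chosen. Fix $s>0$ (in the model $s=1/(4\theta\Omega)$), $\Omega>0$, $K'\in\mathbb C$. Put $\varepsilon_{\ell i}=1$ (resp. $-1$) if $\ell$ enters (resp. exits) at corner $i$ and $0$ otherwise, and $\eta_{\ell i}=|\varepsilon_{\ell i}|$. Each line has a short variable $u_\ell$ (coefficients $\varepsilon_{\ell i}$) and a long variable $v_\ell$ (coefficients $\eta_{\ell i}$). The internal variables are, in this order, the short variables, the long variables and the hypermomenta $p_v$, $v\ne\bar V$ ($d=2L+n-1$ in all). The external variables are the positions $x_e$ of the external corners and $p_{\bar V}$; they take values in $\mathbb R^{2m}$, and are collected in $X$. Write $x\wedge y=\sum_k(x_{2k-1}y_{2k}-x_{2k}y_{2k-1})$ and $\sigma=\mathrm{diag}(\sigma_2,\dots,\sigma_2)$, so that $x\sigma y=-i\,x\wedge y$. Consider the antisymmetric form with entry $s\,\omega(i,j)(-1)^{i+j+1}$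 between two distinct corners $i,j$ of one vertex ($\omega=1$ if $i<j$, $-1$ if $i>j$) and entry $(-1)^{i+1}$ between a corner $i\in v$ and $p_v$. In the external and internal variables it has blocks $M,P,B$ (external–external, external–internal, internal–internal). For $t\in(0,1)^L$ let $A$ be diagonal with entries $1/t_\ell$ on $u_\ell$, $t_\ell$ on $v_\ell$ and $0$ on hypermomenta, $Q=A\otimes1+B\otimes\sigma$, $\mathbf M=M\otimes\sigma$, $\mathbf P=P\otimes\sigma$, and $HU(t)=\big(\prod_\ell t_\ell\big)\det(A+B)$. The (massless) Feynman amplitude at complex dimension $D$ is $$\mathcal A_{\mathcal G}(D;X)=K'\int_{(0,1)^L}\prod_\ell dt_\ell\,(1-t_\ell^2)^{\frac D2-1}\;HU(t)^{-\frac D2}\;e^{-\frac\Omega2X(\mathbf M-\mathbf PQ^{-1}\mathbf P^t)X^t}.$$ For $K=(I,J)$, with $I,J\subset\{1,\dots,L\}$ sets of short and long variables, let $\mathrm{Pf}(B_{\hat K\hat\tau\cdots})$ be the Pfaffian of $B$ with the variables of $K$ and $\tau,\dots$ deleted, and $\epsilon_{K\tau\cdots}$ the signature of the permutation which moves $\tau,\dots$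 followed by $K$ (in decreasing order) to the end. Put $u_{\ell K}=v_{\ell K}=[\ell\notin I]+[\ell\in J]\in\{0,1,2\}$, $t^{K}=\prod_\ell t_\ell^{u_{\ell K}}$, and $$a_K=s^{\,2g-k_K}n_K^2,\qquad n_K=\mathrm{Pf}(B_{\hat K})\big|_{s=1}\in\mathbb Z,\qquad 2g-k_K=2L+1-n-|I|-|J|,$$ $$s^{\mathcal R}_K(X)=\tfrac\Omega2\Big|\sum_e x_e\sum_{\tau\notin K}P_{e\tau}\epsilon_{K\tau}\mathrm{Pf}(B_{\hat K\hat\tau})\Big|^2,$$ $$s^{\mathcal I}_K(X)=\tfrac\Omega2\,\epsilon_K\mathrm{Pf}(B_{\hat K})\sum_{e,e'}\Big(\sum_{\tau\ne\tau'\notin K}P_{e\tau}\epsilon_{K\tau\tau'}\mathrm{Pf}(B_{\hat K\hat\tau\hat\tau'})P_{e'\tau'}\Big)x_e\wedge x_{e'},$$ where $e,e'$ run over all external variables. Let $K_U$ run over the $K$ with $n_K\neq0$, and let $K_V$ run, separately for $\mathcal R$ and $\mathcal I$, over the $K$ whose coefficients in $s^{\mathcal R}_K$, resp. $s^{\mathcal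 I}_K$, do not all vanish. For independent real numbers $r=(s^{\mathcal R}_{K_V},s^{\mathcal I}_{K_V})$ (the *external invariants*) with $s^{\mathcal R}_{K_V}\ge0$ put $HV^{\mathcal R}=\sum s^{\mathcal R}_{K_V}t^{K_V}$, $HV^{\mathcal I}=\sum s^{\mathcal I}_{K_V}t^{K_V}$, and $$\mathcal A_{\mathcal G}(D;r)=K'\int_{(0,1)^L}\prod_\ell dt_\ell(1-t_\ell^2)^{\frac D2-1}\,HU^{-\frac D2}\,e^{-(HV^{\mathcal R}+iHV^{\mathcal I})/HU}.$$ **Theorem (CM representation for NCQFT).** 1. On $(0,1)^L$: $HU=\sum_{K_U}a_{K_U}t^{K_U}>0$, and $\frac\Omega2X(\mathbf M-\mathbf PQ^{-1}\mathbf P^t)X^t=\frac\Omega2X\mathbf MX^t+(HV^{\mathcal R}+iHV^{\mathcal I})/HU$ at the invariants $r(X)$ of $X$. Hence $\mathcal A_{\mathcal G}(D;X)=e^{-\frac\Omega2X\mathbf MX^t}\mathcal A_{\mathcal G}(D;r(X))$ for $0<\Re D<2$. 2. For $0<\Re D<2$ the integrals that define $\mathcal A_{\mathcal G}(D;X)$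 and $\mathcal A_{\mathcal G}(D;r)$ converge absolutely. Both are analytic in $D$ in this strip, for every $X$ and every $r$ with all $s^{\mathcal R}_{K_V}\ge0$. 3. For $0<\Re D<2$ the convex domain $\Delta$ of real parts $(\sigma,\tau^{\mathcal R},\tau^{\mathcal I})$ of Mellin variables $(x_{K_U},y^{\mathcal R}_{K_V},y^{\mathcal I}_{K_V})$, defined by $$\sigma_{K_U}<0,\quad\tau^{\mathcal R}_{K_V}<0,\quad-1<\tau^{\mathcal I}_{K_V}<0,\quad\sum\sigma_{K_U}+\sum\tau^{\mathcal R}_{K_V}+\sum\tau^{\mathcal I}_{K_V}=-\tfrac{\Re D}2,\quad\Re\phi_\ell>0\ \ \forall\ell,$$ $$\phi_\ell=\sum_{K_U}u_{\ell K_U}x_{K_U}+\sum_{K_V}\big(v_{\ell K_V}y^{\mathcal R}_{K_V}+v_{\ell K_V}y^{\mathcal I}_{K_V}\big)+1,$$ is not empty. For each point of $\Delta$, as tempered distributions in the external invariants $s^{\mathcal R}_{K_V}>0$, $s^{\mathcal I}_{K_V}\in\mathbb R$, $$\mathcal A_{\mathcal G}(D;r)=K'\int_\Delta\frac{\prod_{K_U}a_{K_U}^{x_{K_U}}\Gamma(-x_{K_U})}{\Gamma(-\sum_{K_U}x_{K_U})}\prod_{K_V}(s^{\mathcal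 R}_{K_V})^{y^{\mathcal R}_{K_V}}\Gamma(-y^{\mathcal R}_{K_V})\prod_{K_V}(i\,s^{\mathcal I}_{K_V})^{y^{\mathcal I}_{K_V}}\Gamma(-y^{\mathcal I}_{K_V})\prod_{\ell=1}^L\frac{\Gamma(\frac{\phi_\ell}2)\Gamma(\frac D2)}{2\Gamma(\frac{\phi_\ell+D}2)},$$ with principal powers. Here $\int_\Delta$ is the integral over the imaginary parts, each divided by $2\pi$, of all Mellin variables but one $x_{K_0}$ (for any choice of $K_0$ among the $K_U$), the real parts being fixed at the given point and $x_{K_0}$ being determined by $\sum x+\sum y=-D/2$. That is: the amplitude, restricted to $s^{\mathcal R}_{K_V}>0$, defines a tempered distribution $T_D$; for every Schwartz function $f$ of the invariants, $T_D(f)$ is analytic in $D$ in the strip and equals the integral obtained by smearing the integrand with $f$, all the integrals involved (over the invariants and over the imaginary parts) being absolutely convergent. -/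

import Mathlib

open MeasureTheory Complex
open scoped SchwartzMap Kronecker

noncomputable section

/-- The Pfaffian of the antisymmetric matrix `B` restricted to the rows and columns listed (in
this order) in `l`, by expansion along the first row. The Pfaffian of the empty matrix is `1`,
and it is `0` in odd size. -/
def Pf {ι R : Type*} [CommRing R] (B : Matrix ι ι R) : List ι → R
  | [] => 1
  | i :: l => ∑ k : Fin l.length, (-1) ^ (k : ℕ) * B i (l.get k) * Pf B (l.eraseIdx k)
termination_by l => l.length
decreasing_by
  simp only [List.length_cons]
  have h := k.isLt
  rw [List.length_eraseIdx]
  split_ifs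
  omega

/-- The signature of the arrangement `l` relative to the increasing order of `rank`:
`(-1)` to the number of inversions. -/
def arrangementSign {ι : Type*} (rank : ι → ℕ) : List ι → ℤ
  | [] => 1
  | i :: l => (-1) ^ (l.countP fun j => decide (rank j < rank i)) * arrangementSign rank l

/-- The matrix `σ = diag (σ₂, …, σ₂)` (`m` blocks), acting on `ℝ^(2m)`. -/
def sigmaMatrix (m : ℕ) : Matrix (Fin m × Fin 2) (Fin m × Fin 2) ℂ :=
  (1 : Matrix (Fin m) (Fin m) ℂ) ⊗ₖ !![0, -I; I, 0]

/-- The symplectic product `x ∧ y = ∑ (x₁ y₂ - x₂ y₁)` on `ℝ^(2m)`; `x σ y = -i (x ∧ y)`. -/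
def symp {m : ℕ} (x y : Fin m × Fin 2 → ℝ) : ℝ :=
  ∑ k : Fin m, (x (k, 0) * y (k, 1) - x (k, 1) * y (k, 0))

/-- A connected rooted `φ^{⋆4}` ribbon graph: `n` vertices, each with four corners numbered in
the cyclic order of the Moyal vertex; `L` oriented internal lines, the line `ℓ` exiting the
corner `foot ℓ false` and entering the corner `foot ℓ true`, every corner carrying at most one
end of a line; corners that carry none are external. -/
structure StarGraph where
  n : ℕ
  L : ℕ
  foot : Fin L → Bool → Fin n × Fin 4
  foot_injective : Function.Injective fun p : Fin L × Bool => foot p.1 p.2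
  root : Fin n
  connected : (SimpleGraph.fromRel fun v w : Fin n =>
    ∃ ℓ, (foot ℓ false).1 = v ∧ (foot ℓ true).1 = w).Connected

namespace StarGraph

abbrev Corner (G : StarGraph) : Type := Fin G.n × Fin 4

/-- External variables: the positions `x_e` of the external corners, and the hypermomentum
`p` of the root vertex. -/
abbrev ExtVar (G : StarGraph) : Type := {c : G.Corner // ∀ ℓ b, G.foot ℓ b ≠ c} ⊕ Unit

/-- Internal variables: short variables, long variables, and hypermomenta of the vertices
other than the root. -/
abbrev IntVar (G : StarGraph) : Type := Fin G.L ⊕ (Fin G.L ⊕ {v : Fin G.n // v ≠ G.root})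

/-- The oscillations of the vertices, as an antisymmetric form in the corner positions and the
hypermomenta: `s ω(i,j) (-1)^(i+j+1)` between two corners `i ≠ j` of one vertex (with
`ω(i,j) = 1` if `i < j` and `-1` if `i > j`), and `(-1)^(i+1)` between the corner `i` of `v` and
the hypermomentum of `v`, for corners numbered `1,2,3,4` (so `0,1,2,3` here, whence
`(-1)^i`). The constant `s` is `1 / (4θΩ)`. -/
def vertexForm (G : StarGraph) {R : Type*} [CommRing R] (s : R) :
    Matrix (G.Corner ⊕ Fin G.n) (G.Corner ⊕ Fin G.n) R
  | .inl c, .inl c' =>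
      if c.1 = c'.1 then
        if c.2 < c'.2 then s * (-1) ^ ((c.2 : ℕ) + (c'.2 : ℕ) + 1)
        else if c'.2 < c.2 then -(s * (-1) ^ ((c.2 : ℕ) + (c'.2 : ℕ) + 1))
        else 0
      else 0
  | .inl c, .inr v => if c.1 = v then (-1) ^ (c.2 : ℕ) else 0
  | .inr v, .inl c => if c.1 = v then -(-1) ^ (c.2 : ℕ) else 0
  | .inr _, .inr _ => 0

/-- The coefficients of the corner positions and hypermomenta in the external and the internal
variables. The corner `i` has coefficient `ε_{ℓ i}` (`1` if `ℓ` enters at `i`, `-1` if it exits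
at `i`, `0` otherwise) in the short variable of `ℓ` and `η_{ℓ i} = |ε_{ℓ i}|` in the long one; the
factors `√2` are absorbed in the normalization of the external variables. -/
def coord (G : StarGraph) (R : Type*) [CommRing R] :
    Matrix (G.ExtVar ⊕ G.IntVar) (G.Corner ⊕ Fin G.n) R
  | .inl (.inl e), .inl c => if e.1 = c then 1 else 0
  | .inl (.inl _), .inr _ => 0
  | .inl (.inr _), .inl _ => 0
  | .inl (.inr _), .inr v => if v = G.root then 1 else 0
  | .inr (.inl ℓ), .inl c =>
      (if G.foot ℓ true = c then 1 else 0) - (if G.foot ℓ false = c then 1 else 0)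
  | .inr (.inl _), .inr _ => 0
  | .inr (.inr (.inl ℓ)), .inl c =>
      (if G.foot ℓ true = c then 1 else 0) + (if G.foot ℓ false = c then 1 else 0)
  | .inr (.inr (.inl _)), .inr _ => 0
  | .inr (.inr (.inr _)), .inl _ => 0
  | .inr (.inr (.inr w)), .inr v => if w.1 = v then 1 else 0

/-- The oscillating part of the quadratic form in all external and internal variables. -/
def oscForm (G : StarGraph) {R : Type*} [CommRing R] (s : R) :
    Matrix (G.ExtVar ⊕ G.IntVar) (G.ExtVar ⊕ G.IntVar) R :=
  G.coord R * G.vertexForm s * (G.coord R).transpose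

/-- The external-external block: `M = MMat ⊗ σ`. -/
def MMat (G : StarGraph) (s : ℝ) : Matrix G.ExtVar G.ExtVar ℝ := (G.oscForm s).toBlocks₁₁

/-- The external-internal block: `P = PMat ⊗ σ`. -/
def PMat (G : StarGraph) (s : ℝ) : Matrix G.ExtVar G.IntVar ℝ := (G.oscForm s).toBlocks₁₂

/-- The antisymmetric matrix `B = ((s E, C), (-Cᵗ, 0))` of the internal oscillations. -/
def BMat (G : StarGraph) {R : Type*} [CommRing R] (s : R) : Matrix G.IntVar G.IntVar R :=
  (G.oscForm s).toBlocks₂₂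

/-- The diagonal matrix `A` of the propagators: `1 / t_ℓ` on short variables, `t_ℓ` on long
variables, `0` on hypermomenta. -/
def AMat (G : StarGraph) (t : Fin G.L → ℝ) : Matrix G.IntVar G.IntVar ℝ :=
  Matrix.diagonal (Sum.elim (fun ℓ => (t ℓ)⁻¹) (Sum.elim t fun _ => 0))

/-- The internal quadratic form `Q = A ⊗ 1 + B ⊗ σ`. -/
def QMat (G : StarGraph) (s : ℝ) (m : ℕ) (t : Fin G.L → ℝ) :
    Matrix (G.IntVar × (Fin m × Fin 2)) (G.IntVar × (Fin m × Fin 2)) ℂ :=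
  (G.AMat t).map ofReal ⊗ₖ 1 + (G.BMat s).map ofReal ⊗ₖ sigmaMatrix m

/-- A configuration of the external variables, each of them in `ℝ^(2m)`. -/
abbrev ExtConf (G : StarGraph) (m : ℕ) : Type := G.ExtVar → Fin m × Fin 2 → ℝ

/-- The complex quadratic form `X R Xᵗ` at an external configuration. -/
def evalForm (G : StarGraph) {m : ℕ}
    (R : Matrix (G.ExtVar × (Fin m × Fin 2)) (G.ExtVar × (Fin m × Fin 2)) ℂ)
    (X : G.ExtConf m) : ℂ :=
  (fun p => (X p.1 p.2 : ℂ)) ⬝ᵥ R.mulVec fun p => (X p.1 p.2 : ℂ)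

/-- `X M Xᵗ`. It is purely imaginary and does not depend on `t`. -/
def pureExtForm (G : StarGraph) (s : ℝ) {m : ℕ} (X : G.ExtConf m) : ℂ :=
  G.evalForm ((G.MMat s).map ofReal ⊗ₖ sigmaMatrix m) X

/-- `X (M - P Q⁻¹ Pᵗ) Xᵗ`. -/
def extForm (G : StarGraph) (s : ℝ) {m : ℕ} (t : Fin G.L → ℝ) (X : G.ExtConf m) : ℂ :=
  G.evalForm
    ((G.MMat s).map ofReal ⊗ₖ sigmaMatrix m -
      ((G.PMat s).map ofReal ⊗ₖ sigmaMatrix m) * (G.QMat s m t)⁻¹ *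
        ((G.PMat s).map ofReal ⊗ₖ sigmaMatrix m).transpose) X

/-- The first hyperbolic polynomial `HU(t) = (∏ t_ℓ) det (A + B)`. In even integer dimension
`d` one has `det Q = det (A + B) ^ d`. -/
def HU (G : StarGraph) (s : ℝ) (t : Fin G.L → ℝ) : ℝ :=
  (∏ ℓ, t ℓ) * (G.AMat t + G.BMat s).det

/-- The domain `(0,1)^L` of the parameters `t_ℓ = tanh (α_ℓ / 2)`. -/
def cube (G : StarGraph) : Set (Fin G.L → ℝ) := Set.univ.pi fun _ => Set.Ioo 0 1

/-- The integrand of the parametric representation with `h` in the exponent. -/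
def paramIntegrand (G : StarGraph) (s : ℝ) (D : ℂ) (h : (Fin G.L → ℝ) → ℂ)
    (t : Fin G.L → ℝ) : ℂ :=
  (∏ ℓ, ((1 - t ℓ ^ 2 : ℝ) : ℂ) ^ (D / 2 - 1)) * exp (-h t) / (G.HU s t : ℂ) ^ (D / 2)

/-- The Feynman amplitude of `G` at (complex) dimension `D` as a function of the external
variables, with normalization constant `K'`. -/
def amplitude (G : StarGraph) (s Ω : ℝ) (K' D : ℂ) {m : ℕ} (X : G.ExtConf m) : ℂ :=
  K' * ∫ t in G.cube, G.paramIntegrand s D (fun t => (Ω / 2 : ℝ) * G.extForm s t X) t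

/-! ### Monomials of the hyperbolic polynomials -/

/-- Pairs `K = (I, J)`, with `I` a set of short and `J` a set of long variables. -/
abbrev Pair (G : StarGraph) : Type := Finset (Fin G.L) × Finset (Fin G.L)

/-- Membership of an internal variable in `K = I ∪ J`. -/
def inPair (G : StarGraph) (K : G.Pair) : G.IntVar → Bool
  | .inl ℓ => decide (ℓ ∈ K.1)
  | .inr (.inl ℓ) => decide (ℓ ∈ K.2)
  | .inr (.inr _) => false

/-- The increasing enumeration `1, …, d` of the internal variables. -/
def varList (G : StarGraph) : List G.IntVar :=
  (List.finRange G.L).map .inl ++ (List.finRange G.L).map (fun ℓ => .inr (.inl ℓ)) ++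
    ((List.finRange G.n).filterMap fun v =>
      if h : v ≠ G.root then some (.inr (.inr ⟨v, h⟩)) else none)

/-- A rank function that is increasing along `varList`. -/
def rank (G : StarGraph) : G.IntVar → ℕ
  | .inl ℓ => ℓ
  | .inr (.inl ℓ) => G.L + ℓ
  | .inr (.inr v) => 2 * G.L + v.1

/-- The internal variables outside `K` and outside `τs`, in increasing order. -/
def rest (G : StarGraph) (K : G.Pair) (τs : List G.IntVar) : List G.IntVar :=
  G.varList.filter fun x => !(G.inPair K x) && τs.all fun τ => decide (x ≠ τ)

/-- The signature `ε_{K τs}` of the permutation that extracts `τs` and `K` and puts them at the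
end, in the order `τs, i_{|K|}, …, i_1`. -/
def eps (G : StarGraph) (K : G.Pair) (τs : List G.IntVar) : ℤ :=
  arrangementSign G.rank (G.rest K τs ++ τs ++ (G.varList.filter (G.inPair K)).reverse)

/-- `Pf (B_{K̂ τ̂s})`: the variables in `K` and `τs` are deleted. -/
def pfDel (G : StarGraph) {R : Type*} [CommRing R] (s : R) (K : G.Pair)
    (τs : List G.IntVar) : R :=
  Pf (G.BMat s) (G.rest K τs)

/-- The integer Pfaffian `n_K` (of the matrix `B` normalized to have integer entries). -/
def nPf (G : StarGraph) (K : G.Pair) : ℤ := G.pfDel (1 : ℤ) K []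

/-- `a_K = s^(2g-k_K) n_K²` with `k_K = |K| - L - F + 1`; by Euler's relation
`2 - 2g = n - L + F` the exponent is `2L + 1 - n - |K|`. -/
def aCoef (G : StarGraph) (s : ℝ) (K : G.Pair) : ℝ :=
  s ^ (2 * (G.L : ℤ) + 1 - G.n - (K.1.card + K.2.card : ℕ)) * (G.nPf K : ℝ) ^ 2

/-- The coefficients `∑_{τ ∉ K} P_{eτ} ε_{Kτ} Pf (B_{K̂ τ̂})`. -/
def rCoef (G : StarGraph) (s : ℝ) (K : G.Pair) (e : G.ExtVar) : ℝ :=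
  ∑ τ with G.inPair K τ = false, G.PMat s e τ * G.eps K [τ] * G.pfDel s K [τ]

/-- The coefficients
`ε_K Pf (B_K̂) ∑_{τ ≠ τ' ∉ K} P_{eτ} ε_{Kττ'} Pf (B_{K̂ τ̂ τ̂'}) P_{e'τ'}`. -/
def iCoef (G : StarGraph) (s : ℝ) (K : G.Pair) (e e' : G.ExtVar) : ℝ :=
  G.eps K [] * G.pfDel s K [] *
    ∑ τ with G.inPair K τ = false, ∑ τ' with G.inPair K τ' = false ∧ τ' ≠ τ,
      G.PMat s e τ * G.eps K [τ, τ'] * G.pfDel s K [τ, τ'] * G.PMat s e' τ'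

/-- The exponent (`0`, `1` or `2`) of `t_ℓ` in `∏_{ℓ ∉ I} t_ℓ ∏_{ℓ ∈ J} t_ℓ`. -/
def expo (G : StarGraph) (K : G.Pair) (ℓ : Fin G.L) : ℕ :=
  (if ℓ ∈ K.1 then 0 else 1) + (if ℓ ∈ K.2 then 1 else 0)

def mon (G : StarGraph) (K : G.Pair) (t : Fin G.L → ℝ) : ℝ := ∏ ℓ, t ℓ ^ G.expo K ℓ

/-- Indices of the (nonzero) monomials of `HU`. -/
abbrev KU (G : StarGraph) : Type := {K : G.Pair // G.nPf K ≠ 0}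

/-- Indices of the (not identically zero) monomials of the real part of `HV`. -/
abbrev KR (G : StarGraph) (s : ℝ) : Type := {K : G.Pair // G.rCoef s K ≠ 0}

/-- Indices of the (not identically zero) monomials of the imaginary part of `HV`. -/
abbrev KI (G : StarGraph) (s : ℝ) : Type := {K : G.Pair // G.iCoef s K ≠ 0}

instance (G : StarGraph) (s : ℝ) : Fintype (G.KR s) := Fintype.ofFinite _

instance (G : StarGraph) (s : ℝ) : Fintype (G.KI s) := Fintype.ofFinite _

/-- The space of external invariants: one real coordinate for each monomial of the real and of
the imaginary part of `HV`. -/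
abbrev Inv (G : StarGraph) (s : ℝ) : Type := G.KR s ⊕ G.KI s → ℝ

/-- The values `s^R_K`, `s^I_K` of the invariants at an external configuration. -/
def invariants (G : StarGraph) (s Ω : ℝ) {m : ℕ} (X : G.ExtConf m) : G.Inv s :=
  Sum.elim
    (fun K => Ω / 2 * ∑ c : Fin m × Fin 2, (∑ e, G.rCoef s K e * X e c) ^ 2)
    (fun K => Ω / 2 * ∑ e, ∑ e', G.iCoef s K e e' * symp (X e) (X e'))

/-- The real part of `HV` as a function of `t` and of the invariants. -/
def HVre (G : StarGraph) (s : ℝ) (t : Fin G.L → ℝ) (r : G.Inv s) : ℝ :=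
  ∑ K : G.KR s, r (.inl K) * G.mon K t

/-- The imaginary part of `HV` as a function of `t` and of the invariants. -/
def HVim (G : StarGraph) (s : ℝ) (t : Fin G.L → ℝ) (r : G.Inv s) : ℝ :=
  ∑ K : G.KI s, r (.inr K) * G.mon K t

/-- `HV / HU = (HV^R + i HV^I) / HU` as a function of the invariants. -/
def HVoverHU (G : StarGraph) (s : ℝ) (r : G.Inv s) (t : Fin G.L → ℝ) : ℂ :=
  (G.HVre s t r + I * G.HVim s t r) / G.HU s t

/-- The amplitude as a function of the external invariants. -/
def invAmplitude (G : StarGraph) (s : ℝ) (K' D : ℂ) (r : G.Inv s) : ℂ :=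
  K' * ∫ t in G.cube, G.paramIntegrand s D (G.HVoverHU s r) t

/-! ### The complete Mellin representation -/

/-- Mellin variables: `x_K` for the monomials of `HU`, `y^R_K` and `y^I_K` for those of `HV`. -/
abbrev MellinIdx (G : StarGraph) (s : ℝ) : Type := G.KU ⊕ (G.KR s ⊕ G.KI s)

/-- The independent Mellin variables: all but `x_{K₀}`. -/
abbrev FreeIdx (G : StarGraph) (s : ℝ) (K₀ : G.KU) : Type :=
  {j : G.MellinIdx s // j ≠ .inl K₀}

instance (G : StarGraph) (s : ℝ) (K₀ : G.KU) : Fintype (G.FreeIdx s K₀) := Fintype.ofFinite _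

/-- `φ_ℓ = ∑ u_{ℓK} x_K + ∑ (v_{ℓK} y^R_K + v_{ℓK} y^I_K) + 1`. -/
def phi (G : StarGraph) {s : ℝ} {R : Type*} [CommRing R] (z : G.MellinIdx s → R)
    (ℓ : Fin G.L) : R :=
  (∑ K : G.KU, (G.expo K ℓ : R) * z (.inl K)) +
    (∑ K : G.KR s, (G.expo K ℓ : R) * z (.inr (.inl K)) +
      ∑ K : G.KI s, (G.expo K ℓ : R) * z (.inr (.inr K))) + 1

/-- The convex domain `Δ` of the real parts of the Mellin variables. -/
def Delta (G : StarGraph) (s : ℝ) (D : ℂ) : Set (G.MellinIdx s → ℝ) :=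
  {σ | (∀ K, σ (.inl K) < 0) ∧ (∀ K, σ (.inr (.inl K)) < 0) ∧
    (∀ K, -1 < σ (.inr (.inr K)) ∧ σ (.inr (.inr K)) < 0) ∧
    ∑ j, σ j = -D.re / 2 ∧ ∀ ℓ, 0 < G.phi σ ℓ}

/-- The point of the contour with real parts `σ` and imaginary parts `η`, where the imaginary
parts of all variables but `x_{K₀}` are free and `x_{K₀}` is fixed by `∑ x + ∑ y = -D/2`. -/
def contourPoint (G : StarGraph) {s : ℝ} (D : ℂ) (σ : G.MellinIdx s → ℝ) (K₀ : G.KU)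
    (η : G.FreeIdx s K₀ → ℝ) : G.MellinIdx s → ℂ :=
  open Classical in fun j =>
    if h : j = .inl K₀ then -D / 2 - ∑ j' : G.FreeIdx s K₀,
      ((σ j'.1 : ℂ) + I * η j')
    else (σ j : ℂ) + I * η ⟨j, h⟩

/-- The part of the integrand of the representation that does not depend on the invariants. -/
def mellinKernel (G : StarGraph) (s : ℝ) (D : ℂ) (z : G.MellinIdx s → ℂ) : ℂ :=
  (∏ K : G.KU, (G.aCoef s K : ℂ) ^ z (.inl K) * Gamma (-z (.inl K))) /
      Gamma (-∑ K : G.KU, z (.inl K)) *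
    (∏ K : G.KR s, Gamma (-z (.inr (.inl K)))) *
    (∏ K : G.KI s, Gamma (-z (.inr (.inr K)))) *
    ∏ ℓ, Gamma (G.phi z ℓ / 2) * Gamma (D / 2) / (2 * Gamma ((G.phi z ℓ + D) / 2))

/-- `∏ (s^R_K)^(y^R_K) ∏ (i s^I_K)^(y^I_K)`, with principal powers. -/
def invPower (G : StarGraph) {s : ℝ} (z : G.MellinIdx s → ℂ) (r : G.Inv s) : ℂ :=
  (∏ K : G.KR s, (r (.inl K) : ℂ) ^ z (.inr (.inl K))) *
    ∏ K : G.KI s, (I * (r (.inr K) : ℂ)) ^ z (.inr (.inr K))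

/-- The range of the invariants: those of the real part are positive, those of the imaginary part
are arbitrary real numbers. -/
def invCone (G : StarGraph) (s : ℝ) : Set (G.Inv s) := {r | ∀ K : G.KR s, 0 < r (.inl K)}

/-- The integrand of the representation, smeared with a test function of the invariants. -/
def mellinIntegrand (G : StarGraph) {s : ℝ} (D : ℂ) (f : 𝓢(G.Inv s, ℂ))
    (z : G.MellinIdx s → ℂ) : ℂ :=
  G.mellinKernel s D z * ∫ r in G.invCone s, f r * G.invPower z r

end StarGraph

/-- The strip `0 < Re D < 2`. -/
def dimStrip : Set ℂ := {D | 0 < D.re ∧ D.re < 2}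

end

/-! The algebra rests on one expansion. For `A` diagonal with nonnegative entries and `B`
antisymmetric, `det (A + B)` is the sum over sets `K` of `∏_K A` times the square of the Pfaffian of
`B` off `K`. The inverse has a companion expansion `resolventSum`, bilinear in signed Pfaffians with
one or two further deletions. It is verified by multiplying with `A + B`
(`diagonal_add_mul_resolventSum`), where the row expansion of Pfaffians makes the terms of `K` and
`K ∪ {τ}` fit together. The determinant formula follows: when one diagonal entry changes, the
determinant and the sum of squares change in the same proportion, and their ratio is found in the
limit of large `A` (`det_diagonal_add_eq_pfaffianSum`). For the propagator matrix only pairs `K =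
(I, J)` contribute, and the prefactor `∏ t_ℓ` turns `∏_K A` into a monomial, which gives `HU`.

Since `σ² = 1`, the form `Q` acts as `A + B` and `A - B = (A + B)ᵗ` on the two eigenspaces of `σ`.
So `Q⁻¹` is the symmetric part of `(A + B)⁻¹` tensored with `1` plus the antisymmetric part tensored
with `σ` (`inv_kronecker_one_add_kronecker_sigma`). In the expansion the symmetric part is a
combination of rank one squares and yields the nonnegative `HV^R`; the antisymmetric part yields
`HV^I` (`extForm_eq`).

Convergence comes from connectedness: some monomial of `HU` has all exponents at most `1`
(`exists_KU_expo_le_one`). Hence `HU ≥ a ∏ t_ℓ`, which controls `t → 0` for `Re D < 2`, while `Re D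
> 0` controls `t → 1`. The exponential has modulus at most `1`, so the bounds are uniform in the
invariants and locally uniform in `D`; analyticity follows by domination. Concentrating the Mellin
weight on the same monomial shows that `Delta` is not empty.

For the Mellin representation, each factor `exp (-s_K t^K / HU)` is an inverse Mellin transform.
Together these produce the power `HU ^ (-(D/2 + ∑ y))` of a sum of positive monomials, which a
Mellin–Barnes integral splits (`Gamma_mul_sum_cpow_eq_integral`). The integrals over `t` are then
beta integrals. The obstacle is the imaginary invariants: the decay `e^{-π|Im y|/2}` of `Γ(-y)` can
be cancelled by the growth of `(i s)^y`. So `i s` is first replaced by `ε + i s`, where everything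
converges absolutely and Fubini applies (`integral_regularized`). To let `ε → 0`, the integrand is
smeared with a Schwartz function, and integration by parts in the imaginary invariants gains any
power of `1 + |Im y|`, uniformly in `ε` (`exists_norm_mellinKernel_mul_integral_le`). Dominated
convergence on both sides then gives the identity. -/

noncomputable section

/-! ### Pfaffians through the exterior algebra -/

section Pfaffian

variable {ι R : Type*} [CommRing R]

theorem Pf_cons (B : Matrix ι ι R) (i : ι) (l : List ι) :
    Pf B (i :: l) = ∑ k : Fin l.length, (-1) ^ (k : ℕ) * B i (l.get k) * Pf B (l.eraseIdx k) := by
  rw [Pf]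

theorem Pf_nil (B : Matrix ι ι R) : Pf B [] = 1 := by rw [Pf]

theorem Pf_map_ringHom {S : Type*} [CommRing S] (f : R →+* S) (B : Matrix ι ι R) (l : List ι) :
    Pf (B.map f) l = f (Pf B l) := by
  induction h : l.length using Nat.strong_induction_on generalizing l with
  | _ n ih =>
    cases l with
    | nil => simp [Pf_nil]
    | cons i l =>
      rw [Pf_cons, Pf_cons, map_sum]
      refine Finset.sum_congr rfl fun k _ => ?_
      rw [ih _ _ (l.eraseIdx k) rfl]
      · simp
      · have := k.isLt
        rw [← h, List.length_eraseIdx_of_lt k.isLt, List.length_cons]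
        omega

/-- Contraction is an antiderivation, so iterating the Leibniz rule removes one factor at a time
with alternating sign. This is the pattern of the expansion of a Pfaffian along its first row. -/
theorem contractLeft_list_prod {M : Type*} [AddCommGroup M] [Module R M] (Q : QuadraticForm R M)
    (d : Module.Dual R M) (e : ι → M) (l : List ι) :
    CliffordAlgebra.contractLeft d (l.map fun i => CliffordAlgebra.ι Q (e i)).prod =
      ∑ k : Fin l.length, ((-1) ^ (k : ℕ) * d (e (l.get k))) •
        ((l.eraseIdx k).map fun i => CliffordAlgebra.ι Q (e i)).prod := by
  induction l with
  | nil => simp [CliffordAlgebra.contractLeft_one]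
  | cons a l ih =>
    rw [List.map_cons, List.prod_cons, CliffordAlgebra.contractLeft_ι_mul, ih]
    simp only [List.length_cons, Fin.sum_univ_succ, List.get_eq_getElem]
    simp only [Fin.val_zero, pow_zero, one_mul, List.getElem_cons_zero, List.eraseIdx_cons_zero,
      Fin.val_succ, List.getElem_cons_succ, List.eraseIdx_cons_succ, List.map_cons, List.prod_cons]
    rw [sub_eq_add_neg, Finset.mul_sum, ← Finset.sum_neg_distrib]
    congr 1
    refine Finset.sum_congr rfl fun k _ => ?_
    rw [mul_smul_comm, ← neg_smul]
    congr 1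
    ring

variable [Fintype ι] [DecidableEq ι]

theorem neg_toBilin'_toQuadraticMap {B : Matrix ι ι R} (hB : B.transpose = -B)
    (hd : ∀ i, B i i = 0) :
    (-(Matrix.toBilin' B)).toQuadraticMap = (0 : QuadraticForm R (ι → R)) - 0 := by
  have h0 : ∀ i j, B j i = - B i j := fun i j => by
    have := congrFun (congrFun hB i) j
    simpa using this
  have halt : (Matrix.toBilin' B).IsAlt := by
    intro x
    rw [Matrix.toBilin'_apply]
    rw [← Finset.sum_product']
    -- Off-diagonal terms cancel against their transposes; the diagonal ones need `hd`, which
    -- antisymmetry alone does not give in characteristic two.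
    refine Finset.sum_involution (fun p _ => (p.2, p.1)) ?_ ?_ ?_ ?_
    · intro p _
      rw [h0 p.1 p.2]; ring
    · rintro ⟨i, j⟩ _ h hij
      simp only [Prod.mk.injEq] at hij
      obtain ⟨rfl, -⟩ := hij
      simp [hd] at h
    · simp
    · simp
  ext x
  simp [LinearMap.BilinMap.toQuadraticMap_apply, halt x]

/-- The linear functional on the exterior algebra whose value on `e_{i₁} ∧ … ∧ e_{i_k}` is the
Pfaffian of `B` on `i₁, …, i_k`. -/
def pfFunctional {B : Matrix ι ι R} (hB : B.transpose = -B) (hd : ∀ i, B i i = 0) :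
    ExteriorAlgebra R (ι → R) →ₗ[R] R :=
  (ExteriorAlgebra.algebraMapInv (R := R) (M := ι → R)).toLinearMap ∘ₗ
    CliffordAlgebra.changeForm (neg_toBilin'_toQuadraticMap hB hd)

/-- Deforming the zero quadratic form by an alternating form leaves it zero, so `changeForm` maps
the exterior algebra to itself. On a product it contracts the first factor with the others through
`B`, and its scalar part obeys the recursion that defines `Pf`. The point is that antisymmetry of
`Pf` in its list, hidden by the expansion along the first row, becomes antisymmetry of the wedge
product. -/
theorem Pf_eq_pfFunctional {B : Matrix ι ι R} (hB : B.transpose = -B) (hd : ∀ i, B i i = 0)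
    (l : List ι) :
    Pf B l = pfFunctional hB hd
      (l.map fun i => ExteriorAlgebra.ι R (Pi.single i (1 : R) : ι → R)).prod := by
  induction h : l.length using Nat.strong_induction_on generalizing l with
  | _ n ih =>
    cases l with
    | nil =>
      simp [Pf_nil, pfFunctional, CliffordAlgebra.changeForm_one]
    | cons i l =>
      rw [Pf_cons, List.map_cons, List.prod_cons]
      have key : ∀ (m : ι → R) (x : ExteriorAlgebra R (ι → R)),
          pfFunctional hB hd (ExteriorAlgebra.ι R m * x) =
            pfFunctional hB hd (CliffordAlgebra.contractLeft (Matrix.toBilin' B m) x) := by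
        intro m x
        simp only [pfFunctional, LinearMap.comp_apply]
        erw [CliffordAlgebra.changeForm_ι_mul]
        rw [CliffordAlgebra.changeForm_contractLeft, map_sub]
        -- A product with a generator on the left has no scalar part, so only the contraction
        -- survives.
        have h0 : (ExteriorAlgebra.algebraMapInv (R := R) (M := ι → R)).toLinearMap
            (CliffordAlgebra.ι 0 m *
              (CliffordAlgebra.changeForm (neg_toBilin'_toQuadraticMap hB hd)) x) = 0 := by
          rw [AlgHom.toLinearMap_apply, map_mul]
          erw [ExteriorAlgebra.algebraMapInv, ExteriorAlgebra.lift_ι_apply]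
          simp
        erw [h0]
        simp
      rw [key]
      erw [contractLeft_list_prod]
      rw [map_sum]
      refine Finset.sum_congr rfl fun k _ => ?_
      have hk : (l.eraseIdx k).length < n := by
        have := k.isLt
        rw [← h, List.length_eraseIdx_of_lt k.isLt, List.length_cons]
        omega
      rw [ih _ hk (l.eraseIdx k) rfl, map_smul, Matrix.toBilin'_single, smul_eq_mul]

theorem Pf_swap {B : Matrix ι ι R} (hB : B.transpose = -B) (hd : ∀ i, B i i = 0)
    (l₁ l₂ : List ι) (a b : ι) :
    Pf B (l₁ ++ a :: b :: l₂) = -Pf B (l₁ ++ b :: a :: l₂) := by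
  rw [Pf_eq_pfFunctional hB hd, Pf_eq_pfFunctional hB hd, ← map_neg]
  congr 1
  simp only [List.map_append, List.map_cons, List.prod_append, List.prod_cons]
  rw [← mul_neg, ← mul_assoc (ExteriorAlgebra.ι R (Pi.single a (1 : R) : ι → R)), ← mul_assoc (ExteriorAlgebra.ι R (Pi.single b (1 : R) : ι → R)), ← neg_mul]
  congr 2
  exact eq_neg_of_add_eq_zero_left (ExteriorAlgebra.ι_add_mul_swap _ _)

theorem Pf_move {B : Matrix ι ι R} (hB : B.transpose = -B) (hd : ∀ i, B i i = 0)
    (m l : List ι) (a : ι) :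
    Pf B (a :: (m ++ l)) = (-1) ^ m.length * Pf B (m ++ a :: l) := by
  suffices h : ∀ p : List ι, Pf B (p ++ a :: (m ++ l)) =
      (-1) ^ m.length * Pf B (p ++ (m ++ a :: l)) from h []
  induction m with
  | nil => simp
  | cons b m ih =>
    intro p
    have := ih (p ++ [b])
    simp only [List.append_assoc, List.singleton_append] at this
    rw [List.cons_append, Pf_swap hB hd, this, List.length_cons, List.cons_append]
    ring

/-- A repeated row: the first copy is moved next to the second, and exchanging the two changes the
sign. -/
theorem Pf_cons_of_mem {B : Matrix ι ι ℝ} (hB : B.transpose = -B) (hd : ∀ i, B i i = 0)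
    {a : ι} {l : List ι} (h : a ∈ l) : Pf B (a :: l) = 0 := by
  obtain ⟨m, l, rfl⟩ := List.append_of_mem h
  rw [Pf_move hB hd]
  have := Pf_swap hB hd m l a a
  have : Pf B (m ++ a :: a :: l) = 0 := by linarith
  rw [this, mul_zero]

end Pfaffian

/-! ### Signs of arrangements -/

section ArrangementSign

variable {ι : Type*} (rank : ι → ℕ)

theorem arrangementSign_swap (p l : List ι) {a b : ι} (h : rank a ≠ rank b) :
    arrangementSign rank (p ++ a :: b :: l) = -arrangementSign rank (p ++ b :: a :: l) := by
  induction p with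
  | nil =>
    simp only [List.nil_append, arrangementSign, List.countP_cons]
    rcases lt_or_gt_of_ne h with h | h
    · simp [h, h.not_gt, pow_add]; ring
    · simp [h, h.not_gt, pow_add]; ring
  | cons c p ih =>
    simp only [List.cons_append, arrangementSign, ih, List.countP_append, List.countP_cons]
    ring

theorem arrangementSign_move (p m l : List ι) {a : ι} (h : ∀ b ∈ m, rank a ≠ rank b) :
    arrangementSign rank (p ++ a :: (m ++ l)) =
      (-1) ^ m.length * arrangementSign rank (p ++ (m ++ a :: l)) := by
  induction m generalizing p with
  | nil => simp
  | cons b m ih =>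
    have := ih (p ++ [b]) fun c hc => h c (List.mem_cons_of_mem _ hc)
    simp only [List.append_assoc, List.singleton_append] at this
    rw [List.cons_append, arrangementSign_swap rank p _ (h b (by simp)), this, List.length_cons,
      List.cons_append]
    ring

theorem arrangementSign_sq (l : List ι) : arrangementSign rank l ^ 2 = 1 := by
  induction l with
  | nil => simp [arrangementSign]
  | cons a l ih =>
    rw [arrangementSign, mul_pow, ih, mul_one, ← pow_mul, mul_comm, pow_mul]
    simp

end ArrangementSign

/-! ### Signed complementary Pfaffians -/

section SignedPfaffian

variable {ι : Type*} [DecidableEq ι]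

/-- The Pfaffian of `B` on the complement of `l` in `vl`, with the signature of the permutation
that moves `l` to the end (and `0` if `l` has repeated entries). -/
def signedPf (vl : List ι) (rank : ι → ℕ) (B : Matrix ι ι ℝ) (l : List ι) : ℝ :=
  if l.Nodup then
    (arrangementSign rank (vl.filter (fun x => decide (x ∉ l)) ++ l) : ℝ) *
      Pf B (vl.filter fun x => decide (x ∉ l))
  else 0

/-- The elements of `K`, in the reverse of the order of `vl`. -/
def revList (vl : List ι) (K : Finset ι) : List ι := (vl.filter fun x => decide (x ∈ K)).reverse

variable {vl : List ι} {rank : ι → ℕ} {B : Matrix ι ι ℝ}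

theorem mem_revList (hc : ∀ i, i ∈ vl) {K : Finset ι} {i : ι} : i ∈ revList vl K ↔ i ∈ K := by
  simp [revList, hc]

theorem revList_nodup (hn : vl.Nodup) (K : Finset ι) : (revList vl K).Nodup :=
  List.nodup_reverse.2 (hn.filter _)

theorem filter_notMem_cons (hn : vl.Nodup) (a : ι) (l : List ι) :
    (vl.filter fun x => decide (x ∉ a :: l)) = (vl.filter fun x => decide (x ∉ l)).erase a := by
  rw [(hn.filter _).erase_eq_filter, List.filter_filter]
  congr 1
  ext x
  by_cases h : x = a <;> simp [h]

theorem signedPf_of_not_nodup {l : List ι} (h : ¬ l.Nodup) : signedPf vl rank B l = 0 := by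
  rw [signedPf, if_neg h]

/-- Swapping two deleted variables leaves the complement alone and adds one inversion to the
arrangement. With the value `0` on repetitions, `signedPf` is alternating in its list. -/
theorem signedPf_swap (hr : Function.Injective rank) (p l : List ι) (a b : ι) :
    signedPf vl rank B (p ++ a :: b :: l) = -signedPf vl rank B (p ++ b :: a :: l) := by
  have hperm : List.Perm (p ++ a :: b :: l) (p ++ b :: a :: l) :=
    List.Perm.append_left p (List.Perm.swap _ _ _)
  by_cases h : (p ++ a :: b :: l).Nodup
  · have h' : (p ++ b :: a :: l).Nodup := hperm.nodup_iff.1 h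
    have hab : a ≠ b := by
      rintro rfl
      have := (List.nodup_append.1 h).2.1
      simp at this
    have hf : (vl.filter fun x => decide (x ∉ p ++ a :: b :: l)) =
        vl.filter fun x => decide (x ∉ p ++ b :: a :: l) := by
      congr 1
      ext x
      exact decide_eq_decide.2 (not_congr hperm.mem_iff)
    rw [signedPf, signedPf, if_pos h, if_pos h', hf, ← List.append_assoc, arrangementSign_swap rank
      _ _ (hr.ne hab), List.append_assoc]
    push_cast
    ring
  · have h' : ¬ (p ++ b :: a :: l).Nodup := fun h' => h (hperm.nodup_iff.2 h')
    rw [signedPf_of_not_nodup h, signedPf_of_not_nodup h', neg_zero]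

theorem signedPf_move (hr : Function.Injective rank) (p m l : List ι) (a : ι) :
    signedPf vl rank B (p ++ a :: (m ++ l)) =
      (-1) ^ m.length * signedPf vl rank B (p ++ (m ++ a :: l)) := by
  induction m generalizing p with
  | nil => simp
  | cons b m ih =>
    have := ih (p ++ [b])
    simp only [List.append_assoc, List.singleton_append] at this
    rw [List.cons_append, signedPf_swap hr, this, List.length_cons, List.cons_append]
    ring

/-- Taking an element of `K` to the front changes the sign at most. -/
theorem signedPf_revList_insert (hr : Function.Injective rank) (hn : vl.Nodup)
    (hc : ∀ i, i ∈ vl) {K : Finset ι} {τ : ι} (hτ : τ ∉ K) :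
    ∃ ε : ℝ, ε * ε = 1 ∧ ∀ p, signedPf vl rank B (p ++ revList vl (insert τ K)) =
      ε * signedPf vl rank B (p ++ τ :: revList vl K) := by
  obtain ⟨m, l, hml⟩ := List.append_of_mem ((mem_revList hc (K := insert τ K)).2
    (Finset.mem_insert_self τ K))
  have hnd := revList_nodup hn (insert τ K)
  have hK : revList vl K = m ++ l := by
    have h1 : revList vl K = (revList vl (insert τ K)).filter fun x => decide (x ≠ τ) := by
      rw [revList, revList, List.filter_reverse, List.filter_filter]
      congr 2
      ext x
      by_cases hx : x = τ
      · subst hx; simp [hτ]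
      · simp [hx]
    rw [h1, hml]
    rw [hml] at hnd
    rw [List.nodup_middle] at hnd
    have h2 := (List.nodup_cons.1 hnd).1
    rw [List.filter_append, List.filter_cons_of_neg (by simp)]
    congr 1
    · rw [List.filter_eq_self]
      intro a ha
      simp only [decide_eq_true_eq]
      rintro rfl
      exact h2 (List.mem_append_left _ ha)
    · rw [List.filter_eq_self]
      intro a ha
      simp only [decide_eq_true_eq]
      rintro rfl
      exact h2 (List.mem_append_right _ ha)
  refine ⟨(-1) ^ m.length, ?_, fun p => ?_⟩
  · rw [← pow_add, ← two_mul, pow_mul]; simp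
  · rw [hK, signedPf_move hr, hml, ← mul_assoc, ← pow_add, ← two_mul, pow_mul]
    simp

variable [Fintype ι]

/-- Deleting one more variable `i` and summing against the row of `τ` rebuilds a Pfaffian with `τ`
put in front of the remaining list. Both identities below are read off from the position of `τ`. -/
theorem sum_mul_signedPf_cons (hr : Function.Injective rank) (hn : vl.Nodup)
    (hc : ∀ i, i ∈ vl) {l : List ι} (hl : l.Nodup) (τ : ι) :
    ∑ i, B τ i * signedPf vl rank B (i :: l) =
      (-1) ^ ((vl.filter fun x => decide (x ∉ l)).length + 1) *
        (arrangementSign rank (vl.filter (fun x => decide (x ∉ l)) ++ l) : ℝ) *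
          Pf B (τ :: vl.filter fun x => decide (x ∉ l)) := by
  set ρ := vl.filter fun x => decide (x ∉ l) with hρ
  have hρn : ρ.Nodup := hn.filter _
  have hmem : ∀ i, i ∈ ρ ↔ i ∉ l := by simp [hρ, hc]
  have h1 : ∑ i, B τ i * signedPf vl rank B (i :: l) =
      ∑ i ∈ ρ.toFinset, B τ i * signedPf vl rank B (i :: l) := by
    symm
    refine Finset.sum_subset (Finset.subset_univ _) fun i _ hi => ?_
    rw [List.mem_toFinset, hmem, not_not] at hi
    rw [signedPf_of_not_nodup (by simp [hi]), mul_zero]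
  rw [h1, List.sum_toFinset _ hρn, Pf_cons, Finset.mul_sum, ← List.sum_ofFn]
  congr 1
  refine List.ext_getElem (by simp) fun k hk hk' => ?_
  rw [List.length_map] at hk
  rw [List.getElem_map, List.getElem_ofFn]
  simp only [List.get_eq_getElem]
  have hil : ρ[k] ∉ l := (hmem _).1 (List.getElem_mem _)
  have hf : (vl.filter fun x => decide (x ∉ ρ[k] :: l)) = ρ.eraseIdx k := by
    rw [filter_notMem_cons hn, ← hρ, ← List.Nodup.erase_getElem hρn k hk]
  have hs : ρ = ρ.take k ++ ρ[k] :: ρ.drop (k + 1) := by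
    rw [List.getElem_cons_drop, List.take_append_drop]
  have he : ρ.eraseIdx k = ρ.take k ++ ρ.drop (k + 1) := List.eraseIdx_eq_take_drop_succ _ _
  have hsign : (arrangementSign rank (ρ ++ l) : ℝ) = (-1) ^ (ρ.length - (k + 1)) *
      (arrangementSign rank (ρ.eraseIdx k ++ ρ[k] :: l) : ℝ) := by
    have := arrangementSign_move rank (ρ.take k) (ρ.drop (k + 1)) l (a := ρ[k]) (by
      intro b hb
      refine hr.ne ?_
      rintro rfl
      rw [hs] at hρn
      rw [List.nodup_middle] at hρn
      exact (List.nodup_cons.1 hρn).1 (List.mem_append_right _ hb))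
    rw [he, List.append_assoc]
    nth_rewrite 1 [hs]
    rw [List.append_assoc, List.cons_append, this, List.length_drop]
    push_cast
    ring
  rw [signedPf, if_pos (List.nodup_cons.2 ⟨hil, hl⟩), hf]
  -- The sign `(-1)^k` of the expansion combines with that of carrying the `k`-th entry past the
  -- later ones, so the total sign does not depend on `k`.
  have hp : ((-1 : ℝ)) ^ (ρ.length + 1) * (-1) ^ (ρ.length - (k + 1)) * (-1) ^ k = 1 := by
    rw [← pow_add, ← pow_add]
    have : ρ.length + 1 + (ρ.length - (k + 1)) + k = 2 * ρ.length := by omega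
    rw [this, pow_mul]; simp
  linear_combination (-((-1) ^ (ρ.length + 1) * (-1) ^ k * B τ ρ[k] * Pf B (ρ.eraseIdx k))) * hsign +
    (-(B τ ρ[k] * arrangementSign rank (ρ.eraseIdx k ++ ρ[k] :: l) *
    Pf B (ρ.eraseIdx k))) * hp

/-- If `τ` has not been deleted, the rebuilt Pfaffian has the row of `τ` twice. -/
theorem sum_mul_signedPf_cons_of_notMem (hB : B.transpose = -B) (hd : ∀ i, B i i = 0)
    (hr : Function.Injective rank) (hn : vl.Nodup) (hc : ∀ i, i ∈ vl) {l : List ι}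
    (hl : l.Nodup) {τ : ι} (hτ : τ ∉ l) :
    ∑ i, B τ i * signedPf vl rank B (i :: l) = 0 := by
  rw [sum_mul_signedPf_cons hr hn hc hl, Pf_cons_of_mem hB hd (by simp [hc, hτ]), mul_zero]

/-- If `τ` has been deleted, the rebuilt Pfaffian is the one in which `τ` is restored. The two
moves, of `τ` in the Pfaffian and in the arrangement, leave the overall sign `-1`. -/
theorem sum_mul_signedPf_cons_cons (hB : B.transpose = -B) (hd : ∀ i, B i i = 0)
    (hr : Function.Injective rank) (hn : vl.Nodup) (hc : ∀ i, i ∈ vl) {l : List ι} {τ : ι}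
    (hl : (τ :: l).Nodup) :
    ∑ i, B τ i * signedPf vl rank B (i :: τ :: l) = -signedPf vl rank B l := by
  rw [sum_mul_signedPf_cons hr hn hc hl, signedPf, if_pos (List.nodup_cons.1 hl).2]
  set ρ := vl.filter fun x => decide (x ∉ l) with hρ
  have hρn : ρ.Nodup := hn.filter _
  have hmem : τ ∈ ρ := by simp [hρ, hc, (List.nodup_cons.1 hl).1]
  obtain ⟨m, q, hmq⟩ := List.append_of_mem hmem
  have hf : (vl.filter fun x => decide (x ∉ τ :: l)) = m ++ q := by
    have hτm : τ ∉ m := by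
      rw [hmq, List.nodup_middle] at hρn
      exact fun h => (List.nodup_cons.1 hρn).1 (List.mem_append_left _ h)
    rw [filter_notMem_cons hn, ← hρ, hmq, List.erase_append_right _ hτm, List.erase_cons_head]
  have hnd : (m ++ q).Nodup ∧ τ ∉ m ++ q := by
    rw [hmq, List.nodup_middle] at hρn
    exact ⟨(List.nodup_cons.1 hρn).2, (List.nodup_cons.1 hρn).1⟩
  rw [hf, Pf_move hB hd, hmq]
  have hsign := arrangementSign_move rank m q l (a := τ) (by
    intro b hb
    refine hr.ne ?_
    rintro rfl
    exact hnd.2 (List.mem_append_right _ hb))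
  rw [List.append_assoc, List.append_assoc, List.cons_append, hsign, List.length_append]
  push_cast
  have hp : ((-1 : ℝ)) ^ (m.length + q.length + 1) * (-1) ^ m.length = -(-1) ^ q.length := by
    rw [← pow_add]
    have : m.length + q.length + 1 + m.length = 2 * m.length + (q.length + 1) := by omega
    rw [this, pow_add, pow_mul]
    simp [pow_succ]
  linear_combination (arrangementSign rank (m ++ (q ++ τ :: l)) * Pf B (m ++ τ :: q) : ℝ) * hp

/-- The contribution of `K` to the entries of `det (A + B) (A + B)⁻¹`. -/
def resolventTerm (vl : List ι) (rank : ι → ℕ) (B : Matrix ι ι ℝ) (K : Finset ι) (i j : ι) : ℝ :=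
  signedPf vl rank B (i :: revList vl K) * signedPf vl rank B (j :: revList vl K) -
    signedPf vl rank B (revList vl K) * signedPf vl rank B (i :: j :: revList vl K)

theorem sum_mul_resolventTerm_of_notMem (hB : B.transpose = -B) (hd : ∀ i, B i i = 0)
    (hr : Function.Injective rank) (hn : vl.Nodup) (hc : ∀ i, i ∈ vl) {K : Finset ι} {τ : ι}
    (hτ : τ ∉ K) (j : ι) :
    ∑ i, B τ i * resolventTerm vl rank B K i j =
      if τ = j then signedPf vl rank B (revList vl K) ^ 2 else 0 := by
  have hnd := revList_nodup (vl := vl) hn K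
  have hτ' : τ ∉ revList vl K := fun h => hτ ((mem_revList hc).1 h)
  have h1 := sum_mul_signedPf_cons_of_notMem hB hd hr hn hc hnd hτ'
  have hsplit : ∑ i, B τ i * resolventTerm vl rank B K i j =
      (∑ i, B τ i * signedPf vl rank B (i :: revList vl K)) *
        signedPf vl rank B (j :: revList vl K) - signedPf vl rank B (revList vl K) *
          ∑ i, B τ i * signedPf vl rank B (i :: j :: revList vl K) := by
    rw [Finset.sum_mul, Finset.mul_sum, ← Finset.sum_sub_distrib]
    refine Finset.sum_congr rfl fun i _ => ?_
    rw [resolventTerm]; ring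
  rw [hsplit, h1, zero_mul, zero_sub]
  split_ifs with hj
  · subst hj
    rw [sum_mul_signedPf_cons_cons hB hd hr hn hc (List.nodup_cons.2 ⟨hτ', hnd⟩)]
    ring
  · by_cases hjK : j ∈ revList vl K
    · rw [Finset.sum_eq_zero, mul_zero, neg_zero]
      intro i _
      rw [signedPf_of_not_nodup, mul_zero]
      simp [hjK]
    · rw [sum_mul_signedPf_cons_of_notMem hB hd hr hn hc (List.nodup_cons.2 ⟨hjK, hnd⟩) (by
        simp [hj, hτ']), mul_zero, neg_zero]

/-- This is the coefficient of `A τ ∏_K A` in an entry of `(A + B) · resolventSum`: the diagonal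
contributes through `K` and the row of `B` through `insert τ K`. For `j` different from `τ` and
outside `K`, they cancel because `signedPf` is alternating in `τ` and `j`. -/
theorem resolventTerm_add_sum_mul (hB : B.transpose = -B) (hd : ∀ i, B i i = 0)
    (hr : Function.Injective rank) (hn : vl.Nodup) (hc : ∀ i, i ∈ vl) {K : Finset ι} {τ : ι}
    (hτ : τ ∉ K) (j : ι) :
    resolventTerm vl rank B K τ j + ∑ i, B τ i * resolventTerm vl rank B (insert τ K) i j =
      if τ = j then signedPf vl rank B (revList vl (insert τ K)) ^ 2 else 0 := by
  have hnd := revList_nodup (vl := vl) hn K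
  have hτ' : τ ∉ revList vl K := fun h => hτ ((mem_revList hc).1 h)
  obtain ⟨ε, hε, hp⟩ := signedPf_revList_insert (B := B) hr hn hc hτ
  have hp0 := hp []
  have hp1 : ∀ i, signedPf vl rank B (i :: revList vl (insert τ K)) =
      ε * signedPf vl rank B (i :: τ :: revList vl K) := fun i => hp [i]
  have hp2 : ∀ i j, signedPf vl rank B (i :: j :: revList vl (insert τ K)) =
      ε * signedPf vl rank B (i :: j :: τ :: revList vl K) := fun i j => hp [i, j]
  rw [List.nil_append, List.nil_append] at hp0
  have hsplit : ∑ i, B τ i * resolventTerm vl rank B (insert τ K) i j =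
      (∑ i, B τ i * signedPf vl rank B (i :: τ :: revList vl K)) *
        signedPf vl rank B (j :: τ :: revList vl K) - signedPf vl rank B (τ :: revList vl K) *
          ∑ i, B τ i * signedPf vl rank B (i :: j :: τ :: revList vl K) := by
    rw [Finset.sum_mul, Finset.mul_sum, ← Finset.sum_sub_distrib]
    refine Finset.sum_congr rfl fun i _ => ?_
    rw [resolventTerm, hp0, hp1, hp1, hp2]
    linear_combination (B τ i * (signedPf vl rank B (i :: τ :: revList vl K) *
      signedPf vl rank B (j :: τ :: revList vl K) - signedPf vl rank B (τ :: revList vl K) *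
        signedPf vl rank B (i :: j :: τ :: revList vl K))) * hε
  rw [hsplit, sum_mul_signedPf_cons_cons hB hd hr hn hc (List.nodup_cons.2 ⟨hτ', hnd⟩),
    resolventTerm]
  split_ifs with hj
  · subst hj
    rw [signedPf_of_not_nodup (l := τ :: τ :: revList vl K) (by simp), hp0,
      Finset.sum_eq_zero (fun i _ => by
        rw [signedPf_of_not_nodup (l := i :: τ :: τ :: revList vl K) (by simp), mul_zero])]
    linear_combination (-signedPf vl rank B (τ :: revList vl K) ^ 2) * hε
  · by_cases hjK : j ∈ revList vl K
    · rw [signedPf_of_not_nodup (l := j :: revList vl K) (by simp [hjK]),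
        signedPf_of_not_nodup (l := τ :: j :: revList vl K) (by simp [hjK]),
        signedPf_of_not_nodup (l := j :: τ :: revList vl K) (by simp [hjK]),
        Finset.sum_eq_zero (fun i _ => by
          rw [signedPf_of_not_nodup (l := i :: j :: τ :: revList vl K) (by simp [hjK]), mul_zero])]
      ring
    · have hs : ∀ i, signedPf vl rank B (i :: j :: τ :: revList vl K) =
          -signedPf vl rank B (i :: τ :: j :: revList vl K) := fun i =>
        signedPf_swap hr [i] (revList vl K) j τ
      have hs' : signedPf vl rank B (j :: τ :: revList vl K) =
          -signedPf vl rank B (τ :: j :: revList vl K) := signedPf_swap hr [] (revList vl K) j τ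
      have h3 := sum_mul_signedPf_cons_cons hB hd hr hn hc (l := j :: revList vl K) (τ := τ)
        (List.nodup_cons.2 ⟨by simp [hj, hτ'], List.nodup_cons.2 ⟨hjK, hnd⟩⟩)
      simp only [hs, mul_neg, Finset.sum_neg_distrib, h3, hs']
      ring

/-- The expansion of `det (A + B)` in squares of Pfaffians. -/
def pfaffianSum (vl : List ι) (rank : ι → ℕ) (A : ι → ℝ) (B : Matrix ι ι ℝ) : ℝ :=
  ∑ K : Finset ι, (∏ i ∈ K, A i) * signedPf vl rank B (revList vl K) ^ 2

/-- The expansion of `det (A + B) (A + B)⁻¹`. -/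
def resolventSum (vl : List ι) (rank : ι → ℕ) (A : ι → ℝ) (B : Matrix ι ι ℝ) : Matrix ι ι ℝ :=
  fun i j => ∑ K : Finset ι, (∏ i ∈ K, A i) * resolventTerm vl rank B K i j

theorem sum_finset_eq_sum_insert {M : Type*} [AddCommMonoid M] (τ : ι) (f : Finset ι → M) :
    ∑ K, f K = ∑ K ∈ (Finset.univ.erase τ).powerset, (f K + f (insert τ K)) := by
  rw [Finset.sum_add_distrib, ← Finset.sum_powerset_insert (by simp),
    Finset.insert_erase (Finset.mem_univ _), Finset.powerset_univ]

/-- Subsets are paired as `K` and `insert τ K` with `τ ∉ K`, where `τ` is the row. Of the four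
contributions, the diagonal entry acting on `insert τ K` vanishes, since `τ` is deleted twice; the
other three are the two preceding identities. -/
theorem diagonal_add_mul_resolventSum (hB : B.transpose = -B) (hd : ∀ i, B i i = 0)
    (hr : Function.Injective rank) (hn : vl.Nodup) (hc : ∀ i, i ∈ vl) (A : ι → ℝ) :
    (Matrix.diagonal A + B) * resolventSum vl rank A B = pfaffianSum vl rank A B • 1 := by
  ext τ j
  rw [add_mul, Matrix.add_apply, Matrix.diagonal_mul, Matrix.mul_apply, Matrix.smul_apply,
    Matrix.one_apply, smul_eq_mul, mul_ite, mul_one, mul_zero]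
  simp only [resolventSum, pfaffianSum]
  have h1 : ∑ x, B τ x * ∑ K : Finset ι, (∏ i ∈ K, A i) * resolventTerm vl rank B K x j =
      ∑ K : Finset ι, (∏ i ∈ K, A i) * ∑ x, B τ x * resolventTerm vl rank B K x j := by
    simp only [Finset.mul_sum]
    rw [Finset.sum_comm]
    refine Finset.sum_congr rfl fun K _ => Finset.sum_congr rfl fun x _ => by ring
  rw [h1, sum_finset_eq_sum_insert τ, sum_finset_eq_sum_insert τ, sum_finset_eq_sum_insert τ,
    Finset.mul_sum, ← Finset.sum_add_distrib]
  rw [← Finset.sum_const_zero (s := (Finset.univ.erase τ).powerset), ← Finset.sum_ite_irrel]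
  refine Finset.sum_congr rfl fun K hK => ?_
  have hτ : τ ∉ K := fun h => by
    have := Finset.mem_powerset.1 hK h
    simp at this
  have e1 := sum_mul_resolventTerm_of_notMem hB hd hr hn hc hτ j
  have e2 := resolventTerm_add_sum_mul hB hd hr hn hc hτ j
  have e3 : resolventTerm vl rank B (insert τ K) τ j = 0 := by
    rw [resolventTerm, signedPf_of_not_nodup, signedPf_of_not_nodup (l := τ :: j :: _)]
    · ring
    · simp [mem_revList hc]
    · simp [mem_revList hc]
  rw [Finset.prod_insert hτ, e1, e3]
  by_cases hj : τ = j
  · simp only [if_pos hj] at e2 ⊢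
    linear_combination (A τ * ∏ i ∈ K, A i) * e2
  · simp only [if_neg hj] at e2 ⊢
    linear_combination (A τ * ∏ i ∈ K, A i) * e2

end SignedPfaffian

/-! ### Determinant and inverse of a diagonal plus an antisymmetric matrix -/

section SignedPfaffian

variable {ι : Type*} [DecidableEq ι] {vl : List ι} {rank : ι → ℕ} {B : Matrix ι ι ℝ} [Fintype ι]

theorem det_add_single (M : Matrix ι ι ℝ) (τ : ι) (x : ℝ) :
    (M + Matrix.single τ τ x).det = M.det + x * M.adjugate τ τ := by
  have h : M + Matrix.single τ τ x = M.updateRow τ (M τ + x • Pi.single τ 1) := by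
    ext i j
    rw [Matrix.updateRow_apply]
    split_ifs with hi
    · subst hi
      by_cases hj : j = i
      · subst hj; simp
      · simp [hj, Ne.symm hj]
    · simp [Matrix.single_apply_of_row_ne (Ne.symm hi)]
  rw [h, Matrix.det_updateRow_add, Matrix.det_updateRow_smul, Matrix.updateRow_eq_self,
    Matrix.adjugate_apply]

/-- The sum is affine in the entry `A τ`. Its slope collects the squares with `τ` deleted on top of
`K`, and these are the diagonal resolvent terms, since deleting `τ` twice gives zero. -/
theorem pfaffianSum_add_single (hr : Function.Injective rank) (hn : vl.Nodup)
    (hc : ∀ i, i ∈ vl) (A : ι → ℝ) (τ : ι) (x : ℝ) :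
    pfaffianSum vl rank (A + Pi.single τ x) B =
      pfaffianSum vl rank A B + x * resolventSum vl rank A B τ τ := by
  rw [pfaffianSum, pfaffianSum, resolventSum, sum_finset_eq_sum_insert τ,
    sum_finset_eq_sum_insert τ, sum_finset_eq_sum_insert τ, Finset.mul_sum,
    ← Finset.sum_add_distrib]
  refine Finset.sum_congr rfl fun K hK => ?_
  have hτ : τ ∉ K := fun h => by
    have := Finset.mem_powerset.1 hK h
    simp at this
  obtain ⟨ε, hε, hp⟩ := signedPf_revList_insert (B := B) hr hn hc hτ
  have hp0 : signedPf vl rank B (revList vl (insert τ K)) =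
    ε * signedPf vl rank B (τ :: revList vl K) := hp []
  have h1 : ∏ i ∈ K, (A + Pi.single τ x : ι → ℝ) i = ∏ i ∈ K, A i :=
    Finset.prod_congr rfl fun i hi => by
      have : i ≠ τ := fun h => hτ (h ▸ hi)
      simp [this]
  rw [Finset.prod_insert hτ, Finset.prod_insert hτ, h1, hp0, resolventTerm, resolventTerm,
    signedPf_of_not_nodup (l := τ :: τ :: _) (by simp),
    signedPf_of_not_nodup (l := τ :: τ :: _) (by simp),
    signedPf_of_not_nodup (l := τ :: revList vl (insert τ K)) (by simp [mem_revList hc])]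
  simp only [Pi.add_apply, Pi.single_eq_same]
  linear_combination (x * (∏ i ∈ K, A i) * signedPf vl rank B (τ :: revList vl K) ^ 2) * hε

/-- Computing `adj (A + B) · (A + B) · resolventSum` in two ways gives `det · resolventSum =
pfaffianSum · adj`. The determinant and the sum are both affine in `A τ`, with slopes the diagonal
entries of `adj` and of `resolventSum`, so they vary proportionally. -/
theorem det_mul_pfaffianSum_add_single (hB : B.transpose = -B) (hd : ∀ i, B i i = 0)
    (hr : Function.Injective rank) (hn : vl.Nodup)
    (hc : ∀ i, i ∈ vl) (A : ι → ℝ) (τ : ι) (x : ℝ) :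
    (Matrix.diagonal (A + Pi.single τ x) + B).det * pfaffianSum vl rank A B =
      (Matrix.diagonal A + B).det * pfaffianSum vl rank (A + Pi.single τ x) B := by
  have h1 : Matrix.diagonal (A + Pi.single τ x) + B =
      (Matrix.diagonal A + B) + Matrix.single τ τ x := by
    have : Matrix.diagonal (A + Pi.single τ x) = Matrix.diagonal A + Matrix.single τ τ x := by
      rw [← Matrix.diagonal_single, Matrix.diagonal_add]; rfl
    rw [this]; abel
  have h2 := congrArg (fun M => (Matrix.diagonal A + B).adjugate * M)
    (diagonal_add_mul_resolventSum hB hd hr hn hc A)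
  simp only [← mul_assoc, Matrix.adjugate_mul] at h2
  have h3 := congrFun (congrFun h2 τ) τ
  simp only [Matrix.smul_mul, one_mul, Matrix.mul_smul, mul_one, Matrix.smul_apply,
    smul_eq_mul] at h3
  rw [h1, det_add_single, pfaffianSum_add_single hr hn hc]
  linear_combination -x * h3

theorem signedPf_revList_univ (hn : vl.Nodup) (hc : ∀ i, i ∈ vl) :
    signedPf vl rank B (revList vl Finset.univ) ^ 2 = 1 := by
  have : (vl.filter fun x => decide (x ∉ revList vl Finset.univ)) = [] := by
    rw [List.filter_eq_nil_iff]
    intro a _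
    simp [mem_revList hc]
  rw [signedPf, if_pos (revList_nodup hn _), this, Pf_nil, mul_one]
  exact_mod_cast arrangementSign_sq rank _

theorem pfaffianSum_pos (hn : vl.Nodup) (hc : ∀ i, i ∈ vl) {A : ι → ℝ} (hA : ∀ i, 0 < A i) :
    0 < pfaffianSum vl rank A B := by
  refine Finset.sum_pos' (fun K _ => mul_nonneg (Finset.prod_nonneg fun i _ => (hA i).le)
    (sq_nonneg _)) ⟨Finset.univ, Finset.mem_univ _, ?_⟩
  rw [signedPf_revList_univ hn hc, mul_one]
  exact Finset.prod_pos fun i _ => hA i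

theorem det_mul_pfaffianSum_comm (hB : B.transpose = -B) (hd : ∀ i, B i i = 0)
    (hr : Function.Injective rank) (hn : vl.Nodup)
    (hc : ∀ i, i ∈ vl) {A A' : ι → ℝ} (hA : ∀ i, 0 < A i) (hA' : ∀ i, 0 < A' i) :
    (Matrix.diagonal A' + B).det * pfaffianSum vl rank A B =
      (Matrix.diagonal A + B).det * pfaffianSum vl rank A' B := by
  -- The diagonal is changed from `A` to `A'` one entry at a time; positivity of the sum at each
  -- stage allows cancellation.
  suffices h : ∀ s : Finset ι, (Matrix.diagonal (s.piecewise A' A) + B).det *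
      pfaffianSum vl rank A B = (Matrix.diagonal A + B).det *
        pfaffianSum vl rank (s.piecewise A' A) B by
    simpa using h Finset.univ
  intro s
  induction s using Finset.induction_on with
  | empty => simp
  | insert τ s hτ ih =>
    have hpos : 0 < pfaffianSum vl rank (s.piecewise A' A) B :=
      pfaffianSum_pos hn hc fun i => by
        by_cases h : i ∈ s <;> simp [h, hA, hA']
    have hup : (insert τ s).piecewise A' A =
        s.piecewise A' A + Pi.single τ (A' τ - A τ) := by
      ext i
      by_cases hi : i = τ
      · subst hi; simp [hτ]
      · by_cases h : i ∈ s <;> simp [h, hi]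
    have h1 := det_mul_pfaffianSum_add_single hB hd hr hn hc (s.piecewise A' A) τ (A' τ - A τ)
    rw [← hup] at h1
    refine mul_right_cancel₀ hpos.ne' ?_
    linear_combination pfaffianSum vl rank A B * h1 +
      pfaffianSum vl rank ((insert τ s).piecewise A' A) B * ih

theorem continuous_pfaffianSum : Continuous fun A => pfaffianSum vl rank A B := by
  unfold pfaffianSum
  fun_prop

/-- `det (A + B)` is the sum over `K` of `∏_K A` times the square of the Pfaffian of `B` on the
complement of `K`. -/
theorem det_diagonal_add_eq_pfaffianSum (hB : B.transpose = -B) (hd : ∀ i, B i i = 0)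
    (hr : Function.Injective rank) (hn : vl.Nodup)
    (hc : ∀ i, i ∈ vl) {A : ι → ℝ} (hA : ∀ i, 0 ≤ A i) :
    (Matrix.diagonal A + B).det = pfaffianSum vl rank A B := by
  have hcomm : ∀ {A A' : ι → ℝ}, (∀ i, 0 < A i) → (∀ i, 0 < A' i) → _ := fun {A A'} =>
    det_mul_pfaffianSum_comm (A := A) (A' := A') hB hd hr hn hc
  have hcontd : ∀ x : ℝ → ι → ℝ, Continuous x →
      Continuous fun y => (Matrix.diagonal (x y) + B).det := fun x hx => by
    refine Continuous.matrix_det (Continuous.add (Continuous.matrix_diagonal hx) continuous_const)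
  obtain ⟨c, hc'⟩ : ∃ c, ∀ A : ι → ℝ, (∀ i, 0 < A i) →
      (Matrix.diagonal A + B).det = c * pfaffianSum vl rank A B := by
    refine ⟨(Matrix.diagonal (1 : ι → ℝ) + B).det / pfaffianSum vl rank 1 B, fun A hA => ?_⟩
    have h1 := pfaffianSum_pos (vl := vl) (rank := rank) (B := B) hn hc (A := 1)
      (fun i => by simp)
    rw [div_mul_eq_mul_div, eq_div_iff h1.ne']
    exact hcomm (fun i => by simp) hA
  -- The constant is found with all entries equal to `y⁻¹`. After multiplication by `y` to the size
  -- of the matrix, as `y → 0⁺`, the determinant tends to `1` and only `K = univ` survives in the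
  -- sum.
  have hone : c = 1 := by
    have hy : ∀ y : ℝ, 0 < y → (1 + y • B).det =
        c * ∑ K : Finset ι, y ^ (Fintype.card ι - K.card) *
          signedPf vl rank B (revList vl K) ^ 2 := by
      intro y hy
      have h := hc' (fun _ => y⁻¹) (fun _ => inv_pos.2 hy)
      have h2 : (1 : Matrix ι ι ℝ) + y • B = y • (Matrix.diagonal (fun _ => y⁻¹) + B) := by
        rw [smul_add]
        congr 1
        rw [← Matrix.diagonal_one, ← Matrix.diagonal_smul]
        congr 1
        ext i
        simp [hy.ne']
      rw [h2, Matrix.det_smul, h, pfaffianSum, mul_left_comm, Finset.mul_sum]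
      congr 1
      refine Finset.sum_congr rfl fun K _ => ?_
      rw [Finset.prod_const, ← mul_assoc, inv_pow, pow_sub₀ _ hy.ne' (Finset.card_le_univ K)]
    have t1 : Filter.Tendsto (fun y : ℝ => (1 + y • B).det) (nhdsWithin 0 (Set.Ioi 0)) (nhds 1) := by
      have : Continuous fun y : ℝ => (1 + y • B).det :=
        Continuous.matrix_det (by fun_prop)
      have h := this.tendsto 0
      simp only [zero_smul, add_zero, Matrix.det_one] at h
      exact h.mono_left nhdsWithin_le_nhds
    have t2 : Filter.Tendsto (fun y : ℝ => c * ∑ K : Finset ι, y ^ (Fintype.card ι - K.card) *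
          signedPf vl rank B (revList vl K) ^ 2) (nhdsWithin 0 (Set.Ioi 0)) (nhds c) := by
      have : Continuous fun y : ℝ => c * ∑ K : Finset ι, y ^ (Fintype.card ι - K.card) *
          signedPf vl rank B (revList vl K) ^ 2 := by fun_prop
      have h := this.tendsto 0
      have h0 : c * ∑ K : Finset ι, (0 : ℝ) ^ (Fintype.card ι - K.card) *
          signedPf vl rank B (revList vl K) ^ 2 = c := by
        rw [Finset.sum_eq_single Finset.univ, signedPf_revList_univ hn hc]
        · simp
        · intro K _ hK
          have : K.card < Fintype.card ι := by
            rw [← Finset.card_univ]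
            exact Finset.card_lt_card (Finset.ssubset_univ_iff.2 hK)
          rw [zero_pow (by omega), zero_mul]
        · simp
      rw [h0] at h
      exact h.mono_left nhdsWithin_le_nhds
    refine tendsto_nhds_unique (t2.congr' ?_) t1
    filter_upwards [self_mem_nhdsWithin] with y h
    exact (hy y h).symm
  subst hone
  -- Vanishing entries, such as those of the hypermomenta, are reached as limits of positive ones.
  have hx : Continuous fun ε : ℝ => fun i => A i + ε := by fun_prop
  have t1 := ((hcontd _ hx).tendsto 0).mono_left (nhdsWithin_le_nhds (s := Set.Ioi 0))
  have t2 := ((continuous_pfaffianSum (vl := vl) (rank := rank) (B := B)).comp hx |>.tendsto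
    0).mono_left (nhdsWithin_le_nhds (s := Set.Ioi 0))
  simp only [Function.comp_def, add_zero] at t1 t2
  refine tendsto_nhds_unique t1 (t2.congr' ?_)
  filter_upwards [self_mem_nhdsWithin] with ε hε
  rw [hc' _ fun i => add_pos_of_nonneg_of_pos (hA i) hε, one_mul]

theorem inv_diagonal_add_eq (hB : B.transpose = -B) (hd : ∀ i, B i i = 0)
    (hr : Function.Injective rank) (hn : vl.Nodup)
    (hc : ∀ i, i ∈ vl) {A : ι → ℝ} (h0 : pfaffianSum vl rank A B ≠ 0) :
    (Matrix.diagonal A + B)⁻¹ = (pfaffianSum vl rank A B)⁻¹ • resolventSum vl rank A B := by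
  refine Matrix.inv_eq_right_inv ?_
  rw [Matrix.mul_smul, diagonal_add_mul_resolventSum hB hd hr hn hc, smul_smul,
    inv_mul_cancel₀ h0, one_smul]

end SignedPfaffian

/-! ### Scaling, locality and vanishing of Pfaffians -/

theorem Pf_scale {ι R : Type*} [CommRing R] (B : Matrix ι ι R) (d : ι → R) (l : List ι) :
    Pf (Matrix.of fun i j => d i * B i j * d j) l = (l.map d).prod * Pf B l := by
  induction h : l.length using Nat.strong_induction_on generalizing l with
  | _ n ih =>
    cases l with
    | nil => simp [Pf_nil]
    | cons i l =>
      rw [Pf_cons, Pf_cons, Finset.mul_sum]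
      refine Finset.sum_congr rfl fun k _ => ?_
      have hk : (l.eraseIdx k).length < n := by
        have := k.isLt
        rw [← h, List.length_eraseIdx_of_lt k.isLt, List.length_cons]
        omega
      have hp : (l.map d).prod = d (l.get k) * ((l.eraseIdx k).map d).prod := by
        rw [← List.prod_cons, ← List.map_cons]
        refine List.Perm.prod_eq (List.Perm.map _ ?_)
        exact (List.getElem_cons_eraseIdx_perm k.isLt).symm
      rw [ih _ hk (l.eraseIdx k) rfl, List.map_cons, List.prod_cons, hp, Matrix.of_apply]
      ring

theorem Pf_congr {ι R : Type*} [CommRing R] {B B' : Matrix ι ι R} {l : List ι}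
    (h : ∀ i ∈ l, ∀ j ∈ l, B i j = B' i j) : Pf B l = Pf B' l := by
  induction hl : l.length using Nat.strong_induction_on generalizing l with
  | _ n ih =>
    cases l with
    | nil => simp [Pf_nil]
    | cons i l =>
      rw [Pf_cons, Pf_cons]
      refine Finset.sum_congr rfl fun k _ => ?_
      have hk : (l.eraseIdx k).length < n := by
        have := k.isLt
        rw [← hl, List.length_eraseIdx_of_lt k.isLt, List.length_cons]
        omega
      have hsub : ∀ i ∈ l.eraseIdx k, i ∈ l := fun i hi => (List.eraseIdx_sublist l k).subset hi
      rw [h i (by simp) (l.get k) (by simp), ih _ hk (l := l.eraseIdx k) (fun a ha b hb =>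
        h a (List.mem_cons_of_mem _ (hsub a ha)) b (List.mem_cons_of_mem _ (hsub b hb))) rfl]

theorem Pf_eq_zero_of_row_eq_zero {ι R : Type*} [CommRing R] [Fintype ι] [DecidableEq ι]
    {B : Matrix ι ι R} (hB : B.transpose = -B) (hd : ∀ i, B i i = 0) {l : List ι} {a : ι}
    (ha : a ∈ l) (h : ∀ j, B a j = 0) : Pf B l = 0 := by
  obtain ⟨m, l, rfl⟩ := List.append_of_mem ha
  have h1 := Pf_move hB hd m l a
  rw [Pf_cons, Finset.sum_eq_zero (by simp [h])] at h1
  have h2 := congrArg (fun x => (-1) ^ m.length * x) h1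
  simp only [← mul_assoc, ← pow_add, ← two_mul, pow_mul] at h2
  simpa using h2.symm

theorem signedPf_eq_of_nodup {ι : Type*} [DecidableEq ι] {vl : List ι} {rank : ι → ℕ}
    {B : Matrix ι ι ℝ} {l : List ι} (h : l.Nodup) (p : ι → Bool)
    (hp : ∀ x, p x = true ↔ x ∉ l) :
    signedPf vl rank B l = (arrangementSign rank (vl.filter p ++ l) : ℝ) * Pf B (vl.filter p) := by
  have : (fun x => decide (x ∉ l)) = p := by
    ext x
    rw [Bool.eq_iff_iff, decide_eq_true_eq, hp]
  rw [signedPf, if_pos h, this]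

/-! ### The oscillation matrices of a graph -/

namespace StarGraph

variable (G : StarGraph)

theorem vertexForm_transpose {R : Type*} [CommRing R] (s : R) :
    (G.vertexForm s).transpose = -G.vertexForm s := by
  ext a b
  rw [Matrix.transpose_apply, Matrix.neg_apply]
  rcases a with c | v <;> rcases b with c' | w
  · simp only [vertexForm]
    by_cases h : c.1 = c'.1
    · rw [if_pos h, if_pos h.symm]
      rcases lt_trichotomy c.2 c'.2 with h' | h' | h'
      · rw [if_neg h'.not_gt, if_pos h', if_pos h']
        ring
      · simp [h']
      · rw [if_pos h', if_neg h'.not_gt, if_pos h']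
        ring
    · rw [if_neg h, if_neg (Ne.symm h), neg_zero]
  · simp only [vertexForm]
    split_ifs <;> simp
  · simp only [vertexForm]
    split_ifs <;> simp
  · simp [vertexForm]

theorem oscForm_transpose {R : Type*} [CommRing R] (s : R) :
    (G.oscForm s).transpose = -G.oscForm s := by
  rw [oscForm, Matrix.transpose_mul, Matrix.transpose_mul, Matrix.transpose_transpose,
    vertexForm_transpose, Matrix.neg_mul, Matrix.mul_neg, Matrix.mul_assoc]

theorem BMat_transpose {R : Type*} [CommRing R] (s : R) :
    (G.BMat s).transpose = -G.BMat s := by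
  have h := G.oscForm_transpose s
  ext i j
  exact congrFun (congrFun h (.inr i)) (.inr j)

theorem BMat_diag (s : ℝ) (i : G.IntVar) : G.BMat s i i = 0 := by
  have := congrFun (congrFun (G.BMat_transpose s) i) i
  rw [Matrix.transpose_apply, Matrix.neg_apply] at this
  linarith

theorem oscForm_apply {R : Type*} [CommRing R] (s : R) (a b : G.ExtVar ⊕ G.IntVar) :
    G.oscForm s a b = ∑ x, ∑ y, G.coord R a x * G.vertexForm s x y * G.coord R b y := by
  rw [oscForm, Matrix.mul_apply]
  simp only [Matrix.mul_apply, Finset.sum_mul, Matrix.transpose_apply]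
  exact Finset.sum_comm

theorem map_coord {R S : Type*} [CommRing R] [CommRing S] (f : R →+* S)
    (a : G.ExtVar ⊕ G.IntVar) (x : G.Corner ⊕ Fin G.n) : f (G.coord R a x) = G.coord S a x := by
  rcases a with (e | e) | (ℓ | (ℓ | w)) <;> rcases x with c | v <;> simp only [coord] <;>
    simp [apply_ite f]

theorem map_vertexForm {R S : Type*} [CommRing R] [CommRing S] (f : R →+* S) (s : R)
    (x y : G.Corner ⊕ Fin G.n) : f (G.vertexForm s x y) = G.vertexForm (f s) x y := by
  rcases x with c | v <;> rcases y with c' | v' <;>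
    simp [vertexForm, apply_ite f]

theorem map_BMat {R S : Type*} [CommRing R] [CommRing S] (f : R →+* S) (s : R) :
    (G.BMat s).map f = G.BMat (f s) := by
  ext i j
  simp only [BMat, Matrix.map_apply, Matrix.toBlocks₂₂, Matrix.of_apply, oscForm_apply, map_sum,
    map_mul, map_coord, map_vertexForm]

theorem nPf_cast (K : G.Pair) : ((G.nPf K : ℤ) : ℝ) = G.pfDel (1 : ℝ) K [] := by
  have h := Pf_map_ringHom (Int.castRingHom ℝ) (G.BMat (1 : ℤ)) (G.rest K [])
  rw [map_BMat] at h
  simpa [nPf, pfDel] using h.symm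

/-! ### The enumeration of the internal variables -/

theorem mem_varList (x : G.IntVar) : x ∈ G.varList := by
  rcases x with ℓ | ℓ | w
  · simp [varList]
  · simp [varList]
  · simp only [varList, List.mem_append, List.mem_filterMap]
    right
    exact ⟨w.1, List.mem_finRange _, by simp [w.2]⟩

theorem varList_nodup : G.varList.Nodup := by
  rw [varList, List.nodup_append, List.nodup_append]
  refine ⟨⟨(List.nodup_finRange _).map Sum.inl_injective, (List.nodup_finRange _).map
    (Sum.inr_injective.comp Sum.inl_injective), by simp⟩, ?_, ?_⟩
  · refine List.Nodup.filterMap ?_ (List.nodup_finRange _)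
    intro a a' b hb hb'
    rw [Option.mem_def] at hb hb'
    split_ifs at hb hb'
    simp_all
    have := hb.trans hb'.symm
    simpa using this
  · intro a ha b hb
    rw [List.mem_filterMap] at hb
    obtain ⟨v, -, hv⟩ := hb
    split_ifs at hv
    simp only [Option.some.injEq] at hv
    subst hv
    simp only [List.mem_append, List.mem_map] at ha
    rcases ha with ⟨_, _, rfl⟩ | ⟨_, _, rfl⟩ <;> simp

theorem rank_injective : Function.Injective G.rank := by
  intro a b h
  rcases a with ℓ | ℓ | w <;> rcases b with ℓ' | ℓ' | w' <;> simp only [rank] at h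
  · exact congrArg _ (Fin.ext h)
  · omega
  · omega
  · omega
  · exact congrArg _ (congrArg _ (Fin.ext (by omega)))
  · omega
  · omega
  · omega
  · exact congrArg _ (congrArg _ (Subtype.ext (Fin.ext (by omega))))

/-- A pair as a set of internal variables. -/
def pairSet (K : G.Pair) : Finset G.IntVar := Finset.univ.filter fun x => G.inPair K x = true

theorem mem_pairSet {K : G.Pair} {x : G.IntVar} : x ∈ G.pairSet K ↔ G.inPair K x = true := by
  simp [pairSet]

theorem pairSet_injective : Function.Injective G.pairSet := by
  intro K K' h
  refine Prod.ext (Finset.ext fun ℓ => ?_) (Finset.ext fun ℓ => ?_)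
  · have := Finset.ext_iff.1 h (.inl ℓ)
    simpa [mem_pairSet, inPair] using this
  · have := Finset.ext_iff.1 h (.inr (.inl ℓ))
    simpa [mem_pairSet, inPair] using this

theorem revList_pairSet (K : G.Pair) :
    revList G.varList (G.pairSet K) = (G.varList.filter (G.inPair K)).reverse := by
  rw [revList]
  congr 2
  ext x
  by_cases h : G.inPair K x = true <;> simp [mem_pairSet, h]

/-- The dictionary between the graph notation and `signedPf`. The two signs agree because they count
the inversions of the same arrangement: the remaining variables, then `τs`, then `K` in decreasing
order. -/
theorem eps_mul_pfDel (s : ℝ) (K : G.Pair) (τs : List G.IntVar)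
    (h : (τs ++ revList G.varList (G.pairSet K)).Nodup) :
    (G.eps K τs : ℝ) * G.pfDel s K τs =
      signedPf G.varList G.rank (G.BMat s) (τs ++ revList G.varList (G.pairSet K)) := by
  rw [signedPf_eq_of_nodup h (fun x => !(G.inPair K x) && τs.all fun τ => decide (x ≠ τ)), eps,
    pfDel, ← revList_pairSet, List.append_assoc]
  · rfl
  · intro x
    simp only [List.mem_append, mem_revList G.mem_varList, mem_pairSet]
    simp only [not_or, decide_eq_true_eq, Bool.and_eq_true, Bool.not_eq_true',
      List.all_eq_true]
    constructor
    · rintro ⟨h1, h2⟩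
      exact ⟨fun hx => h2 x hx rfl, by simp [h1]⟩
    · rintro ⟨h1, h2⟩
      exact ⟨by simpa using h2, fun τ hτ hx => h1 (hx ▸ hτ)⟩

theorem sq_pfDel (s : ℝ) (K : G.Pair) :
    G.pfDel s K [] ^ 2 =
      signedPf G.varList G.rank (G.BMat s) (revList G.varList (G.pairSet K)) ^ 2 := by
  have h := G.eps_mul_pfDel s K [] (by simpa using revList_nodup G.varList_nodup _)
  have h2 : ((G.eps K [] : ℤ) : ℝ) ^ 2 = 1 := by
    exact_mod_cast arrangementSign_sq G.rank _
  rw [List.nil_append] at h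
  rw [← h, mul_pow, h2, one_mul]

/-! ### Dependence on the oscillation strength -/

/-- The weights that relate the oscillating form at strength `s` to the one at strength `1`. -/
def strengthWeight (s : ℝ) : G.IntVar → ℝ :=
  Sum.elim (fun _ => √s) (Sum.elim (fun _ => √s) fun _ => (√s)⁻¹)

/-- Giving weight `√s` to corners and `1/√s` to hypermomenta multiplies corner–corner entries by `s`
and leaves corner–hypermomentum entries unchanged. -/
theorem BMat_eq_scale {s : ℝ} (hs : 0 < s) (i j : G.IntVar) :
    G.BMat s i j = G.strengthWeight s i * G.BMat 1 i j * G.strengthWeight s j := by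
  let w : G.Corner ⊕ Fin G.n → ℝ := Sum.elim (fun _ => √s) fun _ => (√s)⁻¹
  have h1 : ∀ i x, G.coord ℝ (.inr i) x * w x = G.strengthWeight s i * G.coord ℝ (.inr i) x := by
    intro i x
    rcases i with ℓ | ℓ | v <;> rcases x with c | v' <;> simp [coord, w, strengthWeight, mul_comm]
  have hsq : √s * √s = s := Real.mul_self_sqrt hs.le
  have hinv : √s * (√s)⁻¹ = 1 := mul_inv_cancel₀ (Real.sqrt_pos.2 hs).ne'
  have h2 : ∀ x y, G.vertexForm s x y = w x * G.vertexForm 1 x y * w y := by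
    intro x y
    rcases x with c | v <;> rcases y with c' | v' <;> simp only [vertexForm, w, Sum.elim_inl,
      Sum.elim_inr]
    · split_ifs
      · linear_combination -((-1) ^ ((c.2 : ℕ) + (c'.2 : ℕ) + 1)) * hsq
      · linear_combination ((-1) ^ ((c.2 : ℕ) + (c'.2 : ℕ) + 1)) * hsq
      · ring
      · ring
    · split_ifs
      · linear_combination -((-1) ^ (c.2 : ℕ)) * hinv
      · ring
    · split_ifs
      · linear_combination ((-1) ^ (c'.2 : ℕ)) * hinv
      · ring
    · ring
  simp only [BMat, Matrix.toBlocks₂₂, Matrix.of_apply, oscForm_apply, Finset.mul_sum,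
    Finset.sum_mul]
  refine Finset.sum_congr rfl fun x _ => Finset.sum_congr rfl fun y _ => ?_
  rw [h2]
  linear_combination (G.vertexForm 1 x y * w y * G.coord ℝ (.inr j) y) * h1 i x +
    (G.strengthWeight s i * G.coord ℝ (.inr i) x * G.vertexForm 1 x y) * h1 j y

/-- By the scaling, the squared Pfaffian picks up a factor `s` for each remaining short or long
variable and `s⁻¹` for each of the `n - 1` hypermomenta. -/
theorem sq_pfDel_eq_aCoef {s : ℝ} (hs : 0 < s) (K : G.Pair) :
    G.pfDel s K [] ^ 2 = G.aCoef s K := by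
  have hB : G.BMat s =
      Matrix.of fun i j => G.strengthWeight s i * G.BMat 1 i j * G.strengthWeight s j := by
    ext i j; exact G.BMat_eq_scale hs i j
  rw [pfDel, hB, Pf_scale, mul_pow, aCoef, nPf_cast, pfDel]
  congr 1
  have hnd : (G.rest K []).Nodup := G.varList_nodup.filter _
  rw [← List.prod_toFinset _ hnd]
  have h1 : (G.rest K []).toFinset = Finset.univ.filter fun x => G.inPair K x = false := by
    ext x
    simp [rest, G.mem_varList]
  rw [h1, ← Finset.prod_pow, Finset.prod_filter, Fintype.prod_sum_type, Fintype.prod_sum_type]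
  simp only [inPair, strengthWeight, Sum.elim_inl, Sum.elim_inr, Real.sq_sqrt hs.le, inv_pow,
    if_true, decide_eq_false_iff_not]
  rw [← Finset.prod_filter, ← Finset.prod_filter, Finset.prod_const, Finset.prod_const,
    Finset.prod_const]
  have c1 : ∀ S : Finset (Fin G.L), (Finset.univ.filter fun x => x ∉ S).card = G.L - S.card := by
    intro S
    rw [← Finset.compl_filter, Finset.card_compl]
    simp
  have c2 : (Finset.univ : Finset {v : Fin G.n // v ≠ G.root}).card = G.n - 1 := by
    rw [Finset.card_univ, Fintype.card_subtype_compl]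
    simp
  rw [c1, c1, c2]
  have hn : 1 ≤ G.n := Nat.one_le_iff_ne_zero.2 fun h => by
    have := G.root.isLt; omega
  have hI := Finset.card_le_univ K.1
  have hJ := Finset.card_le_univ K.2
  rw [Fintype.card_fin] at hI hJ
  rw [← zpow_natCast, ← zpow_natCast, ← zpow_natCast, inv_zpow', ← zpow_add₀ hs.ne',
    ← zpow_add₀ hs.ne']
  congr 1
  push_cast [Nat.cast_sub hI, Nat.cast_sub hJ, Nat.cast_sub hn]
  ring

end StarGraph

/-! ### The polynomial `HU` as a sum of monomials -/

theorem sum_subtype_eq_sum {α M : Type*} [Fintype α] [AddCommMonoid M] {p : α → Prop}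
    [Fintype {x // p x}] {f : α → M} (h : ∀ x, ¬ p x → f x = 0) :
    ∑ x : {x // p x}, f x = ∑ x, f x := by
  classical
  rw [← Finset.sum_subset (Finset.subset_univ (Finset.univ.filter p)) (fun x _ hx => h x (by
    simpa using hx))]
  exact (Finset.sum_subtype (Finset.univ.filter p) (by simp) f).symm

namespace StarGraph

variable (G : StarGraph)

theorem cube_pos {t : Fin G.L → ℝ} (ht : t ∈ G.cube) (ℓ : Fin G.L) : 0 < t ℓ :=
  (ht ℓ (Set.mem_univ _)).1

theorem cube_lt_one {t : Fin G.L → ℝ} (ht : t ∈ G.cube) (ℓ : Fin G.L) : t ℓ < 1 :=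
  (ht ℓ (Set.mem_univ _)).2

/-- The diagonal entries of `A`. -/
def aDiag (t : Fin G.L → ℝ) : G.IntVar → ℝ :=
  Sum.elim (fun ℓ => (t ℓ)⁻¹) (Sum.elim t fun _ => 0)

theorem aDiag_nonneg {t : Fin G.L → ℝ} (ht : t ∈ G.cube) (i : G.IntVar) : 0 ≤ G.aDiag t i := by
  rcases i with ℓ | ℓ | v
  · exact inv_nonneg.2 (G.cube_pos ht ℓ).le
  · exact (G.cube_pos ht ℓ).le
  · exact le_rfl

/-- Since `A` vanishes on hypermomenta, a set containing one contributes nothing; the others come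
from pairs `(I, J)`. -/
theorem sum_intVar_eq_sum_pair (A : G.IntVar → ℝ) (hA : ∀ v, A (.inr (.inr v)) = 0)
    (F : Finset G.IntVar → ℝ) :
    ∑ K : Finset G.IntVar, (∏ i ∈ K, A i) * F K =
      ∑ K : G.Pair, (∏ i ∈ G.pairSet K, A i) * F (G.pairSet K) := by
  rw [← Finset.sum_image (f := fun K => (∏ i ∈ K, A i) * F K)
    (fun K _ K' _ h => G.pairSet_injective h)]
  symm
  refine Finset.sum_subset (Finset.subset_univ _) fun K _ hK => ?_
  by_cases h : ∃ v, Sum.inr (Sum.inr v) ∈ K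
  · obtain ⟨v, hv⟩ := h
    rw [Finset.prod_eq_zero hv (hA v), zero_mul]
  · exfalso
    refine hK (Finset.mem_image.2 ⟨(Finset.univ.filter fun ℓ => .inl ℓ ∈ K,
      Finset.univ.filter fun ℓ => .inr (.inl ℓ) ∈ K), Finset.mem_univ _, ?_⟩)
    ext x
    rw [mem_pairSet]
    rcases x with ℓ | ℓ | v
    · simp [inPair]
    · simp [inPair]
    · simp only [inPair, Bool.false_eq_true, false_iff]
      exact fun hv => h ⟨v, hv⟩

theorem prod_pairSet {M : Type*} [CommMonoid M] (A : G.IntVar → M) (K : G.Pair) :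
    ∏ i ∈ G.pairSet K, A i = (∏ ℓ ∈ K.1, A (.inl ℓ)) * ∏ ℓ ∈ K.2, A (.inr (.inl ℓ)) := by
  rw [pairSet, Finset.prod_filter, Fintype.prod_sum_type, Fintype.prod_sum_type]
  simp [inPair]

theorem prod_mul_prod_pairSet {t : Fin G.L → ℝ} (ht : t ∈ G.cube) (K : G.Pair) :
    (∏ ℓ, t ℓ) * ∏ i ∈ G.pairSet K, G.aDiag t i = G.mon K t := by
  rw [prod_pairSet, mon]
  simp only [aDiag, Sum.elim_inl, Sum.elim_inr]
  have h1 : ∏ ℓ ∈ K.1, (t ℓ)⁻¹ = ∏ ℓ, if ℓ ∈ K.1 then (t ℓ)⁻¹ else 1 := by simp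
  have h2 : ∏ ℓ ∈ K.2, t ℓ = ∏ ℓ, if ℓ ∈ K.2 then t ℓ else 1 := by simp
  rw [h1, h2, ← Finset.prod_mul_distrib, ← Finset.prod_mul_distrib]
  refine Finset.prod_congr rfl fun ℓ _ => ?_
  have := (G.cube_pos ht ℓ).ne'
  rw [expo]
  split_ifs <;> simp [this, pow_two]

theorem det_AMat_add_BMat (s : ℝ) {t : Fin G.L → ℝ} (ht : t ∈ G.cube) :
    (G.AMat t + G.BMat s).det = pfaffianSum G.varList G.rank (G.aDiag t) (G.BMat s) :=
  det_diagonal_add_eq_pfaffianSum (G.BMat_transpose s) (G.BMat_diag s) G.rank_injective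
    G.varList_nodup G.mem_varList (G.aDiag_nonneg ht)

theorem HU_eq_sum {s : ℝ} (hs : 0 < s) {t : Fin G.L → ℝ} (ht : t ∈ G.cube) :
    G.HU s t = ∑ K : G.KU, G.aCoef s K * G.mon K t := by
  rw [sum_subtype_eq_sum (f := fun K => G.aCoef s K * G.mon K t) (fun K hK => by
    rw [not_not] at hK; simp [aCoef, hK]), HU, det_AMat_add_BMat G s ht, pfaffianSum,
    sum_intVar_eq_sum_pair G _ (fun _ => rfl), Finset.mul_sum]
  refine Finset.sum_congr rfl fun K _ => ?_
  rw [← mul_assoc, prod_mul_prod_pairSet G ht, ← sq_pfDel, sq_pfDel_eq_aCoef G hs, mul_comm]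

theorem aCoef_pos {s : ℝ} (hs : 0 < s) (K : G.KU) : 0 < G.aCoef s K := by
  have : (0 : ℝ) < (G.nPf K : ℝ) ^ 2 := by
    have : ((G.nPf K : ℤ) : ℝ) ≠ 0 := by exact_mod_cast K.2
    positivity
  exact mul_pos (zpow_pos hs _) this

theorem mon_pos {t : Fin G.L → ℝ} (ht : t ∈ G.cube) (K : G.Pair) : 0 < G.mon K t :=
  Finset.prod_pos fun ℓ _ => pow_pos (G.cube_pos ht ℓ) _

/-! ### A monomial with exponents at most one, from connectedness -/

theorem BMat_long_hyper (s : ℝ) (ℓ : Fin G.L) (w : {v : Fin G.n // v ≠ G.root}) :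
    G.BMat s (.inr (.inl ℓ)) (.inr (.inr w)) =
      (if (G.foot ℓ true).1 = w then (-1) ^ ((G.foot ℓ true).2 : ℕ) else 0) +
        if (G.foot ℓ false).1 = w then (-1) ^ ((G.foot ℓ false).2 : ℕ) else 0 := by
  simp only [BMat, Matrix.toBlocks₂₂, Matrix.of_apply, oscForm_apply, Fintype.sum_sum_type, coord,
    vertexForm]
  simp only [mul_zero, zero_mul, Finset.sum_const_zero, add_zero, zero_add]
  simp only [Finset.sum_ite_eq, Finset.mem_univ, if_true, mul_ite, mul_zero, mul_one,
    ← Finset.sum_filter, add_mul, ite_mul, one_mul, zero_mul]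
  simp [Finset.sum_add_distrib]

/-- The form obtained by erasing the short variables. -/
def longForm : Matrix G.IntVar G.IntVar ℝ
  | .inr i, .inr j => G.BMat 1 (.inr i) (.inr j)
  | _, _ => 0

theorem longForm_transpose : G.longForm.transpose = -G.longForm := by
  ext i j
  rw [Matrix.transpose_apply, Matrix.neg_apply]
  rcases i with ℓ | i <;> rcases j with ℓ' | j <;> simp only [longForm, neg_zero]
  exact congrFun (congrFun (G.BMat_transpose (1 : ℝ)) (.inr i)) (.inr j)

theorem longForm_diag (i : G.IntVar) : G.longForm i i = 0 := by
  rcases i with ℓ | i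
  · rfl
  · exact G.BMat_diag 1 (.inr i)

/-- Between long variables and hypermomenta the form is an incidence matrix of the graph, up to
signs. A kernel vector has no component where the diagonal is `1`, and its hypermomenta then have
equal modulus at the two ends of each line. Connectedness propagates the value `0` from the root to
every vertex. -/
theorem det_add_longForm_ne_zero :
    (Matrix.diagonal (Sum.elim (fun _ => 1) (Sum.elim (fun _ => 1) fun _ => 0) : G.IntVar → ℝ) +
      G.longForm).det ≠ 0 := by
  intro hdet
  obtain ⟨x, hx0, hx⟩ := Matrix.exists_mulVec_eq_zero_iff.2 hdet
  apply hx0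
  have hq : ∑ i, ((Sum.elim (fun _ => 1) (Sum.elim (fun _ => 1) fun _ => 0) : G.IntVar → ℝ) i) *
      x i ^ 2 = 0 := by
    -- The antisymmetric form drops out of `xᵗ (A + B) x`, which leaves a sum of squares over the
    -- short and long variables.
    have h1 : x ⬝ᵥ (G.longForm.mulVec x) = 0 := by
      have h2 : x ⬝ᵥ (G.longForm.mulVec x) = -(x ⬝ᵥ (G.longForm.mulVec x)) := by
        conv_lhs => rw [Matrix.dotProduct_mulVec, ← Matrix.mulVec_transpose, longForm_transpose,
          Matrix.neg_mulVec, neg_dotProduct, dotProduct_comm]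
      linarith
    have h3 : x ⬝ᵥ ((Matrix.diagonal (Sum.elim (fun _ => 1) (Sum.elim (fun _ => 1) fun _ => 0) :
        G.IntVar → ℝ) + G.longForm).mulVec x) = 0 := by rw [hx, dotProduct_zero]
    rw [Matrix.add_mulVec, dotProduct_add, h1, add_zero, dotProduct] at h3
    refine Eq.trans (Finset.sum_congr rfl fun i _ => ?_) h3
    rw [Matrix.mulVec_diagonal]
    ring
  have hpos : ∀ i, ((Sum.elim (fun _ => 1) (Sum.elim (fun _ => 1) fun _ => 0) :
      G.IntVar → ℝ) i) * x i ^ 2 = 0 := by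
    intro i
    refine (Finset.sum_eq_zero_iff_of_nonneg fun i _ => mul_nonneg ?_ (sq_nonneg _)).1 hq i
      (Finset.mem_univ _)
    rcases i with ℓ | ℓ | v <;> simp
  have hs : ∀ ℓ, x (.inl ℓ) = 0 := fun ℓ => by simpa using hpos (.inl ℓ)
  have hl : ∀ ℓ, x (.inr (.inl ℓ)) = 0 := fun ℓ => by simpa using hpos (.inr (.inl ℓ))
  -- The hypermomenta are extended by `0` to the root, so that lines ending there need no separate
  -- treatment.
  let p : Fin G.n → ℝ := fun v => if h : v ≠ G.root then x (.inr (.inr ⟨v, h⟩)) else 0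
  have hsum : ∀ (c : ℝ) (v : Fin G.n),
      ∑ w : {v : Fin G.n // v ≠ G.root}, (if v = w then c else 0) * x (.inr (.inr w)) = c * p v := by
    intro c v
    simp only [p]
    by_cases h : v ≠ G.root
    · rw [Finset.sum_eq_single (⟨v, h⟩ : {v : Fin G.n // v ≠ G.root})]
      · simp [h]
      · intro b _ hb
        have : v ≠ b := fun hv => hb (Subtype.ext hv.symm)
        simp [this]
      · simp
    · rw [dif_neg h, mul_zero]
      refine Finset.sum_eq_zero fun w _ => ?_
      have : v ≠ w := fun hv => h (hv ▸ w.2)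
      simp [this]
  have hrow : ∀ ℓ, |p (G.foot ℓ false).1| = |p (G.foot ℓ true).1| := by
    intro ℓ
    have h := congrFun hx (.inr (.inl ℓ))
    rw [Matrix.add_mulVec, Pi.add_apply, Matrix.mulVec_diagonal, hl, mul_zero, zero_add,
      Matrix.mulVec, dotProduct, Fintype.sum_sum_type, Fintype.sum_sum_type] at h
    simp only [hs, hl, mul_zero, Finset.sum_const_zero, zero_add, longForm, BMat_long_hyper,
      add_mul, Finset.sum_add_distrib, hsum, Pi.zero_apply] at h
    have h2 := congrArg abs (eq_neg_of_add_eq_zero_left h)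
    rw [abs_neg, abs_mul, abs_mul, abs_pow, abs_pow, abs_neg, abs_one, one_pow, one_pow, one_mul,
      one_mul] at h2
    exact h2.symm
  have hconst : ∀ u v, |p u| = |p v| := by
    intro u v
    obtain ⟨w⟩ := G.connected.preconnected u v
    induction w with
    | nil => rfl
    | cons hadj _ ih =>
      rw [← ih]
      rw [SimpleGraph.fromRel_adj] at hadj
      rcases hadj.2 with ⟨ℓ, rfl, rfl⟩ | ⟨ℓ, rfl, rfl⟩
      · exact hrow ℓ
      · exact (hrow ℓ).symm
  have hroot : p G.root = 0 := by simp [p]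
  funext i
  rcases i with ℓ | ℓ | v
  · exact hs ℓ
  · exact hl ℓ
  · have := hconst v.1 G.root
    rw [hroot, abs_zero, abs_eq_zero] at this
    simpa [p, v.2] using this

/-- There is a monomial of `HU` in which every `t_ℓ` has exponent at most `1`. -/
theorem exists_KU_expo_le_one : ∃ K : G.KU, ∀ ℓ, G.expo K ℓ ≤ 1 := by
  have h := G.det_add_longForm_ne_zero
  rw [det_diagonal_add_eq_pfaffianSum (vl := G.varList) (rank := G.rank) G.longForm_transpose
    G.longForm_diag G.rank_injective G.varList_nodup G.mem_varList (by
      intro i; rcases i with ℓ | ℓ | v <;> simp), pfaffianSum,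
    sum_intVar_eq_sum_pair G _ (fun _ => rfl)] at h
  obtain ⟨K, -, hK⟩ := Finset.exists_ne_zero_of_sum_ne_zero h
  have hK2 := right_ne_zero_of_mul hK
  have hnd := revList_nodup (vl := G.varList) G.varList_nodup (G.pairSet K)
  rw [signedPf_eq_of_nodup hnd (fun x => !(G.inPair K x)) (fun x => by
    rw [mem_revList G.mem_varList, mem_pairSet]; simp)] at hK2
  have hPf : Pf G.longForm (G.varList.filter fun x => !(G.inPair K x)) ≠ 0 :=
    right_ne_zero_of_mul (left_ne_zero_of_mul (by rwa [pow_two] at hK2))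
  -- A short variable outside `K` would leave a zero row in the Pfaffian. So all short variables are
  -- deleted, `longForm` agrees with `B` on the rest, and each exponent is `0` or `1`.
  have hI : ∀ ℓ, ℓ ∈ K.1 := by
    intro ℓ
    by_contra hℓ
    refine hPf (Pf_eq_zero_of_row_eq_zero G.longForm_transpose G.longForm_diag (a := .inl ℓ) ?_ ?_)
    · simp [G.mem_varList, inPair, hℓ]
    · intro j; rfl
  refine ⟨⟨K, ?_⟩, fun ℓ => ?_⟩
  · have : ((G.nPf K : ℤ) : ℝ) ≠ 0 := by
      rw [nPf_cast, pfDel]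
      have hr : G.rest K [] = G.varList.filter fun x => !(G.inPair K x) := by
        simp [rest]
      rw [hr]
      convert hPf using 1
      refine Pf_congr fun i hi j hj => ?_
      rcases i with ℓ | i
      · simp [inPair, hI] at hi
      rcases j with ℓ | j
      · simp [inPair, hI] at hj
      rfl
    exact_mod_cast this
  · simp only [expo, hI, if_true]
    split_ifs <;> simp

theorem HU_pos {s : ℝ} (hs : 0 < s) {t : Fin G.L → ℝ} (ht : t ∈ G.cube) : 0 < G.HU s t := by
  rw [G.HU_eq_sum hs ht]
  obtain ⟨K, -⟩ := G.exists_KU_expo_le_one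
  exact Finset.sum_pos (fun K _ => mul_pos (G.aCoef_pos hs K) (G.mon_pos ht K)) ⟨K, Finset.mem_univ _⟩

end StarGraph

/-! ### Inverting the internal quadratic form -/

theorem sigmaMatrix_mul_self (m : ℕ) : sigmaMatrix m * sigmaMatrix m = 1 := by
  have h : (!![0, -I; I, 0] : Matrix (Fin 2) (Fin 2) ℂ) * !![0, -I; I, 0] = 1 := by
    ext i j
    fin_cases i <;> fin_cases j <;> simp
  rw [sigmaMatrix, ← Matrix.mul_kronecker_mul, h, one_mul, Matrix.one_kronecker_one]

theorem sigmaMatrix_transpose (m : ℕ) : (sigmaMatrix m).transpose = -sigmaMatrix m := by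
  ext ⟨k, i⟩ ⟨k', j⟩
  rw [Matrix.transpose_apply, Matrix.neg_apply]
  simp only [sigmaMatrix, Matrix.kroneckerMap_apply, Matrix.one_apply, eq_comm]
  fin_cases i <;> fin_cases j <;> simp

/-- The inverse of `A ⊗ 1 + B ⊗ σ` in terms of the inverse `N` of `A + B`. -/
theorem inv_kronecker_one_add_kronecker_sigma {ι : Type*} [Fintype ι] [DecidableEq ι] {m : ℕ}
    {A B N : Matrix ι ι ℂ} (hA : A.transpose = A) (hB : B.transpose = -B) (hN : (A + B) * N = 1) :
    (A ⊗ₖ (1 : Matrix (Fin m × Fin 2) (Fin m × Fin 2) ℂ) + B ⊗ₖ sigmaMatrix m)⁻¹ =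
      ((1 / 2 : ℂ) • (N + N.transpose)) ⊗ₖ 1 +
        ((1 / 2 : ℂ) • (N - N.transpose)) ⊗ₖ sigmaMatrix m := by
  have h1 : A * N + B * N = 1 := by rw [← add_mul, hN]
  have h2 : A * N.transpose - B * N.transpose = 1 := by
    have h3 : N * (A + B) = 1 := mul_eq_one_comm.1 hN
    have h4 := congrArg Matrix.transpose h3
    rw [Matrix.transpose_mul, Matrix.transpose_add, hA, hB, Matrix.transpose_one, ← sub_eq_add_neg,
      sub_mul] at h4
    exact h4
  refine Matrix.inv_eq_right_inv ?_
  rw [add_mul, mul_add, mul_add, ← Matrix.mul_kronecker_mul, ← Matrix.mul_kronecker_mul,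
    ← Matrix.mul_kronecker_mul, ← Matrix.mul_kronecker_mul, one_mul, one_mul, mul_one,
    sigmaMatrix_mul_self]
  have e1 : A * ((1 / 2 : ℂ) • (N + N.transpose)) + B * ((1 / 2 : ℂ) • (N - N.transpose)) = 1 := by
    have : A * ((1 / 2 : ℂ) • (N + N.transpose)) + B * ((1 / 2 : ℂ) • (N - N.transpose)) =
        (1 / 2 : ℂ) • ((A * N + B * N) + (A * N.transpose - B * N.transpose)) := by
      rw [Matrix.mul_smul, Matrix.mul_smul, mul_add, mul_sub, ← smul_add]
      congr 1
      abel
    rw [this, h1, h2, ← two_smul ℂ (1 : Matrix ι ι ℂ), smul_smul]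
    norm_num
  have e2 : A * ((1 / 2 : ℂ) • (N - N.transpose)) + B * ((1 / 2 : ℂ) • (N + N.transpose)) = 0 := by
    have : A * ((1 / 2 : ℂ) • (N - N.transpose)) + B * ((1 / 2 : ℂ) • (N + N.transpose)) =
        (1 / 2 : ℂ) • ((A * N + B * N) - (A * N.transpose - B * N.transpose)) := by
      rw [Matrix.mul_smul, Matrix.mul_smul, mul_add, mul_sub, ← smul_add]
      congr 1
      abel
    rw [this, h1, h2, sub_self, smul_zero]
  have e3 : ∀ (a b c d : Matrix (ι × Fin m × Fin 2) (ι × Fin m × Fin 2) ℂ),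
      a + b + (c + d) = (a + d) + (b + c) := fun a b c d => by abel
  rw [e3, ← Matrix.add_kronecker, ← Matrix.add_kronecker, e1, e2, Matrix.zero_kronecker, add_zero,
    Matrix.one_kronecker_one]

/-! ### The exponent in terms of external configurations -/

namespace StarGraph

variable (G : StarGraph)

theorem evalForm_add {m : ℕ} (R R' : Matrix (G.ExtVar × (Fin m × Fin 2)) (G.ExtVar × (Fin m × Fin 2)) ℂ)
    (X : G.ExtConf m) : G.evalForm (R + R') X = G.evalForm R X + G.evalForm R' X := by
  rw [evalForm, Matrix.add_mulVec, dotProduct_add]; rfl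

theorem evalForm_eq_sum {m : ℕ}
    (R : Matrix (G.ExtVar × (Fin m × Fin 2)) (G.ExtVar × (Fin m × Fin 2)) ℂ) (X : G.ExtConf m) :
    G.evalForm R X = ∑ e, ∑ e', ∑ c, ∑ c', R (e, c) (e', c') * X e c * X e' c' := by
  simp only [evalForm, dotProduct, Matrix.mulVec, Fintype.sum_prod_type (α₁ := G.ExtVar),
    Finset.mul_sum]
  refine Finset.sum_congr rfl fun e _ => ?_
  rw [Finset.sum_comm]
  refine Finset.sum_congr rfl fun e' _ => Finset.sum_congr rfl fun c _ =>
    Finset.sum_congr rfl fun c' _ => ?_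
  ring

theorem evalForm_kronecker_one {m : ℕ} (W : Matrix G.ExtVar G.ExtVar ℂ) (X : G.ExtConf m) :
    G.evalForm (W ⊗ₖ 1) X = ∑ c, ∑ e, ∑ e', W e e' * X e c * X e' c := by
  rw [evalForm_eq_sum]
  have : ∀ e e', ∑ c, ∑ c', (W ⊗ₖ (1 : Matrix (Fin m × Fin 2) (Fin m × Fin 2) ℂ)) (e, c) (e', c') *
      X e c * X e' c' = ∑ c, W e e' * X e c * X e' c := by
    intro e e'
    refine Finset.sum_congr rfl fun c _ => ?_
    rw [Finset.sum_eq_single c]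
    · simp [Matrix.kroneckerMap_apply]
    · intro c' _ hc
      simp [Matrix.kroneckerMap_apply, Matrix.one_apply_ne hc.symm]
    · simp
  simp only [this]
  rw [Finset.sum_comm' (t' := Finset.univ) (s' := fun _ => Finset.univ) (by simp)]
  rw [Finset.sum_comm]
  have h2 : ∀ e : G.ExtVar, ∑ e', ∑ c, W e e' * (X e c : ℂ) * X e' c =
      ∑ c, ∑ e', W e e' * (X e c : ℂ) * X e' c := fun e => Finset.sum_comm
  simp only [h2]
  rw [Finset.sum_comm]

theorem evalForm_kronecker_sigma {m : ℕ} (W : Matrix G.ExtVar G.ExtVar ℂ) (X : G.ExtConf m) :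
    G.evalForm (W ⊗ₖ sigmaMatrix m) X =
      -I * ∑ e, ∑ e', W e e' * ((symp (X e) (X e') : ℝ) : ℂ) := by
  rw [evalForm_eq_sum, Finset.mul_sum]
  refine Finset.sum_congr rfl fun e _ => ?_
  rw [Finset.mul_sum]
  refine Finset.sum_congr rfl fun e' _ => ?_
  rw [symp, Fintype.sum_prod_type]
  push_cast
  rw [Finset.mul_sum, Finset.mul_sum]
  refine Finset.sum_congr rfl fun k _ => ?_
  have h : ∀ i : Fin 2, ∑ c' : Fin m × Fin 2, (W ⊗ₖ sigmaMatrix m) (e, (k, i)) (e', c') *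
      X e (k, i) * X e' c' = ∑ j : Fin 2, W e e' * (!![0, -I; I, 0] : Matrix _ _ ℂ) i j *
        X e (k, i) * X e' (k, j) := by
    intro i
    rw [Fintype.sum_prod_type, Finset.sum_eq_single k]
    · simp [sigmaMatrix, Matrix.kroneckerMap_apply]
    · intro k' _ hk
      simp [sigmaMatrix, Matrix.kroneckerMap_apply, Matrix.one_apply_ne hk.symm]
    · simp
  simp only [h, Fin.sum_univ_two]
  simp
  ring

theorem rCoef_eq (s : ℝ) (K : G.Pair) (e : G.ExtVar) : G.rCoef s K e =
    ∑ τ, G.PMat s e τ *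
      signedPf G.varList G.rank (G.BMat s) (τ :: revList G.varList (G.pairSet K)) := by
  rw [rCoef, Finset.sum_filter]
  refine Finset.sum_congr rfl fun τ _ => ?_
  split_ifs with h
  · rw [mul_assoc, eps_mul_pfDel]
    · rfl
    · rw [List.singleton_append, List.nodup_cons, mem_revList G.mem_varList, mem_pairSet]
      exact ⟨by simp [h], revList_nodup G.varList_nodup _⟩
  · rw [signedPf_of_not_nodup, mul_zero]
    rw [List.nodup_cons, mem_revList G.mem_varList, mem_pairSet]
    simp [h]

theorem iCoef_eq (s : ℝ) (K : G.Pair) (e e' : G.ExtVar) : G.iCoef s K e e' =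
    ∑ τ, ∑ τ', G.PMat s e τ *
      (signedPf G.varList G.rank (G.BMat s) (revList G.varList (G.pairSet K)) *
        signedPf G.varList G.rank (G.BMat s) (τ :: τ' :: revList G.varList (G.pairSet K))) *
          G.PMat s e' τ' := by
  have hnd := revList_nodup G.varList_nodup (G.pairSet K)
  rw [iCoef, eps_mul_pfDel _ _ _ _ (by simpa using hnd), List.nil_append, Finset.mul_sum,
    Finset.sum_filter]
  refine Finset.sum_congr rfl fun τ _ => ?_
  have hmem : ∀ τ, τ ∈ revList G.varList (G.pairSet K) ↔ G.inPair K τ = true := fun τ => by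
    rw [mem_revList G.mem_varList, mem_pairSet]
  split_ifs with h
  · rw [Finset.mul_sum, Finset.sum_filter]
    refine Finset.sum_congr rfl fun τ' _ => ?_
    split_ifs with h'
    · rw [mul_assoc (G.PMat s e τ), eps_mul_pfDel]
      · simp only [List.cons_append, List.nil_append]
        ring
      · simp only [List.cons_append, List.nil_append, List.nodup_cons, List.mem_cons, hmem, h, h'.1,
          hnd, h'.2.symm]
        simp
    · rw [signedPf_of_not_nodup (l := τ :: τ' :: _)]
      · simp
      · simp only [List.nodup_cons, List.mem_cons, hmem]
        rintro ⟨h1, h2, -⟩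
        exact h' ⟨by simpa using h2, fun hh => h1 (Or.inl hh.symm)⟩
  · symm
    refine Finset.sum_eq_zero fun τ' _ => ?_
    rw [signedPf_of_not_nodup (l := τ :: τ' :: _)]
    · simp
    · simp only [List.nodup_cons, List.mem_cons, hmem]
      rintro ⟨h1, -⟩
      exact h1 (Or.inr (by simpa using h))

/-- Multiplying numerator and denominator of the expansion of the inverse by `∏ t_ℓ` turns the
products of entries of `A` into monomials and the determinant into `HU`. -/
theorem HU_smul_resolvent (s : ℝ) {t : Fin G.L → ℝ} (ht : t ∈ G.cube)
    (hU : G.HU s t ≠ 0) (τ τ' : G.IntVar) : (G.AMat t + G.BMat s)⁻¹ τ τ' =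
      (G.HU s t)⁻¹ * ∑ K : G.Pair, G.mon K t *
        resolventTerm G.varList G.rank (G.BMat s) (G.pairSet K) τ τ' := by
  rw [HU, det_AMat_add_BMat G s ht] at hU ⊢
  have h := inv_diagonal_add_eq (G.BMat_transpose s) (G.BMat_diag s) G.rank_injective
    G.varList_nodup G.mem_varList (right_ne_zero_of_mul hU)
  have h2 : G.AMat t = Matrix.diagonal (G.aDiag t) := rfl
  have h3 := left_ne_zero_of_mul hU
  rw [h2, h, Matrix.smul_apply, resolventSum, sum_intVar_eq_sum_pair G _ (fun _ => rfl),
    smul_eq_mul, mul_inv, mul_comm (∏ ℓ, t ℓ)⁻¹, mul_assoc]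
  congr 1
  rw [Finset.mul_sum]
  refine Finset.sum_congr rfl fun K _ => ?_
  rw [← prod_mul_prod_pairSet G ht]
  field_simp

/-- Of the two products in `resolventTerm`, the second is alternating in its two indices and drops
out of the symmetric part. The first has rank one, so contraction with `PMat` gives a product of two
linear coefficients. -/
theorem sum_resolvent_symm (s : ℝ) {t : Fin G.L → ℝ} (ht : t ∈ G.cube)
    (hU : G.HU s t ≠ 0) (e e' : G.ExtVar) :
    ((G.PMat s) * ((1 / 2 : ℝ) • ((G.AMat t + G.BMat s)⁻¹ + ((G.AMat t + G.BMat s)⁻¹).transpose)) *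
      (G.PMat s).transpose) e e' =
        (G.HU s t)⁻¹ * ∑ K : G.Pair, G.mon K t * (G.rCoef s K e * G.rCoef s K e') := by
  have h : ∀ τ τ', ((1 / 2 : ℝ) • ((G.AMat t + G.BMat s)⁻¹ +
      ((G.AMat t + G.BMat s)⁻¹).transpose)) τ τ' = (G.HU s t)⁻¹ * ∑ K : G.Pair, G.mon K t *
        (signedPf G.varList G.rank (G.BMat s) (τ :: revList G.varList (G.pairSet K)) *
          signedPf G.varList G.rank (G.BMat s) (τ' :: revList G.varList (G.pairSet K))) := by
    intro τ τ'
    rw [Matrix.smul_apply, Matrix.add_apply, Matrix.transpose_apply, HU_smul_resolvent G s ht hU,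
      HU_smul_resolvent G s ht hU, ← mul_add, ← Finset.sum_add_distrib, smul_eq_mul,
      mul_left_comm, Finset.mul_sum]
    congr 1
    refine Finset.sum_congr rfl fun K _ => ?_
    have := signedPf_swap (vl := G.varList) (B := G.BMat s) G.rank_injective []
      (revList G.varList (G.pairSet K)) τ τ'
    simp only [List.nil_append] at this
    rw [resolventTerm, resolventTerm, this]
    ring
  rw [Matrix.mul_apply]
  simp only [Matrix.mul_apply, Matrix.transpose_apply, h, rCoef_eq, Finset.sum_mul,
    Finset.mul_sum]
  rw [Finset.sum_congr rfl fun τ' _ => Finset.sum_comm, Finset.sum_comm]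
  refine Finset.sum_congr rfl fun K _ => ?_
  refine Finset.sum_congr rfl fun τ _ => Finset.sum_congr rfl fun τ' _ => ?_
  ring

/-- Here the rank one product drops out and the alternating one remains, with the minus sign of
`resolventTerm`. -/
theorem sum_resolvent_antisymm (s : ℝ) {t : Fin G.L → ℝ} (ht : t ∈ G.cube)
    (hU : G.HU s t ≠ 0) (e e' : G.ExtVar) :
    ((G.PMat s) * ((1 / 2 : ℝ) • ((G.AMat t + G.BMat s)⁻¹ - ((G.AMat t + G.BMat s)⁻¹).transpose)) *
      (G.PMat s).transpose) e e' =
        -((G.HU s t)⁻¹ * ∑ K : G.Pair, G.mon K t * G.iCoef s K e e') := by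
  have h : ∀ τ τ', ((1 / 2 : ℝ) • ((G.AMat t + G.BMat s)⁻¹ -
      ((G.AMat t + G.BMat s)⁻¹).transpose)) τ τ' = (G.HU s t)⁻¹ * ∑ K : G.Pair, G.mon K t *
        -(signedPf G.varList G.rank (G.BMat s) (revList G.varList (G.pairSet K)) *
          signedPf G.varList G.rank (G.BMat s) (τ :: τ' :: revList G.varList (G.pairSet K))) := by
    intro τ τ'
    rw [Matrix.smul_apply, Matrix.sub_apply, Matrix.transpose_apply, HU_smul_resolvent G s ht hU,
      HU_smul_resolvent G s ht hU, ← mul_sub, ← Finset.sum_sub_distrib, smul_eq_mul,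
      mul_left_comm, Finset.mul_sum]
    congr 1
    refine Finset.sum_congr rfl fun K _ => ?_
    have := signedPf_swap (vl := G.varList) (B := G.BMat s) G.rank_injective []
      (revList G.varList (G.pairSet K)) τ τ'
    simp only [List.nil_append] at this
    rw [resolventTerm, resolventTerm, this]
    ring
  rw [Matrix.mul_apply]
  simp only [Matrix.mul_apply, Matrix.transpose_apply, h, iCoef_eq, Finset.sum_mul,
    Finset.mul_sum, ← Finset.sum_neg_distrib]
  rw [Finset.sum_congr rfl fun τ' _ => Finset.sum_comm, Finset.sum_comm]
  refine Finset.sum_congr rfl fun K _ => ?_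
  rw [Finset.sum_comm]
  refine Finset.sum_congr rfl fun τ _ => Finset.sum_congr rfl fun τ' _ => ?_
  ring

/-- The powers of `σ` around `Q⁻¹` reduce by `σ² = 1`. The symmetric part is left with the identity,
hence a sum of squares, and the antisymmetric part with `σ`, hence `-i` times a symplectic form. -/
theorem extForm_eq {s : ℝ} (hs : 0 < s) {m : ℕ} {t : Fin G.L → ℝ} (ht : t ∈ G.cube)
    (X : G.ExtConf m) : G.extForm s t X = G.pureExtForm s X +
      (((∑ K : G.Pair, (∑ c, (∑ e, G.rCoef s K e * X e c) ^ 2) * G.mon K t : ℝ) : ℂ) +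
        I * ((∑ K : G.Pair, (∑ e, ∑ e', G.iCoef s K e e' * symp (X e) (X e')) * G.mon K t : ℝ) : ℂ))
          / G.HU s t := by
  have hU : G.HU s t ≠ 0 := (G.HU_pos hs ht).ne'
  set N := (G.AMat t + G.BMat s)⁻¹ with hN
  have hmap : ∀ {a b : Type} (M : Matrix a b ℝ), M.map ofReal = M.map Complex.ofRealHom :=
    fun M => rfl
  have hdet : IsUnit (G.AMat t + G.BMat s).det := by
    rw [HU] at hU
    exact (right_ne_zero_of_mul hU).isUnit
  have hQ : (G.QMat s m t)⁻¹ = ((1 / 2 : ℝ) • (N + N.transpose)).map ofReal ⊗ₖ 1 +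
      ((1 / 2 : ℝ) • (N - N.transpose)).map ofReal ⊗ₖ sigmaMatrix m := by
    rw [QMat, inv_kronecker_one_add_kronecker_sigma (N := N.map ofReal)]
    · congr 2
      · ext i j; simp [mul_add]
      · ext i j; simp [mul_sub]
    · rw [← Matrix.transpose_map, AMat, Matrix.diagonal_transpose]
    · rw [← Matrix.transpose_map, BMat_transpose]
      ext i j; simp
    · rw [hmap, hmap, hmap, ← Matrix.map_add _ (map_add _), ← Matrix.map_mul, hN,
        Matrix.mul_nonsing_inv _ hdet, Matrix.map_one _ (map_zero _) (map_one _)]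
  have hform : ((G.MMat s).map ofReal ⊗ₖ sigmaMatrix m -
      ((G.PMat s).map ofReal ⊗ₖ sigmaMatrix m) * (G.QMat s m t)⁻¹ *
        ((G.PMat s).map ofReal ⊗ₖ sigmaMatrix m).transpose) =
      (G.MMat s).map ofReal ⊗ₖ sigmaMatrix m +
        ((G.PMat s * ((1 / 2 : ℝ) • (N + N.transpose)) * (G.PMat s).transpose).map ofReal ⊗ₖ 1 +
          (G.PMat s * ((1 / 2 : ℝ) • (N - N.transpose)) * (G.PMat s).transpose).map ofReal ⊗ₖ
            sigmaMatrix m) := by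
    -- As `σ` is antisymmetric, transposing `P ⊗ σ` produces a sign, which makes the real part of
    -- the exponent nonnegative.
    have ht : ((G.PMat s).map ofReal ⊗ₖ sigmaMatrix m).transpose =
        -(((G.PMat s).transpose.map ofReal) ⊗ₖ sigmaMatrix m) := by
      rw [← Matrix.kroneckerMap_transpose, sigmaMatrix_transpose, Matrix.transpose_map]
      ext p q
      simp [Matrix.kroneckerMap_apply]
    rw [hQ, ht, Matrix.mul_neg, sub_neg_eq_add, Matrix.mul_add, Matrix.add_mul, ← Matrix.mul_kronecker_mul,
      ← Matrix.mul_kronecker_mul, ← Matrix.mul_kronecker_mul, ← Matrix.mul_kronecker_mul, mul_one,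
      sigmaMatrix_mul_self, one_mul]
    simp only [hmap, Matrix.map_mul]
  have e1 : ∑ c, ∑ e, ∑ e', ((G.HU s t)⁻¹ * ∑ K : G.Pair, G.mon K t *
      (G.rCoef s K e * G.rCoef s K e')) * X e c * X e' c =
        (∑ K : G.Pair, (∑ c, (∑ e, G.rCoef s K e * X e c) ^ 2) * G.mon K t) / G.HU s t := by
    rw [div_eq_inv_mul]
    simp only [pow_two, Finset.sum_mul, Finset.mul_sum]
    symm
    rw [Finset.sum_comm]
    refine Finset.sum_congr rfl fun c _ => ?_
    rw [Finset.sum_comm]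
    refine Finset.sum_congr rfl fun e _ => ?_
    rw [Finset.sum_comm]
    refine Finset.sum_congr rfl fun e' _ => Finset.sum_congr rfl fun K _ => ?_
    ring
  have e2 : ∑ e, ∑ e', (-((G.HU s t)⁻¹ * ∑ K : G.Pair, G.mon K t * G.iCoef s K e e')) *
      symp (X e) (X e') = -((∑ K : G.Pair, (∑ e, ∑ e', G.iCoef s K e e' * symp (X e) (X e')) *
        G.mon K t) / G.HU s t) := by
    rw [div_eq_inv_mul]
    simp only [Finset.sum_mul, Finset.mul_sum, ← Finset.sum_neg_distrib]
    symm
    rw [Finset.sum_comm]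
    refine Finset.sum_congr rfl fun e _ => ?_
    rw [Finset.sum_comm]
    refine Finset.sum_congr rfl fun e' _ => Finset.sum_congr rfl fun K _ => ?_
    ring
  rw [extForm, hform, evalForm_add, evalForm_add, evalForm_kronecker_one,
    evalForm_kronecker_sigma _ (Matrix.map (_ * _) _), add_div, pureExtForm]
  simp only [Matrix.map_apply, hN, sum_resolvent_symm G s ht hU, sum_resolvent_antisymm G s ht hU]
  congr 2
  · rw [← ofReal_div, ← e1]
    push_cast
    rfl
  · rw [mul_div_assoc, ← ofReal_div, neg_mul, ← mul_neg, ← neg_eq_iff_eq_neg.2 e2]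
    push_cast
    simp

/-- The exponent of the parametric representation in terms of the external invariants. -/
theorem half_mul_extForm {s : ℝ} (hs : 0 < s) (Ω : ℝ) {m : ℕ} {t : Fin G.L → ℝ} (ht : t ∈ G.cube)
    (X : G.ExtConf m) : ((Ω / 2 : ℝ) : ℂ) * G.extForm s t X =
      ((Ω / 2 : ℝ) : ℂ) * G.pureExtForm s X + G.HVoverHU s (G.invariants s Ω X) t := by
  rw [extForm_eq G hs ht, mul_add, HVoverHU, mul_div_assoc']
  congr 2
  have h1 : G.HVre s t (G.invariants s Ω X) =
      Ω / 2 * ∑ K : G.Pair, (∑ c, (∑ e, G.rCoef s K e * X e c) ^ 2) * G.mon K t := by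
    rw [HVre, Finset.mul_sum]
    simp only [invariants, Sum.elim_inl]
    rw [sum_subtype_eq_sum (f := fun K =>
      Ω / 2 * (∑ c, (∑ e, G.rCoef s K e * X e c) ^ 2) * G.mon K t) (fun K hK => by
        rw [not_not] at hK; simp [hK])]
    exact Finset.sum_congr rfl fun K _ => by ring
  have h2 : G.HVim s t (G.invariants s Ω X) = Ω / 2 * ∑ K : G.Pair,
      (∑ e, ∑ e', G.iCoef s K e e' * symp (X e) (X e')) * G.mon K t := by
    rw [HVim, Finset.mul_sum]
    simp only [invariants, Sum.elim_inr]
    rw [sum_subtype_eq_sum (f := fun K =>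
      Ω / 2 * (∑ e, ∑ e', G.iCoef s K e e' * symp (X e) (X e')) * G.mon K t) (fun K hK => by
        rw [not_not] at hK; simp [hK])]
    exact Finset.sum_congr rfl fun K _ => by ring
  rw [h1, h2]
  push_cast
  ring

theorem invariants_nonneg {Ω : ℝ} (hΩ : 0 < Ω) (s : ℝ) {m : ℕ} (X : G.ExtConf m) (K : G.KR s) :
    0 ≤ G.invariants s Ω X (.inl K) := by
  simp only [invariants, Sum.elim_inl]
  positivity

end StarGraph

/-! ### Holomorphic dependence of integrals on a parameter -/

/-- No bound on derivatives is required: Cauchy's estimate derives one from the local bound on the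
integrand. -/
theorem differentiableOn_integral_of_dominated {α : Type*} [MeasurableSpace α] {μ : Measure α}
    {F : ℂ → α → ℂ} {U : Set ℂ} (hmeas : ∀ z ∈ U, AEStronglyMeasurable (F z) μ)
    (hdiff : ∀ᵐ a ∂μ, DifferentiableOn ℂ (fun z => F z a) U)
    (hb : ∀ z₀ ∈ U, ∃ ρ > 0, Metric.ball z₀ ρ ⊆ U ∧ ∃ bound : α → ℝ, Integrable bound μ ∧
      ∀ᵐ a ∂μ, ∀ z ∈ Metric.ball z₀ ρ, ‖F z a‖ ≤ bound a) :
    DifferentiableOn ℂ (fun z => ∫ a, F z a ∂μ) U := by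
  intro z₀ hz₀
  obtain ⟨ρ, hρ, hU, bound, hbi, hbound⟩ := hb z₀ hz₀
  have hballU : ∀ᵐ a ∂μ, ∀ z ∈ Metric.ball z₀ ρ, DifferentiableAt ℂ (fun z => F z a) z := by
    filter_upwards [hdiff] with a ha z hz
    exact (ha.mono hU).differentiableAt (Metric.isOpen_ball.mem_nhds hz)
  have hz₀' : z₀ ∈ Metric.ball z₀ ρ := Metric.mem_ball_self hρ
  have hint : Integrable (F z₀) μ :=
    hbi.mono' (hmeas z₀ hz₀) (by filter_upwards [hbound] with a ha using ha z₀ hz₀')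
  have hlim : Filter.Tendsto (fun n : ℕ => z₀ + ((ρ / 2 / (n + 1) : ℝ) : ℂ)) Filter.atTop
      (nhdsWithin z₀ {z₀}ᶜ) := by
    refine tendsto_nhdsWithin_iff.2 ⟨?_, Filter.Eventually.of_forall fun n => ?_⟩
    · have h1 : Filter.Tendsto (fun n : ℕ => (ρ / 2 / (n + 1) : ℝ)) Filter.atTop (nhds 0) := by
        have := (tendsto_one_div_add_atTop_nhds_zero_nat (𝕜 := ℝ)).const_mul (ρ / 2)
        simpa [div_eq_mul_inv] using this
      have h2 := ((Complex.continuous_ofReal.tendsto 0).comp h1).const_add z₀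
      simpa using h2
    · have : (0 : ℝ) < ρ / 2 / (n + 1) := by positivity
      simp only [Set.mem_compl_iff, Set.mem_singleton_iff, add_eq_left, ofReal_eq_zero]
      exact this.ne'
  have hmem : ∀ n : ℕ, z₀ + ((ρ / 2 / (n + 1) : ℝ) : ℂ) ∈ Metric.ball z₀ ρ := by
    intro n
    rw [Metric.mem_ball, dist_eq_norm, add_sub_cancel_left, Complex.norm_real, Real.norm_eq_abs,
      abs_of_pos (by positivity)]
    have : ρ / 2 / (n + 1) ≤ ρ / 2 := div_le_self (by positivity) (by simp)
    linarith
  -- Measurability of the derivative comes from writing it as the limit of difference quotients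
  -- along a sequence.
  have hderivmeas : AEStronglyMeasurable (fun a => deriv (fun z => F z a) z₀) μ := by
    refine aestronglyMeasurable_of_tendsto_ae Filter.atTop
      (f := fun (n : ℕ) a => slope (fun z => F z a) z₀ (z₀ + ((ρ / 2 / (n + 1) : ℝ) : ℂ)))
      (fun n => ?_) ?_
    · simp only [slope_def_module]
      exact ((hmeas _ (hU (hmem n))).sub (hmeas _ hz₀)).const_smul
        (z₀ + ((ρ / 2 / (n + 1) : ℝ) : ℂ) - z₀)⁻¹
    · filter_upwards [hballU] with a ha
      exact (ha z₀ hz₀').hasDerivAt.tendsto_slope.comp hlim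
  -- For `z` in the ball of radius `ρ/4`, the circle of radius `ρ/2` around `z` stays in the ball
  -- where the bound holds.
  have hball4 : Metric.ball z₀ (ρ / 4) ∈ nhds z₀ := Metric.ball_mem_nhds _ (by positivity)
  refine (hasDerivAt_integral_of_dominated_loc_of_deriv_le (F := F)
    (F' := fun z a => deriv (fun z => F z a) z) (bound := fun a => bound a / (ρ / 2))
    hball4 ?_ hint hderivmeas ?_ (hbi.div_const _) ?_).2.differentiableAt.differentiableWithinAt
  · filter_upwards [hball4] with z hz
    exact hmeas z (hU (Metric.ball_subset_ball (by linarith) hz))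
  · filter_upwards [hballU, hbound] with a ha hb z hz
    have hsub : Metric.closedBall z (ρ / 2) ⊆ Metric.ball z₀ ρ := by
      intro w hw
      rw [Metric.mem_closedBall] at hw
      rw [Metric.mem_ball] at hz ⊢
      have := dist_triangle w z z₀
      linarith
    refine Complex.norm_deriv_le_of_forall_mem_sphere_norm_le (by positivity) ?_ fun w hw =>
      hb w (hsub (Metric.sphere_subset_closedBall hw))
    refine DifferentiableOn.diffContOnCl fun w hw => ?_
    exact (ha w (hsub (Metric.closure_ball_subset_closedBall hw))).differentiableWithinAt
  · filter_upwards [hballU] with a ha z hz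
    exact (ha z (Metric.ball_subset_ball (by linarith) hz)).hasDerivAt

/-! ### The Gamma integral with a complex rate -/

theorem mellinConvergent_exp_neg_mul {a w : ℂ} (ha : 0 < a.re) (hw : 0 < w.re) :
    MellinConvergent (fun x : ℝ => exp (-(w * x))) a := by
  have hn : ∀ x : ℝ, ‖exp (-(w * x))‖ = Real.exp (-w.re * x) := fun x => by
    rw [Complex.norm_exp]; simp
  refine mellinConvergent_of_isBigO_rpow_exp (b := 0) hw ?_ ?_ ?_ ha
  · exact ContinuousOn.locallyIntegrableOn (by fun_prop) measurableSet_Ioi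
  · refine Asymptotics.isBigO_of_le _ fun x => ?_
    rw [hn, Real.norm_eq_abs, Real.abs_exp]
  · refine Asymptotics.IsBigO.of_bound 1 ?_
    filter_upwards [self_mem_nhdsWithin] with x hx
    rw [hn, neg_zero, Real.rpow_zero, norm_one, mul_one, Real.exp_le_one_iff]
    have : 0 < w.re * x := mul_pos hw hx
    linarith

theorem norm_mellin_exp_neg_mul_le {a w : ℂ} (ha : 0 < a.re) (hw : 0 < w.re) :
    ‖mellin (fun x : ℝ => exp (-(w * x))) a‖ ≤ Real.Gamma a.re * w.re ^ (-a.re) := by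
  rw [mellin]
  refine (norm_integral_le_integral_norm _).trans (le_of_eq ?_)
  have h := Real.integral_rpow_mul_exp_neg_mul_Ioi ha hw
  rw [one_div, Real.inv_rpow hw.le, ← Real.rpow_neg hw.le, mul_comm] at h
  rw [← h]
  refine setIntegral_congr_fun measurableSet_Ioi fun x hx => ?_
  have hx' : (0 : ℝ) < x := hx
  simp only [norm_smul, Complex.norm_exp]
  rw [norm_cpow_eq_rpow_re_of_pos hx']
  simp

theorem convex_re_pos : Convex ℝ {w : ℂ | 0 < w.re} := convex_halfSpace_re_gt 0

theorem isOpen_re_pos : IsOpen {w : ℂ | 0 < w.re} := isOpen_lt continuous_const continuous_re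

/-- For positive real `w` this is Euler's integral. Both sides are holomorphic in the half plane `Re
w > 0`, so the identity theorem extends it, with the principal power. -/
theorem mellin_exp_neg_mul {a w : ℂ} (ha : 0 < a.re) (hw : 0 < w.re) :
    mellin (fun x : ℝ => exp (-(w * x))) a = w ^ (-a) * Gamma a := by
  have hopen := isOpen_re_pos
  have hF : DifferentiableOn ℂ (fun w : ℂ => mellin (fun x : ℝ => exp (-(w * x))) a)
      {w : ℂ | 0 < w.re} := by
    refine differentiableOn_integral_of_dominated (fun w hw =>
      (mellinConvergent_exp_neg_mul ha hw).aestronglyMeasurable) ?_ ?_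
    · refine Filter.Eventually.of_forall fun x => ?_
      simp only [smul_eq_mul]
      fun_prop
    · intro w₀ hw₀
      have hw₀' : 0 < w₀.re := hw₀
      have hre : ∀ z ∈ Metric.ball w₀ (w₀.re / 2), w₀.re / 2 < z.re := by
        intro z hz
        rw [Metric.mem_ball, dist_eq_norm] at hz
        have h1 := (abs_le.1 (Complex.abs_re_le_norm (z - w₀))).1
        rw [Complex.sub_re] at h1
        linarith
      have hc := mellinConvergent_exp_neg_mul (a := a) (w := ((w₀.re / 2 : ℝ) : ℂ)) ha
        (by rw [ofReal_re]; linarith)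
      refine ⟨w₀.re / 2, by linarith, fun z hz => ?_, _, hc.norm, ?_⟩
      · have := hre z hz
        show 0 < z.re
        linarith
      · filter_upwards [ae_restrict_mem measurableSet_Ioi] with x hx z hz
        have hx' : (0 : ℝ) < x := hx
        rw [norm_smul, norm_smul]
        refine mul_le_mul_of_nonneg_left ?_ (norm_nonneg _)
        rw [Complex.norm_exp, Complex.norm_exp]
        refine Real.exp_le_exp.2 ?_
        simp only [neg_re, re_mul_ofReal, ofReal_re]
        have := mul_le_mul_of_nonneg_right (hre z hz).le hx'.le
        linarith
  have hG : DifferentiableOn ℂ (fun w : ℂ => w ^ (-a) * Gamma a) {w : ℂ | 0 < w.re} := by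
    intro w hw
    refine DifferentiableAt.differentiableWithinAt ?_
    refine DifferentiableAt.mul_const ?_ _
    exact (hasStrictDerivAt_cpow_const (Or.inl hw)).hasDerivAt.differentiableAt
  refine (hF.analyticOnNhd hopen).eqOn_of_preconnected_of_frequently_eq (hG.analyticOnNhd hopen)
    convex_re_pos.isPreconnected (z₀ := 1) (by simp) ?_ hw
  have hreal : ∀ x : ℝ, 0 < x → mellin (fun y : ℝ => exp (-((x : ℂ) * y))) a =
      (x : ℂ) ^ (-a) * Gamma a := by
    intro x hx
    have h := Complex.integral_cpow_mul_exp_neg_mul_Ioi ha hx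
    rw [mellin]
    simp only [smul_eq_mul]
    rw [h, one_div, Complex.inv_cpow _ _ (by rw [arg_ofReal_of_nonneg hx.le]; exact Real.pi_pos.ne),
      ← Complex.cpow_neg]
  have hlim : Filter.Tendsto (fun n : ℕ => (((1 : ℝ) + 1 / (n + 1) : ℝ) : ℂ)) Filter.atTop
      (nhdsWithin 1 {1}ᶜ) := by
    refine tendsto_nhdsWithin_iff.2 ⟨?_, Filter.Eventually.of_forall fun n => ?_⟩
    · have h1 := (tendsto_one_div_add_atTop_nhds_zero_nat (𝕜 := ℝ)).const_add 1
      have h2 := (Complex.continuous_ofReal.tendsto _).comp h1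
      simpa [Function.comp_def] using h2
    · have : (0 : ℝ) < 1 / ((n : ℝ) + 1) := by positivity
      simp only [Set.mem_compl_iff, Set.mem_singleton_iff]
      intro h
      have h' : (1 : ℝ) + 1 / (n + 1) = 1 := by exact_mod_cast h
      linarith
  exact hlim.frequently (Filter.Frequently.of_forall fun n => hreal _ (by positivity))

/-! ### Bounds on the Gamma function -/

theorem norm_Gamma_mul_cpow_le {a w : ℂ} (ha : 0 < a.re) (hw : 0 < w.re) :
    ‖Gamma a * w ^ (-a)‖ ≤ Real.Gamma a.re * w.re ^ (-a.re) := by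
  rw [mul_comm, ← mellin_exp_neg_mul ha hw]
  exact norm_mellin_exp_neg_mul_le ha hw

theorem one_add_abs_im_le {a : ℂ} (ha : 0 < a.re) : 1 + |a.im| ≤ (1 / a.re + 1) * ‖a‖ := by
  have h1 := Complex.abs_im_le_norm a
  have h2 := (le_abs_self _).trans (Complex.abs_re_le_norm a)
  have h3 : 1 ≤ 1 / a.re * ‖a‖ := by
    rw [one_div, ← div_eq_inv_mul, le_div_iff₀ ha]
    linarith
  linarith

/-- The functional equation gives `a · Γ(a) w^(-a) = w · Γ(a+1) w^(-(a+1))`. Each shift of `a` by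
one gains a power of `1 + |Im a|` and costs `‖w‖ / Re w`. -/
theorem exists_norm_Gamma_mul_cpow_mul_pow_le {α : ℝ} (hα : 0 < α) (k : ℕ) :
    ∃ C : ℝ, 0 ≤ C ∧ ∀ a w : ℂ, a.re = α → 0 < w.re →
      ‖Gamma a * w ^ (-a)‖ * (1 + |a.im|) ^ k ≤ C * ‖w‖ ^ k * w.re ^ (-(α + k)) := by
  induction k generalizing α with
  | zero =>
    refine ⟨Real.Gamma α, (Real.Gamma_pos_of_pos hα).le, fun a w ha hw => ?_⟩
    have := norm_Gamma_mul_cpow_le (a := a) (ha ▸ hα) hw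
    simpa [ha] using this
  | succ k ih =>
    obtain ⟨C, hC, h⟩ := ih (α := α + 1) (by linarith)
    refine ⟨C * (1 / α + 1), by positivity, fun a w ha hw => ?_⟩
    have ha0 : a ≠ 0 := fun h0 => by rw [h0] at ha; simp at ha; linarith
    have hw0 : w ≠ 0 := fun h0 => by rw [h0] at hw; simp at hw
    have h1 := h (a + 1) w (by simp [ha]) hw
    have h2 : Gamma a * w ^ (-a) * a = w * (Gamma (a + 1) * w ^ (-(a + 1))) := by
      rw [Complex.Gamma_add_one a ha0, neg_add, Complex.cpow_add _ _ hw0, Complex.cpow_neg_one]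
      field_simp
    have h3 : ‖Gamma a * w ^ (-a)‖ * ‖a‖ = ‖w‖ * ‖Gamma (a + 1) * w ^ (-(a + 1))‖ := by
      rw [← norm_mul, ← norm_mul, h2]
    have h4 := one_add_abs_im_le (a := a) (ha ▸ hα)
    rw [ha] at h4
    have him : (a + 1).im = a.im := by simp
    rw [him] at h1
    calc ‖Gamma a * w ^ (-a)‖ * (1 + |a.im|) ^ (k + 1)
        = (‖Gamma a * w ^ (-a)‖ * (1 + |a.im|) ^ k) * (1 + |a.im|) := by ring
      _ ≤ (‖Gamma a * w ^ (-a)‖ * (1 + |a.im|) ^ k) * ((1 / α + 1) * ‖a‖) := by gcongr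
      _ = (‖Gamma a * w ^ (-a)‖ * ‖a‖) * (1 + |a.im|) ^ k * (1 / α + 1) := by ring
      _ = (1 / α + 1) * ‖w‖ * (‖Gamma (a + 1) * w ^ (-(a + 1))‖ * (1 + |a.im|) ^ k) := by
        rw [h3]; ring
      _ ≤ (1 / α + 1) * ‖w‖ * (C * ‖w‖ ^ k * w.re ^ (-(α + 1 + k))) := by gcongr
      _ = C * (1 / α + 1) * ‖w‖ ^ (k + 1) * w.re ^ (-(α + (k + 1 : ℕ))) := by
        push_cast
        rw [show α + 1 + (k : ℝ) = α + ((k : ℝ) + 1) by ring]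
        ring

theorem exists_norm_Gamma_mul_pow_le {α : ℝ} (hα : 0 < α) (k : ℕ) :
    ∃ C : ℝ, 0 ≤ C ∧ ∀ a : ℂ, a.re = α → ‖Gamma a‖ * (1 + |a.im|) ^ k ≤ C := by
  obtain ⟨C, hC, h⟩ := exists_norm_Gamma_mul_cpow_mul_pow_le hα k
  refine ⟨C, hC, fun a ha => ?_⟩
  simpa using h a 1 ha (by simp)

/-- Rotating the ray of Euler's integral by an angle close to `π/2` extracts the exponential decay
of `Γ`; only a linear loss in `Im a` is incurred, which later estimates can afford. -/
theorem exists_norm_Gamma_mul_exp_le {α : ℝ} (hα : 0 < α) (hα1 : α ≤ 1) :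
    ∃ C : ℝ, 0 ≤ C ∧ ∀ a : ℂ, a.re = α →
      ‖Gamma a‖ * Real.exp (Real.pi / 2 * |a.im|) ≤ C * (1 + |a.im|) := by
  refine ⟨Real.exp 1 * (Real.Gamma α * (Real.pi / 2) ^ α), ?_, fun a ha => ?_⟩
  · have := Real.Gamma_pos_of_pos hα
    positivity
  set x := |a.im| with hx
  have hx0 : 0 ≤ x := abs_nonneg _
  -- With this distance to the right angle, the missing exponential factor is at most `e`, while `Re
  -- w = sin δ` is at least a constant over `1 + x`. The hypothesis `α ≤ 1` makes the resulting loss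
  -- linear.
  set δ : ℝ := 1 / (1 + x) with hδ
  have hδ0 : 0 < δ := by positivity
  have hδ1 : δ ≤ 1 := by rw [hδ, div_le_one (by positivity)]; linarith
  have hpi := Real.pi_gt_three
  obtain ⟨θ, hθ, hθx⟩ : ∃ θ : ℝ, |θ| = Real.pi / 2 - δ ∧ θ * a.im = (Real.pi / 2 - δ) * x := by
    have h0 : 0 ≤ Real.pi / 2 - δ := by linarith
    rcases le_total 0 a.im with h | h
    · exact ⟨Real.pi / 2 - δ, abs_of_nonneg h0, by rw [hx, abs_of_nonneg h]⟩
    · exact ⟨-(Real.pi / 2 - δ), by rw [abs_neg, abs_of_nonneg h0], by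
        rw [hx, abs_of_nonpos h]; ring⟩
  set w : ℂ := exp (θ * I) with hw
  have hwre : w.re = Real.sin δ := by
    rw [hw, Complex.exp_ofReal_mul_I_re, ← Real.cos_abs, hθ, Real.cos_pi_div_two_sub]
  have hsin : 2 / Real.pi * δ ≤ Real.sin δ := Real.mul_le_sin hδ0.le (by linarith)
  have hsin0 : 0 < Real.sin δ := lt_of_lt_of_le (by positivity) hsin
  have hwnorm : ‖w‖ = 1 := Complex.norm_exp_ofReal_mul_I θ
  have hw0 : w ≠ 0 := Complex.exp_ne_zero _
  have harg : arg w = θ := by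
    rw [hw, Complex.arg_exp_mul_I, toIocMod_eq_self]
    have := abs_le.1 hθ.le
    constructor <;> linarith [this.1, this.2]
  have h1 := norm_Gamma_mul_cpow_le (a := a) (w := w) (ha ▸ hα) (hwre ▸ hsin0)
  rw [norm_mul, norm_cpow_of_ne_zero hw0, hwnorm, Real.one_rpow, harg, neg_im, mul_neg, hθx,
    Real.exp_neg, one_div, inv_inv, ha, hwre] at h1
  have h2 : Real.sin δ ^ (-α) ≤ (Real.pi / 2) ^ α * (1 + x) := by
    have h3 : Real.sin δ ^ (-α) ≤ (2 / Real.pi * δ) ^ (-α) :=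
      Real.rpow_le_rpow_of_nonpos (by positivity) hsin (by linarith)
    have h4 : (2 / Real.pi * δ) ^ (-α) = (Real.pi / 2) ^ α * (1 + x) ^ α := by
      rw [Real.rpow_neg (by positivity), ← Real.inv_rpow (by positivity), hδ,
        ← Real.mul_rpow (by positivity) (by positivity)]
      congr 1
      field_simp
    have h5 : (1 + x) ^ α ≤ 1 + x := by
      conv_rhs => rw [← Real.rpow_one (1 + x)]
      exact Real.rpow_le_rpow_of_exponent_le (by linarith) hα1
    rw [h4] at h3
    exact h3.trans (mul_le_mul_of_nonneg_left h5 (by positivity))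
  have h6 : Real.exp (Real.pi / 2 * x) ≤ Real.exp 1 * Real.exp ((Real.pi / 2 - δ) * x) := by
    rw [← Real.exp_add]
    refine Real.exp_le_exp.2 ?_
    have : δ * x ≤ 1 := by
      rw [hδ, one_div, ← div_eq_inv_mul, div_le_one (by positivity)]
      linarith
    linarith
  have hG := Real.Gamma_pos_of_pos hα
  calc ‖Gamma a‖ * Real.exp (Real.pi / 2 * x)
      ≤ ‖Gamma a‖ * (Real.exp 1 * Real.exp ((Real.pi / 2 - δ) * x)) := by gcongr
    _ = Real.exp 1 * (‖Gamma a‖ * Real.exp ((Real.pi / 2 - δ) * x)) := by ring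
    _ ≤ Real.exp 1 * (Real.Gamma α * Real.sin δ ^ (-α)) := by gcongr
    _ ≤ Real.exp 1 * (Real.Gamma α * ((Real.pi / 2) ^ α * (1 + x))) := by gcongr
    _ = _ := by ring

/-- The ratio is a beta integral, bounded in modulus by the same integral at the real parts. -/
theorem exists_norm_Gamma_mul_Gamma_le {α β : ℝ} (hα : 0 < α) (hβ : 0 < β) :
    ∃ C : ℝ, 0 ≤ C ∧ ∀ a b : ℂ, a.re = α → b.re = β →
      ‖Gamma a * Gamma b‖ ≤ C * ‖Gamma (a + b)‖ := by
  refine ⟨∫ x in Set.Ioc (0 : ℝ) 1, x ^ (α - 1) * (1 - x) ^ (β - 1), ?_, fun a b ha hb => ?_⟩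
  · refine setIntegral_nonneg measurableSet_Ioc fun x hx => ?_
    have h1 := hx.1
    have h2 : 0 ≤ 1 - x := by linarith [hx.2]
    positivity
  · rw [Complex.Gamma_mul_Gamma_eq_betaIntegral (ha ▸ hα) (hb ▸ hβ), norm_mul, mul_comm]
    refine mul_le_mul_of_nonneg_right ?_ (norm_nonneg _)
    rw [Complex.betaIntegral, intervalIntegral.integral_of_le zero_le_one]
    refine (norm_integral_le_integral_norm _).trans (le_of_eq ?_)
    rw [integral_Ioc_eq_integral_Ioo, integral_Ioc_eq_integral_Ioo]
    refine setIntegral_congr_fun measurableSet_Ioo fun x hx => ?_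
    have h1 := hx.1
    have h2 : 0 < 1 - x := by linarith [hx.2]
    simp only [norm_mul]
    rw [norm_cpow_eq_rpow_re_of_pos h1, ← ofReal_one, ← ofReal_sub,
      norm_cpow_eq_rpow_re_of_pos h2]
    simp [ha, hb]

/-- The function `1/Γ` is entire, and inverting it recovers `Γ` also at the poles, where both
conventions give `0`. -/
theorem measurable_complexGamma : Measurable Gamma := by
  have h : Measurable fun s : ℂ => (Gamma s)⁻¹ := by
    simpa [one_div] using differentiable_one_div_Gamma.continuous.measurable
  convert h.inv using 1
  ext s
  simp

theorem cpow_finset_sum {ι : Type*} {x : ℂ} (hx : x ≠ 0) (s : Finset ι) (f : ι → ℂ) :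
    x ^ (∑ j ∈ s, f j) = ∏ j ∈ s, x ^ f j := by
  classical
  induction s using Finset.induction_on with
  | empty => simp
  | insert i s hi ih => rw [Finset.sum_insert hi, Finset.prod_insert hi, cpow_add _ _ hx, ih]

theorem integrable_one_add_abs_pow_neg_two : Integrable fun x : ℝ => ((1 + |x|) ^ 2)⁻¹ := by
  refine integrable_inv_one_add_sq.mono' (by fun_prop) (Filter.Eventually.of_forall fun x => ?_)
  rw [norm_inv, Real.norm_eq_abs, abs_of_nonneg (by positivity)]
  refine inv_anti₀ (by positivity) ?_
  nlinarith [abs_nonneg x, sq_abs x]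

theorem integrable_prod_one_add_abs_pow_neg_two (ι : Type*) [Fintype ι] :
    Integrable fun η : ι → ℝ => ∏ j, ((1 + |η j|) ^ 2)⁻¹ :=
  Integrable.fintype_prod (f := fun _ x => ((1 + |x|) ^ 2)⁻¹)
    fun _ => integrable_one_add_abs_pow_neg_two

/-! ### Mellin inversion for the exponential -/

theorem norm_Gamma_mul_cpow_le_inv_sq {τ : ℝ} (hτ : τ < 0) {w : ℂ} (hw : 0 < w.re) :
    ∃ C : ℝ, 0 ≤ C ∧ ∀ η : ℝ, ‖Gamma (-(τ + I * η)) * w ^ ((τ : ℂ) + I * η)‖ ≤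
      C * ((1 + |η|) ^ 2)⁻¹ := by
  obtain ⟨C, hC, h⟩ := exists_norm_Gamma_mul_cpow_mul_pow_le (α := -τ) (by linarith) 2
  refine ⟨C * ‖w‖ ^ 2 * w.re ^ (-(-τ + (2 : ℕ))), by positivity, fun η => ?_⟩
  have := h (-(τ + I * η)) w (by simp) hw
  rw [← div_eq_mul_inv, le_div_iff₀ (by positivity)]
  simpa using this

theorem integrable_Gamma_mul_cpow {τ : ℝ} (hτ : τ < 0) {w : ℂ} (hw : 0 < w.re) :
    Integrable fun η : ℝ => Gamma (-(τ + I * η)) * w ^ ((τ : ℂ) + I * η) := by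
  obtain ⟨C, hC, h⟩ := norm_Gamma_mul_cpow_le_inv_sq hτ hw
  refine (integrable_one_add_abs_pow_neg_two.const_mul C).mono' ?_ (Filter.Eventually.of_forall h)
  refine Measurable.aestronglyMeasurable ?_
  exact (measurable_complexGamma.comp (by fun_prop)).mul
    (Measurable.pow measurable_const (by fun_prop))

/-- Mellin inversion on the line of real part `-τ > 0`, with `η` replaced by `-η` so that the
exponent reads `τ + iη`. Positivity of `Re w` makes the integral absolutely convergent. -/
theorem exp_neg_mul_eq_integral {τ : ℝ} (hτ : τ < 0) {w : ℂ} (hw : 0 < w.re) {x : ℝ}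
    (hx : 0 < x) : exp (-(w * x)) = (1 / (2 * (Real.pi : ℂ))) *
      ∫ η : ℝ, Gamma (-(τ + I * η)) * w ^ ((τ : ℂ) + I * η) * (x : ℂ) ^ ((τ : ℂ) + I * η) := by
  have hre : ∀ η : ℝ, 0 < (((-τ : ℝ) : ℂ) + η * I).re := fun η => by simp [hτ]
  have hv : VerticalIntegrable (mellin fun x : ℝ => exp (-(w * x))) (-τ) := by
    have h1 := (integrable_Gamma_mul_cpow hτ hw).comp_neg
    refine h1.congr (Filter.Eventually.of_forall fun η => ?_)
    simp only
    rw [mellin_exp_neg_mul (hre η) hw, mul_comm]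
    push_cast
    congr 2 <;> ring
  have h := mellinInv_mellin_eq (-τ) (fun x : ℝ => exp (-(w * x))) hx
    (mellinConvergent_exp_neg_mul (by simp [hτ]) hw) hv (by fun_prop)
  rw [← h, mellinInv, ← integral_neg_eq_self, Complex.real_smul]
  congr 1
  · push_cast; rfl
  · refine integral_congr_ae (Filter.Eventually.of_forall fun η => ?_)
    have h2 := mellin_exp_neg_mul (hre (-η)) hw
    simp only [smul_eq_mul]
    rw [h2]
    have e : -(((-τ : ℝ) : ℂ) + ((-η : ℝ) : ℂ) * I) = (τ : ℂ) + I * η := by push_cast; ring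
    have e' : (((-τ : ℝ) : ℂ) + ((-η : ℝ) : ℂ) * I) = -((τ : ℂ) + I * η) := by push_cast; ring
    rw [e, e']
    ring

/-! ### Several Mellin variables and the Barnes splitting of a sum -/

section MultiMellin

variable {Y : Type*} [Fintype Y]

theorem prod_exp_neg_mul_eq_integral {τ : Y → ℝ} (hτ : ∀ j, τ j < 0) {w : Y → ℂ}
    (hw : ∀ j, 0 < (w j).re) {x : Y → ℝ} (hx : ∀ j, 0 < x j) :
    ∏ j, exp (-(w j * x j)) = (1 / (2 * (Real.pi : ℂ))) ^ Fintype.card Y *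
      ∫ η : Y → ℝ, ∏ j, (Gamma (-(τ j + I * η j)) * w j ^ ((τ j : ℂ) + I * η j) *
        (x j : ℂ) ^ ((τ j : ℂ) + I * η j)) := by
  rw [integral_fintype_prod_volume_eq_prod (fun j (η : ℝ) =>
    Gamma (-(τ j + I * η)) * w j ^ ((τ j : ℂ) + I * η) * (x j : ℂ) ^ ((τ j : ℂ) + I * η)),
    ← Finset.card_univ, ← Finset.prod_const, ← Finset.prod_mul_distrib]
  exact Finset.prod_congr rfl fun j _ => exp_neg_mul_eq_integral (hτ j) (hw j) (hx j)

theorem integrable_prod_Gamma_mul_cpow {τ : Y → ℝ} (hτ : ∀ j, τ j < 0) {w : Y → ℂ}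
    (hw : ∀ j, 0 < (w j).re) :
    Integrable fun η : Y → ℝ =>
      ∏ j, (Gamma (-(τ j + I * η j)) * w j ^ ((τ j : ℂ) + I * η j)) :=
  Integrable.fintype_prod (f := fun j (η : ℝ) =>
    Gamma (-(τ j + I * η)) * w j ^ ((τ j : ℂ) + I * η))
    fun j => integrable_Gamma_mul_cpow (hτ j) (hw j)

/-- The Mellin–Barnes splitting of a negative power of a sum. -/
theorem Gamma_mul_sum_cpow_eq_integral {σ : Y → ℝ} (hσ : ∀ j, σ j < 0) {z : ℂ}
    (hz : 0 < z.re + ∑ j, σ j) {b₀ : ℝ} (hb₀ : 0 < b₀) {b : Y → ℝ} (hb : ∀ j, 0 < b j) :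
    Gamma z * ((b₀ + ∑ j, b j : ℝ) : ℂ) ^ (-z) = (1 / (2 * (Real.pi : ℂ))) ^ Fintype.card Y *
      ∫ η : Y → ℝ, (∏ j, (Gamma (-(σ j + I * η j)) * (b j : ℂ) ^ ((σ j : ℂ) + I * η j))) *
        (Gamma (z + ∑ j, (σ j + I * η j)) * (b₀ : ℂ) ^ (-(z + ∑ j, (σ j + I * η j)))) := by
  have hσs : ∑ j, σ j ≤ 0 := Finset.sum_nonpos fun j _ => (hσ j).le
  have hzre : 0 < z.re := by linarith
  have hB : 0 < b₀ + ∑ j, b j := add_pos_of_pos_of_nonneg hb₀ (Finset.sum_nonneg fun j _ => (hb j).le)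
  have hcpow : ∀ {c : ℝ} (_ : 0 < c) (u : ℂ), (1 / (c : ℂ)) ^ u = (c : ℂ) ^ (-u) := by
    intro c hc u
    rw [one_div, Complex.inv_cpow _ _ (by
      rw [arg_ofReal_of_nonneg hc.le]; exact Real.pi_pos.ne), ← Complex.cpow_neg]
  have h1 := Complex.integral_cpow_mul_exp_neg_mul_Ioi hzre hB
  rw [hcpow hB, mul_comm] at h1
  rw [← h1]
  -- In Euler's integral for the power, the exponentials of the `b j` are replaced by their Mellin
  -- integrals and that of `b₀` is kept. Integrating over `α` first gives the last Gamma factor.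
  let F : ℝ → (Y → ℝ) → ℂ := fun α η => ((α : ℂ) ^ (z - 1) * exp (-(b₀ * α))) *
    ∏ j, (Gamma (-(σ j + I * η j)) * (b j : ℂ) ^ ((σ j : ℂ) + I * η j) *
      (α : ℂ) ^ ((σ j : ℂ) + I * η j))
  -- Fubini is justified by `hz`, which makes the power of `α` integrable at `0`, and by the
  -- exponential of `b₀` at infinity.
  have hFint : Integrable (Function.uncurry F) ((volume.restrict (Set.Ioi 0)).prod volume) := by
    have i1 : Integrable (fun α : ℝ => α ^ (z.re + ∑ j, σ j - 1) * Real.exp (-(b₀ * α)))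
        (volume.restrict (Set.Ioi 0)) := by
      have h := (mellinConvergent_exp_neg_mul (a := ((z.re + ∑ j, σ j : ℝ) : ℂ)) (w := b₀)
        (by rw [ofReal_re]; exact hz) (by rw [ofReal_re]; exact hb₀)).norm
      refine (integrable_congr ?_).1 h
      filter_upwards [ae_restrict_mem measurableSet_Ioi] with α hα
      have hα' : (0 : ℝ) < α := hα
      rw [norm_smul, norm_cpow_eq_rpow_re_of_pos hα', Complex.norm_exp]
      simp
    have i2 := (integrable_prod_Gamma_mul_cpow hσ (w := fun j => (b j : ℂ)) (by simpa using hb)).norm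
    refine (i1.mul_prod i2).mono' ?_ ?_
    · refine Measurable.aestronglyMeasurable ?_
      refine Measurable.mul (Measurable.mul (Measurable.pow (by fun_prop) (by fun_prop))
        (by fun_prop)) ?_
      refine Finset.measurable_prod _ fun j _ => ?_
      exact ((measurable_complexGamma.comp (by fun_prop)).mul
        (Measurable.pow measurable_const (by fun_prop))).mul (Measurable.pow (by fun_prop) (by fun_prop))
    · have hae : ∀ᵐ p : ℝ × (Y → ℝ) ∂((volume.restrict (Set.Ioi 0)).prod volume), 0 < p.1 := by
        have := Measure.ae_prod_iff_ae_ae (μ := volume.restrict (Set.Ioi (0 : ℝ)))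
          (ν := (volume : Measure (Y → ℝ))) (p := fun p => 0 < p.1)
          (measurableSet_lt measurable_const measurable_fst)
        rw [this]
        filter_upwards [ae_restrict_mem measurableSet_Ioi] with α hα
        exact Filter.Eventually.of_forall fun _ => hα
      filter_upwards [hae] with p hp
      refine le_of_eq ?_
      simp only [Function.uncurry, F, norm_mul, norm_prod, Finset.prod_mul_distrib]
      rw [norm_cpow_eq_rpow_re_of_pos hp, Complex.norm_exp]
      have e1 : ∏ j, ‖(p.1 : ℂ) ^ ((σ j : ℂ) + I * p.2 j)‖ = p.1 ^ (∑ j, σ j) := by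
        rw [Real.rpow_sum_of_pos hp]
        exact Finset.prod_congr rfl fun j _ => by rw [norm_cpow_eq_rpow_re_of_pos hp]; simp
      rw [e1, show z.re + ∑ j, σ j - 1 = (z.re - 1) + ∑ j, σ j by ring, Real.rpow_add hp]
      simp
      ring
  calc ∫ α in Set.Ioi (0 : ℝ), (α : ℂ) ^ (z - 1) * exp (-(((b₀ + ∑ j, b j : ℝ) : ℂ) * α))
      = ∫ α in Set.Ioi (0 : ℝ), (1 / (2 * (Real.pi : ℂ))) ^ Fintype.card Y *
          ∫ η : Y → ℝ, F α η := by
        refine setIntegral_congr_fun measurableSet_Ioi fun α hα => ?_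
        have hα' : (0 : ℝ) < α := hα
        have h2 := prod_exp_neg_mul_eq_integral hσ (w := fun j => (b j : ℂ)) (x := fun _ => α)
          (by simpa using hb) (fun _ => hα')
        simp only [F, integral_const_mul]
        rw [mul_left_comm, ← h2, ← Complex.exp_sum, mul_assoc, ← Complex.exp_add]
        congr 2
        push_cast
        rw [add_mul, Finset.sum_mul, Finset.sum_neg_distrib]
        ring
    _ = (1 / (2 * (Real.pi : ℂ))) ^ Fintype.card Y *
          ∫ η : Y → ℝ, ∫ α in Set.Ioi (0 : ℝ), F α η := by
        rw [integral_const_mul, integral_integral_swap hFint]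
    _ = _ := by
        congr 1
        refine integral_congr_ae (Filter.Eventually.of_forall fun η => ?_)
        have hu : 0 < (z + ∑ j, ((σ j : ℂ) + I * η j)).re := by
          rw [add_re, re_sum]
          simpa using hz
        have h3 := Complex.integral_cpow_mul_exp_neg_mul_Ioi hu hb₀
        rw [hcpow hb₀, mul_comm] at h3
        simp only
        rw [← h3, ← integral_const_mul]
        refine setIntegral_congr_fun measurableSet_Ioi fun α hα => ?_
        have hα0 : (α : ℂ) ≠ 0 := by
          have : (0 : ℝ) < α := hα
          exact_mod_cast this.ne'
        simp only [F]
        rw [Finset.prod_mul_distrib, show z + ∑ j, ((σ j : ℂ) + I * η j) - 1 =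
          (z - 1) + ∑ j, ((σ j : ℂ) + I * η j) by ring, Complex.cpow_add _ _ hα0,
          cpow_finset_sum hα0]
        ring

end MultiMellin

/-! ### Bounds for ratios of Gamma functions -/

/-- Applying the beta bound at `a + 1` multiplies the left side by `a` and the right by `a + b`. So
powers of `Im a` are traded for powers of `Im (a + b)`. -/
theorem exists_norm_Gamma_mul_Gamma_mul_pow_le {α β : ℝ} (hα : 0 < α) (hβ : 0 < β) (k : ℕ) :
    ∃ C : ℝ, 0 ≤ C ∧ ∀ a b : ℂ, a.re = α → b.re = β →
      ‖Gamma a * Gamma b‖ * (1 + |a.im|) ^ k ≤ C * (‖Gamma (a + b)‖ * (1 + |(a + b).im|) ^ k) := by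
  induction k generalizing α with
  | zero =>
    obtain ⟨C, hC, h⟩ := exists_norm_Gamma_mul_Gamma_le hα hβ
    exact ⟨C, hC, fun a b ha hb => by simpa using h a b ha hb⟩
  | succ k ih =>
    obtain ⟨C, hC, h⟩ := ih (α := α + 1) (by linarith)
    refine ⟨C * (1 / α + 1) * (α + β + 1), by positivity, fun a b ha hb => ?_⟩
    have ha0 : a ≠ 0 := fun h0 => by rw [h0] at ha; simp at ha; linarith
    have hab0 : a + b ≠ 0 := fun h0 => by
      have := congrArg re h0
      simp [ha, hb] at this
      linarith
    have h1 := h (a + 1) b (by simp [ha]) hb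
    rw [Complex.Gamma_add_one a ha0, show a + 1 + b = (a + b) + 1 by ring,
      Complex.Gamma_add_one _ hab0, mul_assoc a, norm_mul a, norm_mul (a + b)] at h1
    have him : (a + 1).im = a.im := by simp
    have him' : (a + b + 1).im = (a + b).im := by simp
    rw [him, him'] at h1
    have h4 := one_add_abs_im_le (a := a) (ha ▸ hα)
    rw [ha] at h4
    have h5 : ‖a + b‖ ≤ (α + β + 1) * (1 + |(a + b).im|) := by
      have := Complex.norm_le_abs_re_add_abs_im (a + b)
      rw [add_re, ha, hb, abs_of_pos (by linarith : 0 < α + β)] at this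
      nlinarith [abs_nonneg (a + b).im]
    calc ‖Gamma a * Gamma b‖ * (1 + |a.im|) ^ (k + 1)
        = ‖Gamma a * Gamma b‖ * (1 + |a.im|) ^ k * (1 + |a.im|) := by ring
      _ ≤ ‖Gamma a * Gamma b‖ * (1 + |a.im|) ^ k * ((1 / α + 1) * ‖a‖) := by gcongr
      _ = (1 / α + 1) * (‖a‖ * ‖Gamma a * Gamma b‖ * (1 + |a.im|) ^ k) := by ring
      _ ≤ (1 / α + 1) * (C * (‖a + b‖ * ‖Gamma (a + b)‖ * (1 + |(a + b).im|) ^ k)) := by gcongr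
      _ ≤ (1 / α + 1) * (C * (((α + β + 1) * (1 + |(a + b).im|)) * ‖Gamma (a + b)‖ *
            (1 + |(a + b).im|) ^ k)) := by gcongr
      _ = _ := by ring

/-- Variables are absorbed one at a time into the partial sum. It supplies the decay of the Barnes
kernel in all variables but one, up to a polynomial in the imaginary part of the total. -/
theorem exists_norm_prod_Gamma_le {X : Type*} (s : Finset X) {α : X → ℝ} (hα : ∀ j, 0 < α j)
    {β : ℝ} (hβ : 0 < β) : ∃ C : ℝ, 0 ≤ C ∧ ∃ M : ℕ, ∀ (a : X → ℂ) (b : ℂ),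
      (∀ j, (a j).re = α j) → b.re = β →
        ‖(∏ j ∈ s, Gamma (a j)) * Gamma b‖ * ∏ j ∈ s, (1 + |(a j).im|) ^ 2 ≤
          C * (‖Gamma (∑ j ∈ s, a j + b)‖ * (1 + |(∑ j ∈ s, a j + b).im|) ^ M) := by
  classical
  induction s using Finset.induction_on with
  | empty => exact ⟨1, zero_le_one, 0, fun a b ha hb => by simp⟩
  | insert i s hi ih =>
    obtain ⟨C, hC, M, h⟩ := ih
    obtain ⟨C', hC', h'⟩ := exists_norm_Gamma_mul_Gamma_mul_pow_le (hα i)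
      (add_pos_of_nonneg_of_pos (Finset.sum_nonneg fun j _ => (hα j).le) hβ :
        0 < ∑ j ∈ s, α j + β) (M + 2)
    refine ⟨C * C', by positivity, M + (M + 2), fun a b ha hb => ?_⟩
    have h1 := h a b ha hb
    have h2 := h' (a i) (∑ j ∈ s, a j + b) (ha i) (by simp [re_sum, ha, hb])
    rw [Finset.prod_insert hi, Finset.prod_insert hi, Finset.sum_insert hi]
    set S := ∑ j ∈ s, a j + b with hS
    have hZ : a i + ∑ j ∈ s, a j + b = a i + S := by rw [hS]; ring
    rw [hZ]
    -- The partial sum is controlled by the new total and the new variable, so `M` further powers of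
    -- the latter must be absorbed besides the two required.
    have h3 : 1 + |S.im| ≤ (1 + |(a i + S).im|) * (1 + |(a i).im|) := by
      have e : S.im = (a i + S).im - (a i).im := by simp
      have := abs_sub (a i + S).im (a i).im
      rw [← e] at this
      nlinarith [abs_nonneg (a i + S).im, abs_nonneg (a i).im]
    calc ‖Gamma (a i) * (∏ j ∈ s, Gamma (a j)) * Gamma b‖ *
          ((1 + |(a i).im|) ^ 2 * ∏ j ∈ s, (1 + |(a j).im|) ^ 2)
        = ‖Gamma (a i)‖ * (1 + |(a i).im|) ^ 2 *
          (‖(∏ j ∈ s, Gamma (a j)) * Gamma b‖ * ∏ j ∈ s, (1 + |(a j).im|) ^ 2) := by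
          rw [mul_assoc, norm_mul]; ring
      _ ≤ ‖Gamma (a i)‖ * (1 + |(a i).im|) ^ 2 * (C * (‖Gamma S‖ * (1 + |S.im|) ^ M)) := by
          gcongr
      _ ≤ ‖Gamma (a i)‖ * (1 + |(a i).im|) ^ 2 * (C * (‖Gamma S‖ *
            ((1 + |(a i + S).im|) * (1 + |(a i).im|)) ^ M)) := by gcongr
      _ = C * (1 + |(a i + S).im|) ^ M *
            (‖Gamma (a i) * Gamma S‖ * (1 + |(a i).im|) ^ (M + 2)) := by
          rw [norm_mul, mul_pow]; ring
      _ ≤ C * (1 + |(a i + S).im|) ^ M *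
            (C' * (‖Gamma (a i + S)‖ * (1 + |(a i + S).im|) ^ (M + 2))) := by gcongr
      _ = _ := by ring

/-! ### Beta integrals in the variable `t` -/

/-- The substitution `x = t²` turns this into a beta integral. The integrand is extended by zero to
the half line, where the change of variables is available. -/
theorem integrableOn_and_integral_cpow_mul_one_sub_sq {u v : ℂ} (hu : 0 < u.re) (hv : 0 < v.re) :
    IntegrableOn (fun t : ℝ => (t : ℂ) ^ (u - 1) * ((1 - t ^ 2 : ℝ) : ℂ) ^ (v - 1)) (Set.Ioo 0 1) ∧
      ∫ t in Set.Ioo (0 : ℝ) 1, (t : ℂ) ^ (u - 1) * ((1 - t ^ 2 : ℝ) : ℂ) ^ (v - 1) =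
        Gamma (u / 2) * Gamma v / (2 * Gamma (u / 2 + v)) := by
  have hu2 : 0 < (u / 2).re := by simpa using hu
  let g : ℝ → ℂ := (Set.Ioo (0 : ℝ) 1).indicator
    fun x => (x : ℂ) ^ (u / 2 - 1) * (1 - (x : ℂ)) ^ (v - 1)
  have hconv := Complex.betaIntegral_convergent hu2 hv
  rw [intervalIntegrable_iff_integrableOn_Ioo_of_le zero_le_one] at hconv
  have hsub : Set.Ioi (0 : ℝ) ∩ Set.Ioo 0 1 = Set.Ioo 0 1 :=
    Set.inter_eq_right.2 fun x hx => hx.1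
  have hg : IntegrableOn g (Set.Ioi 0) := by
    have := (integrable_indicator_iff measurableSet_Ioo).2 hconv
    exact this.integrableOn
  have hgi : ∫ x in Set.Ioi (0 : ℝ), g x = Complex.betaIntegral (u / 2) v := by
    rw [setIntegral_indicator measurableSet_Ioo, hsub, Complex.betaIntegral,
      intervalIntegral.integral_of_le zero_le_one, integral_Ioc_eq_integral_Ioo]
  have hcomp : ∀ x ∈ Set.Ioi (0 : ℝ), (2 * x ^ ((2 : ℝ) - 1)) • g (x ^ (2 : ℝ)) =
      (Set.Ioo (0 : ℝ) 1).indicator (fun t : ℝ => 2 * ((t : ℂ) ^ (u - 1) *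
        ((1 - t ^ 2 : ℝ) : ℂ) ^ (v - 1))) x := by
    intro x hx
    have hx' : (0 : ℝ) < x := hx
    have hx0 : (x : ℂ) ≠ 0 := by exact_mod_cast hx'.ne'
    by_cases h1 : x < 1
    · have hm : x ∈ Set.Ioo (0 : ℝ) 1 := ⟨hx', h1⟩
      have hm2 : x ^ (2 : ℝ) ∈ Set.Ioo (0 : ℝ) 1 :=
        ⟨by positivity, Real.rpow_lt_one hx'.le h1 two_pos⟩
      simp only [g]
      rw [Set.indicator_of_mem hm, Set.indicator_of_mem hm2, show (2 : ℝ) - 1 = 1 by norm_num,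
        Real.rpow_one, Real.rpow_two, Complex.real_smul]
      have e1 : (((x ^ 2 : ℝ) : ℂ)) ^ (u / 2 - 1) * x = (x : ℂ) ^ (u - 1) := by
        push_cast
        rw [pow_two, ← ofReal_mul, ofReal_mul, Complex.mul_cpow_ofReal_nonneg hx'.le hx'.le,
          ← Complex.cpow_add _ _ hx0]
        nth_rewrite 2 [← Complex.cpow_one (x : ℂ)]
        rw [← Complex.cpow_add _ _ hx0]
        congr 1
        ring
      rw [← e1]
      push_cast
      ring
    · have hm : x ∉ Set.Ioo (0 : ℝ) 1 := fun h => h1 h.2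
      have hm2 : x ^ (2 : ℝ) ∉ Set.Ioo (0 : ℝ) 1 := fun h =>
        absurd (Real.one_le_rpow (not_lt.1 h1) (by norm_num : (0 : ℝ) ≤ 2)) (not_le.2 h.2)
      simp only [g]
      rw [Set.indicator_of_notMem hm, Set.indicator_of_notMem hm2, smul_zero]
  have hi := (integrableOn_Ioi_comp_rpow_iff g (two_ne_zero (α := ℝ))).2 hg
  rw [abs_of_pos two_pos] at hi
  have hi' := hi.congr_fun hcomp measurableSet_Ioi
  have h2 := integral_comp_rpow_Ioi_of_pos (g := g) (two_pos (α := ℝ))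
  rw [setIntegral_congr_fun measurableSet_Ioi hcomp, setIntegral_indicator measurableSet_Ioo, hsub,
    integral_const_mul, hgi] at h2
  constructor
  · have h3 : IntegrableOn _ (Set.Ioo (0 : ℝ) 1) := hi'.mono_set (fun x hx => hx.1)
    have h4 : IntegrableOn (fun t : ℝ => 2 * ((t : ℂ) ^ (u - 1) *
        ((1 - t ^ 2 : ℝ) : ℂ) ^ (v - 1))) (Set.Ioo 0 1) :=
      h3.congr_fun (fun x hx => Set.indicator_of_mem hx _) measurableSet_Ioo
    refine IntegrableOn.congr_fun (h4.const_mul (1 / 2)) (fun x _ => ?_) measurableSet_Ioo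
    ring
  · have hΓ : Gamma (u / 2 + v) ≠ 0 := Complex.Gamma_ne_zero_of_re_pos (by
      rw [add_re]; linarith)
    rw [Complex.Gamma_mul_Gamma_eq_betaIntegral hu2 hv, ← h2]
    rw [eq_div_iff (mul_ne_zero two_ne_zero hΓ)]
    ring

theorem integrableOn_rpow_mul_one_sub_sq {α β : ℝ} (hα : 0 < α) (hβ : 0 < β) :
    IntegrableOn (fun t : ℝ => t ^ (α - 1) * (1 - t ^ 2) ^ (β - 1)) (Set.Ioo 0 1) := by
  have h := (integrableOn_and_integral_cpow_mul_one_sub_sq (u := α) (v := β)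
    (by simpa using hα) (by simpa using hβ)).1.norm
  refine IntegrableOn.congr_fun h (fun t ht => ?_) measurableSet_Ioo
  have h2 : 0 < 1 - t ^ 2 := by nlinarith [ht.1, ht.2]
  simp only [norm_mul]
  rw [norm_cpow_eq_rpow_re_of_pos ht.1, norm_cpow_eq_rpow_re_of_pos h2]
  simp

theorem dimStrip_isOpen : IsOpen dimStrip :=
  (isOpen_lt continuous_const continuous_re).inter (isOpen_lt continuous_re continuous_const)

namespace StarGraph

variable (G : StarGraph)

theorem measurableSet_cube : MeasurableSet G.cube :=
  MeasurableSet.univ_pi fun _ => measurableSet_Ioo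

theorem volume_restrict_cube : (volume : Measure (Fin G.L → ℝ)).restrict G.cube =
    Measure.pi fun _ => volume.restrict (Set.Ioo 0 1) := by
  rw [cube, volume_pi, Measure.restrict_pi_pi]

theorem integrableOn_cube_prod {α β : Fin G.L → ℝ} (hα : ∀ ℓ, 0 < α ℓ) (hβ : ∀ ℓ, 0 < β ℓ) :
    IntegrableOn (fun t : Fin G.L → ℝ => ∏ ℓ, (t ℓ ^ (α ℓ - 1) * (1 - t ℓ ^ 2) ^ (β ℓ - 1)))
      G.cube := by
  rw [IntegrableOn, volume_restrict_cube]
  exact Integrable.fintype_prod (f := fun ℓ t => t ^ (α ℓ - 1) * (1 - t ^ 2) ^ (β ℓ - 1))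
    fun ℓ => integrableOn_rpow_mul_one_sub_sq (hα ℓ) (hβ ℓ)

theorem integral_cube_prod {φ : Fin G.L → ℂ} {v : ℂ} (hφ : ∀ ℓ, 0 < (φ ℓ).re) (hv : 0 < v.re) :
    ∫ t in G.cube, ∏ ℓ, ((t ℓ : ℂ) ^ (φ ℓ - 1) * ((1 - t ℓ ^ 2 : ℝ) : ℂ) ^ (v - 1)) =
      ∏ ℓ, Gamma (φ ℓ / 2) * Gamma v / (2 * Gamma (φ ℓ / 2 + v)) := by
  rw [volume_restrict_cube, integral_fintype_prod_eq_prod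
    (fun ℓ (t : ℝ) => (t : ℂ) ^ (φ ℓ - 1) * ((1 - t ^ 2 : ℝ) : ℂ) ^ (v - 1))]
  exact Finset.prod_congr rfl fun ℓ _ => (integrableOn_and_integral_cpow_mul_one_sub_sq (hφ ℓ) hv).2

/-! ### Convergence and analyticity of the amplitude -/

theorem exists_mul_prod_le_HU {s : ℝ} (hs : 0 < s) : ∃ a : ℝ, 0 < a ∧ a ≤ 1 ∧
    ∀ t ∈ G.cube, a * ∏ ℓ, t ℓ ≤ G.HU s t := by
  obtain ⟨K, hK⟩ := G.exists_KU_expo_le_one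
  -- Capping at `1` lets `a ^ (-Re D / 2)` be bounded later by `a⁻¹` throughout the strip.
  refine ⟨min (G.aCoef s K) 1, lt_min (G.aCoef_pos hs K) one_pos, min_le_right _ _,
    fun t ht => ?_⟩
  rw [G.HU_eq_sum hs ht]
  have h1 : G.aCoef s K * G.mon K t ≤ ∑ K : G.KU, G.aCoef s K * G.mon K t :=
    Finset.single_le_sum (f := fun K : G.KU => G.aCoef s K * G.mon K t)
      (fun K _ => (mul_pos (G.aCoef_pos hs K) (G.mon_pos ht K)).le) (Finset.mem_univ K)
  refine le_trans ?_ h1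
  refine mul_le_mul (min_le_left _ _) ?_ (Finset.prod_nonneg fun ℓ _ => (G.cube_pos ht ℓ).le)
    (G.aCoef_pos hs K).le
  refine Finset.prod_le_prod (fun ℓ _ => (G.cube_pos ht ℓ).le) fun ℓ _ => ?_
  have h0 := G.cube_pos ht ℓ
  calc t ℓ = t ℓ ^ 1 := (pow_one _).symm
    _ ≤ t ℓ ^ G.expo K ℓ := pow_le_pow_of_le_one h0.le (G.cube_lt_one ht ℓ).le (hK ℓ)

theorem one_sub_sq_pos {t : Fin G.L → ℝ} (ht : t ∈ G.cube) (ℓ : Fin G.L) : 0 < 1 - t ℓ ^ 2 := by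
  nlinarith [G.cube_pos ht ℓ, G.cube_lt_one ht ℓ]

theorem norm_paramIntegrand {s : ℝ} (hs : 0 < s) (D : ℂ) (h : (Fin G.L → ℝ) → ℂ)
    {t : Fin G.L → ℝ} (ht : t ∈ G.cube) : ‖G.paramIntegrand s D h t‖ =
      (∏ ℓ, (1 - t ℓ ^ 2) ^ (D.re / 2 - 1)) * Real.exp (-(h t).re) * G.HU s t ^ (-(D.re / 2)) := by
  have h1 : ∀ ℓ, ‖((1 - t ℓ ^ 2 : ℝ) : ℂ) ^ (D / 2 - 1)‖ = (1 - t ℓ ^ 2) ^ (D.re / 2 - 1) :=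
    fun ℓ => by
      rw [norm_cpow_eq_rpow_re_of_pos (G.one_sub_sq_pos ht ℓ)]
      simp
  rw [paramIntegrand, norm_div, norm_mul, norm_prod, Finset.prod_congr rfl fun ℓ _ => h1 ℓ,
    Complex.norm_exp, neg_re, norm_cpow_eq_rpow_re_of_pos (G.HU_pos hs ht),
    Real.rpow_neg (G.HU_pos hs ht).le, div_eq_mul_inv, show (D / 2).re = D.re / 2 by simp]

/-- The exponents are frozen at `c₁` in the factors singular at `t = 1` and at `c₂` in those
singular at `t = 0`. The majorant therefore serves a whole substrip of `D` and every exponent with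
nonnegative real part, and it is integrable because `c₁ > 0` and `c₂ < 1`. -/
theorem exists_norm_paramIntegrand_le {s : ℝ} (hs : 0 < s) : ∃ C : ℝ, 0 ≤ C ∧
    ∀ (c₁ c₂ : ℝ), 0 < c₁ → c₂ < 1 → ∀ D : ℂ, c₁ ≤ D.re / 2 → D.re / 2 ≤ c₂ →
      ∀ (h : (Fin G.L → ℝ) → ℂ), ∀ t ∈ G.cube, 0 ≤ (h t).re → ‖G.paramIntegrand s D h t‖ ≤
        C * ∏ ℓ, (t ℓ ^ ((1 - c₂) - 1) * (1 - t ℓ ^ 2) ^ (c₁ - 1)) := by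
  obtain ⟨a, ha, ha1, hle⟩ := G.exists_mul_prod_le_HU hs
  refine ⟨a⁻¹, by positivity, fun c₁ c₂ hc₁ hc₂ D h1 h2 h t ht hre => ?_⟩
  rw [norm_paramIntegrand G hs D h ht, Finset.prod_mul_distrib]
  have hpr : 0 < ∏ ℓ, t ℓ := Finset.prod_pos fun ℓ _ => G.cube_pos ht ℓ
  have e1 : ∏ ℓ, (1 - t ℓ ^ 2) ^ (D.re / 2 - 1) ≤ ∏ ℓ, (1 - t ℓ ^ 2) ^ (c₁ - 1) := by
    refine Finset.prod_le_prod (fun ℓ _ => Real.rpow_nonneg (G.one_sub_sq_pos ht ℓ).le _)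
      fun ℓ _ => ?_
    refine Real.rpow_le_rpow_of_exponent_ge (G.one_sub_sq_pos ht ℓ) ?_ (by linarith)
    nlinarith [sq_nonneg (t ℓ)]
  have e2 : Real.exp (-(h t).re) ≤ 1 := Real.exp_le_one_iff.2 (by linarith)
  have e3 : G.HU s t ^ (-(D.re / 2)) ≤ a⁻¹ * ∏ ℓ, t ℓ ^ ((1 - c₂) - 1) := by
    have f1 : G.HU s t ^ (-(D.re / 2)) ≤ (a * ∏ ℓ, t ℓ) ^ (-(D.re / 2)) :=
      Real.rpow_le_rpow_of_nonpos (by positivity) (hle t ht) (by linarith)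
    refine f1.trans ?_
    rw [Real.mul_rpow ha.le hpr.le, ← Real.finsetProd_rpow _ _ fun ℓ _ => (G.cube_pos ht ℓ).le]
    refine mul_le_mul ?_ ?_ (Finset.prod_nonneg fun ℓ _ =>
      Real.rpow_nonneg (G.cube_pos ht ℓ).le _) (by positivity)
    · rw [← Real.rpow_neg_one a]
      exact Real.rpow_le_rpow_of_exponent_ge ha ha1 (by linarith)
    · refine Finset.prod_le_prod (fun ℓ _ => Real.rpow_nonneg (G.cube_pos ht ℓ).le _) fun ℓ _ => ?_
      exact Real.rpow_le_rpow_of_exponent_ge (G.cube_pos ht ℓ) (G.cube_lt_one ht ℓ).le (by linarith)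
  have p1 : 0 ≤ ∏ ℓ, (1 - t ℓ ^ 2) ^ (c₁ - 1) :=
    Finset.prod_nonneg fun ℓ _ => Real.rpow_nonneg (G.one_sub_sq_pos ht ℓ).le _
  have p2 : 0 ≤ G.HU s t ^ (-(D.re / 2)) := Real.rpow_nonneg (G.HU_pos hs ht).le _
  calc _ ≤ (∏ ℓ, (1 - t ℓ ^ 2) ^ (c₁ - 1)) * 1 * (a⁻¹ * ∏ ℓ, t ℓ ^ ((1 - c₂) - 1)) := by
        gcongr
    _ = _ := by ring

theorem measurable_HU (s : ℝ) : Measurable (G.HU s) := by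
  unfold HU
  refine Measurable.mul (Finset.measurable_prod _ fun ℓ _ => measurable_pi_apply ℓ) ?_
  simp only [Matrix.det_apply']
  refine Finset.measurable_sum _ fun p _ => measurable_const.mul
    (Finset.measurable_prod _ fun i _ => ?_)
  simp only [Matrix.add_apply, AMat, Matrix.diagonal_apply]
  refine Measurable.add_const ?_ _
  split_ifs
  · rcases p i with ℓ | ℓ | v
    · exact (measurable_pi_apply ℓ).inv
    · exact measurable_pi_apply ℓ
    · exact measurable_const
  · exact measurable_const

theorem measurable_mon (K : G.Pair) : Measurable (G.mon K) := by
  unfold mon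
  fun_prop

theorem measurable_HVoverHU (s : ℝ) :
    Measurable fun p : G.Inv s × (Fin G.L → ℝ) => G.HVoverHU s p.1 p.2 := by
  unfold HVoverHU HVre HVim
  have hm : ∀ K : G.Pair, Measurable fun p : G.Inv s × (Fin G.L → ℝ) => G.mon K p.2 :=
    fun K => (G.measurable_mon K).comp measurable_snd
  have hU : Measurable fun p : G.Inv s × (Fin G.L → ℝ) => (G.HU s p.2 : ℂ) :=
    Complex.measurable_ofReal.comp ((G.measurable_HU s).comp measurable_snd)
  refine Measurable.div (Measurable.add ?_ (measurable_const.mul ?_)) hU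
  · refine Complex.measurable_ofReal.comp (Finset.measurable_sum _ fun K _ => ?_)
    exact ((measurable_pi_apply _).comp measurable_fst).mul (hm _)
  · refine Complex.measurable_ofReal.comp (Finset.measurable_sum _ fun K _ => ?_)
    exact ((measurable_pi_apply _).comp measurable_fst).mul (hm _)

theorem measurable_paramIntegrand {α : Type*} [MeasurableSpace α] (s : ℝ) (D : ℂ)
    {t : α → Fin G.L → ℝ} (ht : Measurable t) {h : α → ℂ} (hh : Measurable h) :
    Measurable fun a => G.paramIntegrand s D (fun _ => h a) (t a) := by
  unfold paramIntegrand
  have hU := (G.measurable_HU s).comp ht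
  refine Measurable.div (Measurable.mul (Finset.measurable_prod _ fun ℓ _ => ?_) (by fun_prop))
    (Measurable.pow (Complex.measurable_ofReal.comp hU) measurable_const)
  refine Measurable.pow (Complex.measurable_ofReal.comp ?_) measurable_const
  exact measurable_const.sub (((measurable_pi_apply ℓ).comp ht).pow_const 2)

theorem HVoverHU_re_nonneg {s : ℝ} (hs : 0 < s) {r : G.Inv s} (hr : ∀ K : G.KR s, 0 ≤ r (.inl K))
    {t : Fin G.L → ℝ} (ht : t ∈ G.cube) : 0 ≤ (G.HVoverHU s r t).re := by
  rw [HVoverHU, Complex.div_ofReal_re]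
  refine div_nonneg ?_ (G.HU_pos hs ht).le
  simp only [add_re, ofReal_re, mul_re, I_re, zero_mul, ofReal_im, mul_zero, sub_zero, add_zero]
  exact Finset.sum_nonneg fun K _ => mul_nonneg (hr K) (G.mon_pos ht K).le

theorem differentiableOn_paramIntegrand {s : ℝ} (hs : 0 < s) (h : (Fin G.L → ℝ) → ℂ)
    {t : Fin G.L → ℝ} (ht : t ∈ G.cube) (U : Set ℂ) :
    DifferentiableOn ℂ (fun D => G.paramIntegrand s D h t) U := by
  unfold paramIntegrand
  have hU : (G.HU s t : ℂ) ≠ 0 := by exact_mod_cast (G.HU_pos hs ht).ne'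
  have h1 : ∀ ℓ, ((1 - t ℓ ^ 2 : ℝ) : ℂ) ≠ 0 := fun ℓ => by
    exact_mod_cast (G.one_sub_sq_pos ht ℓ).ne'
  refine Differentiable.differentiableOn ?_
  refine Differentiable.div (Differentiable.mul_const (Differentiable.fun_finsetProd fun ℓ _ => ?_) _)
    ?_ (fun D => by rw [Ne, Complex.cpow_eq_zero_iff]; exact fun h => hU h.1)
  · exact Differentiable.const_cpow (by fun_prop) (Or.inl (h1 ℓ))
  · exact Differentiable.const_cpow (by fun_prop) (Or.inl hU)

/-- Local domination of the parametric integrand, uniformly in the invariants. -/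
theorem exists_ball_bound {s : ℝ} (hs : 0 < s) {D₀ : ℂ} (hD₀ : D₀ ∈ dimStrip) :
    ∃ ρ > 0, Metric.ball D₀ ρ ⊆ dimStrip ∧ ∃ bound : (Fin G.L → ℝ) → ℝ,
      IntegrableOn bound G.cube ∧ ∀ D ∈ Metric.ball D₀ ρ, ∀ (h : (Fin G.L → ℝ) → ℂ),
        ∀ t ∈ G.cube, 0 ≤ (h t).re → ‖G.paramIntegrand s D h t‖ ≤ bound t := by
  obtain ⟨C, hC, h⟩ := G.exists_norm_paramIntegrand_le hs
  obtain ⟨h0, h2⟩ := hD₀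
  -- Half the distance from `D₀` to the boundary of the strip.
  set ρ := min D₀.re (2 - D₀.re) / 2 with hρ
  have hρ1 : ρ ≤ D₀.re / 2 := by rw [hρ]; have := min_le_left D₀.re (2 - D₀.re); linarith
  have hρ2 : ρ ≤ (2 - D₀.re) / 2 := by
    rw [hρ]; have := min_le_right D₀.re (2 - D₀.re); linarith
  have hρ0 : 0 < ρ := by
    have : 0 < min D₀.re (2 - D₀.re) := lt_min h0 (by linarith)
    linarith
  have hre : ∀ D ∈ Metric.ball D₀ ρ, D₀.re - ρ ≤ D.re ∧ D.re ≤ D₀.re + ρ := by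
    intro D hD
    rw [Metric.mem_ball, dist_eq_norm] at hD
    have := abs_le.1 ((Complex.abs_re_le_norm (D - D₀)).trans hD.le)
    rw [sub_re] at this
    constructor <;> linarith [this.1, this.2]
  refine ⟨ρ, hρ0, fun D hD => ?_, _, ((G.integrableOn_cube_prod
    (α := fun _ => 1 - (D₀.re + ρ) / 2) (β := fun _ => (D₀.re - ρ) / 2) (fun _ => by linarith)
    (fun _ => by linarith)).const_mul C), fun D hD hh t ht hpos => ?_⟩
  · have := hre D hD
    exact ⟨by linarith [this.1], by linarith [this.2]⟩
  · have := hre D hD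
    exact h _ _ (by linarith) (by linarith) D (by linarith [this.1]) (by linarith [this.2]) hh t ht
      hpos

theorem integrableOn_paramIntegrand {s : ℝ} (hs : 0 < s) {D : ℂ} (hD : D ∈ dimStrip) {r : G.Inv s}
    (hr : ∀ K : G.KR s, 0 ≤ r (.inl K)) :
    IntegrableOn (G.paramIntegrand s D (G.HVoverHU s r)) G.cube := by
  obtain ⟨ρ, hρ, -, bound, hb, h⟩ := G.exists_ball_bound hs hD
  refine hb.mono' ?_ ?_
  · exact (G.measurable_paramIntegrand s D measurable_id ((G.measurable_HVoverHU s).comp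
      (measurable_const.prodMk measurable_id : Measurable fun t => (r, t)))).aestronglyMeasurable
  · filter_upwards [ae_restrict_mem G.measurableSet_cube] with t ht
    exact h D (Metric.mem_ball_self hρ) _ t ht (G.HVoverHU_re_nonneg hs hr ht)

theorem differentiableOn_invAmplitude {s : ℝ} (hs : 0 < s) (K' : ℂ) {r : G.Inv s}
    (hr : ∀ K : G.KR s, 0 ≤ r (.inl K)) :
    DifferentiableOn ℂ (fun D => G.invAmplitude s K' D r) dimStrip := by
  unfold invAmplitude
  refine DifferentiableOn.const_mul (differentiableOn_integral_of_dominated (fun D hD =>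
    (G.integrableOn_paramIntegrand hs hD hr).aestronglyMeasurable) ?_ fun D₀ hD₀ => ?_) _
  · filter_upwards [ae_restrict_mem G.measurableSet_cube] with t ht
    exact G.differentiableOn_paramIntegrand hs _ ht _
  · obtain ⟨ρ, hρ, hsub, bound, hb, h⟩ := G.exists_ball_bound hs hD₀
    refine ⟨ρ, hρ, hsub, bound, hb, ?_⟩
    filter_upwards [ae_restrict_mem G.measurableSet_cube] with t ht D hD
    exact h D hD _ t ht (G.HVoverHU_re_nonneg hs hr ht)

theorem paramIntegrand_extForm {s : ℝ} (hs : 0 < s) (Ω : ℝ) (D : ℂ) {m : ℕ} (X : G.ExtConf m)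
    {t : Fin G.L → ℝ} (ht : t ∈ G.cube) :
    G.paramIntegrand s D (fun t => ((Ω / 2 : ℝ) : ℂ) * G.extForm s t X) t =
      exp (-(((Ω / 2 : ℝ) : ℂ) * G.pureExtForm s X)) *
        G.paramIntegrand s D (G.HVoverHU s (G.invariants s Ω X)) t := by
  rw [paramIntegrand, paramIntegrand, half_mul_extForm G hs Ω ht, neg_add, Complex.exp_add]
  ring

theorem amplitude_eq {s : ℝ} (hs : 0 < s) (Ω : ℝ) (K' D : ℂ) {m : ℕ} (X : G.ExtConf m) :
    G.amplitude s Ω K' D X = exp (-(((Ω / 2 : ℝ) : ℂ) * G.pureExtForm s X)) *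
      G.invAmplitude s K' D (G.invariants s Ω X) := by
  rw [amplitude, invAmplitude, setIntegral_congr_fun G.measurableSet_cube
    fun t ht => G.paramIntegrand_extForm hs Ω D X ht, integral_const_mul]
  ring

/-! ### The amplitude as a tempered distribution -/

theorem measurableSet_invCone (s : ℝ) : MeasurableSet (G.invCone s) := by
  have : G.invCone s = ⋂ K : G.KR s, {r : G.Inv s | 0 < r (.inl K)} := by
    ext r; simp [invCone]
  rw [this]
  exact MeasurableSet.iInter fun K => measurableSet_lt measurable_const (measurable_pi_apply _)

theorem stronglyMeasurable_invAmplitude (s : ℝ) (K' D : ℂ) :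
    StronglyMeasurable fun r => G.invAmplitude s K' D r := by
  unfold invAmplitude
  refine StronglyMeasurable.const_mul ?_ _
  refine StronglyMeasurable.integral_prod_right (f := fun r t =>
    G.paramIntegrand s D (G.HVoverHU s r) t) ?_
  exact (G.measurable_paramIntegrand s D measurable_snd
    (G.measurable_HVoverHU s)).stronglyMeasurable

/-- The majorant does not see the invariants, so the amplitude is bounded on the cone. This is why
it defines a tempered distribution and why smearing preserves analyticity. -/
theorem exists_ball_invAmplitude_bound {s : ℝ} (hs : 0 < s) (K' : ℂ) {D₀ : ℂ}
    (hD₀ : D₀ ∈ dimStrip) : ∃ ρ > 0, Metric.ball D₀ ρ ⊆ dimStrip ∧ ∃ C : ℝ,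
      ∀ D ∈ Metric.ball D₀ ρ, ∀ r ∈ G.invCone s, ‖G.invAmplitude s K' D r‖ ≤ C := by
  obtain ⟨ρ, hρ, hsub, bound, hb, h⟩ := G.exists_ball_bound hs hD₀
  refine ⟨ρ, hρ, hsub, ‖K'‖ * ∫ t in G.cube, bound t, fun D hD r hr => ?_⟩
  rw [invAmplitude, norm_mul]
  refine mul_le_mul_of_nonneg_left (norm_integral_le_of_norm_le hb ?_) (norm_nonneg _)
  filter_upwards [ae_restrict_mem G.measurableSet_cube] with t ht
  exact h D hD _ t ht (G.HVoverHU_re_nonneg hs (fun K => (hr K).le) ht)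

theorem memLp_indicator_invAmplitude {s : ℝ} (hs : 0 < s) (K' : ℂ) {D : ℂ} (hD : D ∈ dimStrip) :
    MemLp ((G.invCone s).indicator fun r => G.invAmplitude s K' D r) ⊤ volume := by
  obtain ⟨ρ, hρ, -, C, h⟩ := G.exists_ball_invAmplitude_bound hs K' hD
  refine memLp_top_of_bound ((G.stronglyMeasurable_invAmplitude s K' D).indicator
    (G.measurableSet_invCone s)).aestronglyMeasurable |C| (Filter.Eventually.of_forall fun r => ?_)
  by_cases hr : r ∈ G.invCone s
  · rw [Set.indicator_of_mem hr]
    exact (h D (Metric.mem_ball_self hρ) r hr).trans (le_abs_self C)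
  · rw [Set.indicator_of_notMem hr, norm_zero]
    exact abs_nonneg C

open Classical in
/-- The amplitude on the cone of invariants as a tempered distribution. -/
def ampDistribution {s : ℝ} (hs : 0 < s) (K' D : ℂ) : 𝓢'(G.Inv s, ℂ) :=
  if hD : D ∈ dimStrip then
    Lp.toTemperedDistribution (G.memLp_indicator_invAmplitude hs K' hD).toLp
  else 0

theorem integrableOn_mul_invAmplitude {s : ℝ} (hs : 0 < s) (K' : ℂ) {D : ℂ} (hD : D ∈ dimStrip)
    (f : 𝓢(G.Inv s, ℂ)) :
    IntegrableOn (fun r => f r * G.invAmplitude s K' D r) (G.invCone s) := by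
  obtain ⟨ρ, hρ, -, C, h⟩ := G.exists_ball_invAmplitude_bound hs K' hD
  refine Integrable.mono' ((f.integrable (μ := volume)).norm.const_mul C).integrableOn
    (f.continuous.aestronglyMeasurable.mul
      (G.stronglyMeasurable_invAmplitude s K' D).aestronglyMeasurable) ?_
  filter_upwards [ae_restrict_mem (G.measurableSet_invCone s)] with r hr
  rw [norm_mul, mul_comm]
  exact mul_le_mul_of_nonneg_right (h D (Metric.mem_ball_self hρ) r hr) (norm_nonneg _)

theorem ampDistribution_apply {s : ℝ} (hs : 0 < s) (K' : ℂ) {D : ℂ} (hD : D ∈ dimStrip)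
    (f : 𝓢(G.Inv s, ℂ)) : G.ampDistribution hs K' D f =
      ∫ r in G.invCone s, f r * G.invAmplitude s K' D r := by
  rw [ampDistribution, dif_pos hD, Lp.toTemperedDistribution_apply,
    ← integral_indicator (G.measurableSet_invCone s)]
  refine integral_congr_ae ?_
  filter_upwards [(G.memLp_indicator_invAmplitude hs K' hD).coeFn_toLp] with r hr
  rw [hr, smul_eq_mul]
  by_cases h : r ∈ G.invCone s
  · rw [Set.indicator_of_mem h, Set.indicator_of_mem h]
  · rw [Set.indicator_of_notMem h, Set.indicator_of_notMem h, mul_zero]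

theorem analyticOnNhd_ampDistribution {s : ℝ} (hs : 0 < s) (K' : ℂ) (f : 𝓢(G.Inv s, ℂ)) :
    AnalyticOnNhd ℂ (fun D => G.ampDistribution hs K' D f) dimStrip := by
  refine DifferentiableOn.analyticOnNhd ?_ dimStrip_isOpen
  refine DifferentiableOn.congr (f := fun D => ∫ r in G.invCone s, f r * G.invAmplitude s K' D r) ?_
    fun D hD => G.ampDistribution_apply hs K' hD f
  refine differentiableOn_integral_of_dominated (fun D hD =>
    (G.integrableOn_mul_invAmplitude hs K' hD f).aestronglyMeasurable) ?_ fun D₀ hD₀ => ?_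
  · filter_upwards [ae_restrict_mem (G.measurableSet_invCone s)] with r hr
    exact (G.differentiableOn_invAmplitude hs K' fun K => (hr K).le).const_mul _
  · obtain ⟨ρ, hρ, hsub, C, h⟩ := G.exists_ball_invAmplitude_bound hs K' hD₀
    refine ⟨ρ, hρ, hsub, _, ((f.integrable (μ := volume)).norm.const_mul C).integrableOn, ?_⟩
    filter_upwards [ae_restrict_mem (G.measurableSet_invCone s)] with r hr D hD
    rw [norm_mul, mul_comm]
    exact mul_le_mul_of_nonneg_right (h D hD r hr) (norm_nonneg _)

end StarGraph

namespace StarGraph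

variable (G : StarGraph)

/-! ### The Mellin variables -/

/-- The monomial attached to a Mellin variable. -/
def idxPair {s : ℝ} : G.MellinIdx s → G.Pair :=
  Sum.elim (fun K => K.1) (Sum.elim (fun K => K.1) fun K => K.1)

theorem phi_eq_sum {s : ℝ} {R : Type*} [CommRing R] (z : G.MellinIdx s → R) (ℓ : Fin G.L) :
    G.phi z ℓ = ∑ j, (G.expo (G.idxPair j) ℓ : R) * z j + 1 := by
  rw [phi, Fintype.sum_sum_type, Fintype.sum_sum_type]
  rfl

theorem phi_re {s : ℝ} {z : G.MellinIdx s → ℂ} {σ : G.MellinIdx s → ℝ} (hz : ∀ j, (z j).re = σ j)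
    (ℓ : Fin G.L) : (G.phi z ℓ).re = G.phi σ ℓ := by
  rw [phi_eq_sum, phi_eq_sum, add_re, re_sum, one_re]
  congr 1
  refine Finset.sum_congr rfl fun j _ => ?_
  rw [← hz j, mul_re, natCast_re, natCast_im, zero_mul, sub_zero]

theorem Delta_neg {s : ℝ} {D : ℂ} {σ : G.MellinIdx s → ℝ} (h : σ ∈ G.Delta s D)
    (j : G.MellinIdx s) : σ j < 0 := by
  rcases j with K | K | K
  · exact h.1 K
  · exact h.2.1 K
  · exact (h.2.2.1 K).2

theorem Delta_sum {s : ℝ} {D : ℂ} {σ : G.MellinIdx s → ℝ} (h : σ ∈ G.Delta s D) :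
    ∑ j, σ j = -D.re / 2 := h.2.2.2.1

/-- All coordinates are negative with sum `-Re D / 2 > -1`. In particular the powers of the real
invariants, on which `Delta` imposes no lower bound, are locally integrable. -/
theorem Delta_gt_neg_one {s : ℝ} {D : ℂ} (hD : D ∈ dimStrip) {σ : G.MellinIdx s → ℝ}
    (h : σ ∈ G.Delta s D) (j : G.MellinIdx s) : -1 < σ j := by
  have h1 : -σ j ≤ ∑ j, -σ j := Finset.single_le_sum (f := fun j => -σ j)
    (fun j _ => by linarith [G.Delta_neg h j]) (Finset.mem_univ j)
  rw [Finset.sum_neg_distrib, G.Delta_sum h] at h1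
  linarith [hD.2]

theorem Delta_nonempty (s : ℝ) {D : ℂ} (hD : D ∈ dimStrip) : (G.Delta s D).Nonempty := by
  classical
  obtain ⟨K, hK⟩ := G.exists_KU_expo_le_one
  obtain ⟨h0, h2⟩ := hD
  set c := D.re / 2 with hc
  set N : ℝ := (Fintype.card (G.MellinIdx s) : ℝ) with hN
  have hN1 : 1 ≤ N := by
    have : Nonempty (G.MellinIdx s) := ⟨.inl K⟩
    rw [hN]
    exact_mod_cast Fintype.card_pos (α := G.MellinIdx s)
  -- Every variable receives `-ε`, and the rest of the weight goes to the monomial with exponents at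
  -- most `1`. Exponents are at most `2` elsewhere, so each `φ_ℓ` is at least `1 - c - Nε > 0`.
  set ε := min c (1 - c) / (4 * N) with hε
  have hmin : 0 < min c (1 - c) := lt_min (by linarith) (by linarith)
  have hε0 : 0 < ε := by positivity
  have hNε : N * ε = min c (1 - c) / 4 := by rw [hε]; field_simp
  have hm1 := min_le_left c (1 - c)
  have hm2 := min_le_right c (1 - c)
  have hε1 : ε ≤ N * ε := le_mul_of_one_le_left hε0.le hN1
  have hite : ∑ j : G.MellinIdx s, (if j = .inl K then -c + N * ε else 0) = -c + N * ε :=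
    (Fintype.sum_eq_single (Sum.inl K) fun j hj => if_neg hj).trans (if_pos rfl)
  have hsum : ∑ j : G.MellinIdx s, (-ε + if j = .inl K then -c + N * ε else 0) = -c := by
    rw [Finset.sum_add_distrib, Finset.sum_const, Finset.card_univ, nsmul_eq_mul,
      hite, ← hN]
    ring
  refine ⟨fun j => -ε + if j = .inl K then -c + N * ε else 0, fun K' => ?_, fun K' => ?_,
    fun K' => ?_, by rw [hsum, hc]; ring, fun ℓ => ?_⟩
  · show -ε + (if _ then _ else _) < 0
    split_ifs <;> linarith
  · show -ε + (if _ then _ else _) < 0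
    rw [if_neg (by simp)]
    linarith
  · show -1 < -ε + (if _ then _ else _) ∧ -ε + (if _ then _ else _) < 0
    rw [if_neg (by simp)]
    constructor <;> linarith
  · rw [phi_eq_sum]
    have h1 : ∀ j : G.MellinIdx s, -(2 * ε) + (if j = .inl K then -c + N * ε else 0) ≤
        (G.expo (G.idxPair j) ℓ : ℝ) * (-ε + if j = .inl K then -c + N * ε else 0) := by
      intro j
      have hle : (G.expo (G.idxPair j) ℓ : ℝ) ≤ 2 := by
        have : G.expo (G.idxPair j) ℓ ≤ 2 := by unfold expo; split_ifs <;> norm_num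
        exact_mod_cast this
      split_ifs with hj
      · have h3 : (G.expo (G.idxPair j) ℓ : ℝ) ≤ 1 := by
          have := hK ℓ
          rw [hj]
          exact_mod_cast this
        nlinarith
      · nlinarith
    have h2 := Finset.sum_le_sum fun j (_ : j ∈ Finset.univ) => h1 j
    rw [Finset.sum_add_distrib, Finset.sum_const, Finset.card_univ, nsmul_eq_mul,
      hite, ← hN] at h2
    linarith

section Contour

variable {s : ℝ} (D : ℂ) (σ : G.MellinIdx s → ℝ) (K₀ : G.KU) (η : G.FreeIdx s K₀ → ℝ)

theorem contourPoint_of_ne {j : G.MellinIdx s} (h : j ≠ .inl K₀) :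
    G.contourPoint D σ K₀ η j = (σ j : ℂ) + I * η ⟨j, h⟩ := by
  rw [contourPoint, dif_neg h]

theorem contourPoint_self : G.contourPoint D σ K₀ η (.inl K₀) =
    -D / 2 - ∑ j' : G.FreeIdx s K₀, ((σ j'.1 : ℂ) + I * η j') := by
  rw [contourPoint, dif_pos rfl]

theorem prod_eq_mul_prod_freeIdx {M : Type*} [CommMonoid M] (f : G.MellinIdx s → M) :
    ∏ j, f j = f (.inl K₀) * ∏ j : G.FreeIdx s K₀, f j.1 := by
  classical
  convert Fintype.prod_eq_mul_prod_subtype_ne f (.inl K₀)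

theorem sum_eq_add_sum_freeIdx {M : Type*} [AddCommMonoid M] (f : G.MellinIdx s → M) :
    ∑ j, f j = f (.inl K₀) + ∑ j : G.FreeIdx s K₀, f j.1 := by
  classical
  convert Fintype.sum_eq_add_sum_subtype_ne f (.inl K₀)

theorem sum_contourPoint : ∑ j, G.contourPoint D σ K₀ η j = -D / 2 := by
  have h : ∀ j : G.FreeIdx s K₀, G.contourPoint D σ K₀ η j.1 = (σ j.1 : ℂ) + I * η j :=
    fun j => G.contourPoint_of_ne D σ K₀ η j.2
  rw [G.sum_eq_add_sum_freeIdx K₀, contourPoint_self, Finset.sum_congr rfl fun j _ => h j]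
  ring

variable {D σ} in
theorem contourPoint_re (hσ : ∑ j, σ j = -D.re / 2) (j : G.MellinIdx s) :
    (G.contourPoint D σ K₀ η j).re = σ j := by
  by_cases h : j = .inl K₀
  · subst h
    rw [G.sum_eq_add_sum_freeIdx K₀] at hσ
    rw [contourPoint_self]
    simp only [sub_re, re_sum, add_re, ofReal_re, mul_re, I_re, zero_mul, I_im, ofReal_im, mul_zero,
      sub_zero, add_zero]
    have : (-D / 2).re = -D.re / 2 := by simp
    rw [this]
    linarith
  · rw [contourPoint_of_ne _ _ _ _ _ h]
    simp

theorem contourPoint_im_of_ne (j : G.FreeIdx s K₀) :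
    (G.contourPoint D σ K₀ η j.1).im = η j := by
  rw [contourPoint_of_ne _ _ _ _ _ j.2]
  simp

theorem measurable_contourPoint (j : G.MellinIdx s) :
    Measurable fun η : G.FreeIdx s K₀ → ℝ => G.contourPoint D σ K₀ η j := by
  by_cases h : j = .inl K₀
  · subst h
    simp only [contourPoint_self]
    fun_prop
  · simp only [contourPoint_of_ne _ _ _ _ _ h]
    fun_prop

end Contour

/-! ### Bounds for the kernel -/

/-- The Barnes kernel of the splitting of `HU`. -/
def barnesFactor (s : ℝ) (z : G.MellinIdx s → ℂ) : ℂ :=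
  (∏ K : G.KU, (G.aCoef s K : ℂ) ^ z (.inl K) * Gamma (-z (.inl K))) /
    Gamma (-∑ K : G.KU, z (.inl K))

/-- The product of the beta integrals over the parameters. -/
def phiFactor (s : ℝ) (D : ℂ) (z : G.MellinIdx s → ℂ) : ℂ :=
  ∏ ℓ, Gamma (G.phi z ℓ / 2) * Gamma (D / 2) / (2 * Gamma ((G.phi z ℓ + D) / 2))

theorem mellinKernel_eq (s : ℝ) (D : ℂ) (z : G.MellinIdx s → ℂ) : G.mellinKernel s D z =
    G.barnesFactor s z * (∏ j, Gamma (-z (.inr j))) * G.phiFactor s D z := by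
  rw [mellinKernel, Fintype.prod_sum_type, barnesFactor, phiFactor]
  ring

theorem measurable_barnesFactor (s : ℝ) : Measurable (G.barnesFactor s) := by
  unfold barnesFactor
  refine Measurable.div (Finset.measurable_prod _ fun K _ => ?_)
    (measurable_complexGamma.comp (by fun_prop))
  exact (Measurable.pow measurable_const (measurable_pi_apply _)).mul
    (measurable_complexGamma.comp (measurable_pi_apply _).neg)

theorem measurable_phiFactor (s : ℝ) (D : ℂ) : Measurable (G.phiFactor s D) := by
  unfold phiFactor
  refine Finset.measurable_prod _ fun ℓ _ => ?_
  have hφ : Measurable fun z : G.MellinIdx s → ℂ => G.phi z ℓ := by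
    unfold phi; fun_prop
  exact ((measurable_complexGamma.comp (hφ.div_const 2)).mul_const _).div
    ((measurable_complexGamma.comp ((hφ.add_const D).div_const 2)).const_mul 2)

theorem measurable_prod_Gamma (s : ℝ) :
    Measurable fun z : G.MellinIdx s → ℂ => ∏ j, Gamma (-z (.inr j)) :=
  Finset.measurable_prod _ fun _ _ => measurable_complexGamma.comp (measurable_pi_apply _).neg

/-- The denominator `Γ(-∑ x)` cancels the Gamma function of the total in the bound for products.
What remains is polynomial in `Im ∑ x`, and the constraint turns this into a polynomial in the
imaginary parts of the variables `y`, whose own factors must compensate it. -/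
theorem exists_norm_barnesFactor_le {s : ℝ} (hs : 0 < s) {D : ℂ}
    {σ : G.MellinIdx s → ℝ} (hσ : σ ∈ G.Delta s D) (K₀ : G.KU) :
    ∃ C : ℝ, 0 ≤ C ∧ ∃ M : ℕ, ∀ z : G.MellinIdx s → ℂ, (∀ j, (z j).re = σ j) →
      ∑ j, z j = -D / 2 →
        ‖G.barnesFactor s z‖ * ∏ K ∈ (Finset.univ : Finset G.KU).erase K₀,
          (1 + |(z (.inl K)).im|) ^ 2 ≤ C * ∏ j, (1 + |(z (.inr j)).im|) ^ M := by
  obtain ⟨C, hC, M, h⟩ := exists_norm_prod_Gamma_le (Finset.univ.erase K₀)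
    (α := fun K : G.KU => -σ (.inl K)) (fun K => by linarith [G.Delta_neg hσ (.inl K)])
    (β := -σ (.inl K₀)) (by linarith [G.Delta_neg hσ (.inl K₀)])
  refine ⟨(∏ K : G.KU, G.aCoef s K ^ σ (.inl K)) * C * (1 + |(D / 2).im|) ^ M, ?_, M,
    fun z hz hsum => ?_⟩
  · have : 0 ≤ ∏ K : G.KU, G.aCoef s K ^ σ (.inl K) :=
      Finset.prod_nonneg fun K _ => Real.rpow_nonneg (G.aCoef_pos hs K).le _
    positivity
  have hz' : ∑ K ∈ Finset.univ.erase K₀, -z (.inl K) + -z (.inl K₀) = -∑ K : G.KU, z (.inl K) := by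
    rw [Finset.sum_erase_add _ _ (Finset.mem_univ K₀), Finset.sum_neg_distrib]
  have hb := h (fun K => -z (.inl K)) (-z (.inl K₀)) (fun K => by rw [neg_re, hz])
    (by rw [neg_re, hz])
  rw [hz', Finset.prod_erase_mul _ _ (Finset.mem_univ K₀)] at hb
  have hS : -∑ K : G.KU, z (.inl K) = D / 2 + ∑ j, z (.inr j) := by
    rw [Fintype.sum_sum_type] at hsum
    linear_combination -hsum
  have hre : 0 < (-∑ K : G.KU, z (.inl K)).re := by
    rw [neg_re, re_sum, ← Finset.sum_neg_distrib]
    refine Finset.sum_pos (fun K _ => ?_) ⟨K₀, Finset.mem_univ _⟩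
    rw [hz]
    linarith [G.Delta_neg hσ (.inl K)]
  have hΓ : 0 < ‖Gamma (-∑ K : G.KU, z (.inl K))‖ := norm_pos_iff.2 (Gamma_ne_zero_of_re_pos hre)
  have him : 1 + |(-∑ K : G.KU, z (.inl K)).im| ≤
      (1 + |(D / 2).im|) * ∏ j, (1 + |(z (.inr j)).im|) := by
    rw [hS, add_im, im_sum]
    have e1 : ∀ t : Finset (G.KR s ⊕ G.KI s),
        1 + |∑ j ∈ t, (z (.inr j)).im| ≤ ∏ j ∈ t, (1 + |(z (.inr j)).im|) := by
      classical
      intro t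
      induction t using Finset.induction_on with
      | empty => simp
      | insert i t hi ih =>
        rw [Finset.sum_insert hi, Finset.prod_insert hi]
        have := abs_add_le (z (.inr i)).im (∑ j ∈ t, (z (.inr j)).im)
        nlinarith [abs_nonneg (z (.inr i)).im, abs_nonneg (∑ j ∈ t, (z (.inr j)).im)]
    have := e1 Finset.univ
    have h2 := abs_add_le (D / 2).im (∑ j, (z (.inr j)).im)
    nlinarith [abs_nonneg (D / 2).im, abs_nonneg (∑ j, (z (.inr j)).im)]
  have hnorm : ‖G.barnesFactor s z‖ = (∏ K : G.KU, G.aCoef s K ^ σ (.inl K)) *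
      ‖∏ K : G.KU, Gamma (-z (.inl K))‖ / ‖Gamma (-∑ K : G.KU, z (.inl K))‖ := by
    rw [barnesFactor, norm_div, Finset.prod_mul_distrib, norm_mul, norm_prod]
    congr 2
    refine Finset.prod_congr rfl fun K _ => ?_
    rw [norm_cpow_eq_rpow_re_of_pos (G.aCoef_pos hs K), hz]
  have ha : 0 ≤ ∏ K : G.KU, G.aCoef s K ^ σ (.inl K) :=
    Finset.prod_nonneg fun K _ => Real.rpow_nonneg (G.aCoef_pos hs K).le _
  rw [hnorm, div_mul_eq_mul_div, div_le_iff₀ hΓ]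
  calc _ = (∏ K : G.KU, G.aCoef s K ^ σ (.inl K)) * (‖∏ K : G.KU, Gamma (-z (.inl K))‖ *
        ∏ K ∈ (Finset.univ : Finset G.KU).erase K₀, (1 + |(-z (.inl K)).im|) ^ 2) := by
        simp only [neg_im, abs_neg]; ring
    _ ≤ (∏ K : G.KU, G.aCoef s K ^ σ (.inl K)) * (C * (‖Gamma (-∑ K : G.KU, z (.inl K))‖ *
        ((1 + |(D / 2).im|) * ∏ j, (1 + |(z (.inr j)).im|)) ^ M)) := by
        refine mul_le_mul_of_nonneg_left (hb.trans ?_) ha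
        gcongr
    _ = _ := by rw [mul_pow, Finset.prod_pow]; ring

/-- Each factor is a beta function with positive real parts, hence bounded on vertical lines. -/
theorem exists_norm_phiFactor_le {s : ℝ} {D : ℂ} (hD : D ∈ dimStrip)
    {σ : G.MellinIdx s → ℝ} (hσ : σ ∈ G.Delta s D) : ∃ C : ℝ, 0 ≤ C ∧
      ∀ z : G.MellinIdx s → ℂ, (∀ j, (z j).re = σ j) → ‖G.phiFactor s D z‖ ≤ C := by
  have hφ := hσ.2.2.2.2
  have h1 : ∀ ℓ, ∃ C : ℝ, 0 ≤ C ∧ ∀ a b : ℂ, a.re = G.phi σ ℓ / 2 → b.re = D.re / 2 →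
      ‖Gamma a * Gamma b‖ ≤ C * ‖Gamma (a + b)‖ := fun ℓ =>
    exists_norm_Gamma_mul_Gamma_le (by linarith [hφ ℓ]) (by linarith [hD.1])
  choose C hC h using h1
  refine ⟨∏ ℓ, C ℓ, Finset.prod_nonneg fun ℓ _ => hC ℓ, fun z hz => ?_⟩
  rw [phiFactor, norm_prod]
  refine Finset.prod_le_prod (fun ℓ _ => norm_nonneg _) fun ℓ _ => ?_
  have hre : (G.phi z ℓ / 2).re = G.phi σ ℓ / 2 := by
    rw [← G.phi_re hz ℓ]; simp
  have hre2 : (D / 2).re = D.re / 2 := by simp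
  have hb := h ℓ (G.phi z ℓ / 2) (D / 2) hre hre2
  rw [← add_div] at hb
  have hΓ : 0 < ‖Gamma ((G.phi z ℓ + D) / 2)‖ := norm_pos_iff.2 (Gamma_ne_zero_of_re_pos (by
    rw [add_div, add_re, hre, hre2]; linarith [hφ ℓ, hD.1]))
  rw [norm_div, norm_mul 2, Complex.norm_ofNat, div_le_iff₀ (by positivity)]
  nlinarith [hC ℓ]

/-! ### Monomials as complex powers -/

theorem mon_cpow {t : Fin G.L → ℝ} (ht : t ∈ G.cube) (K : G.Pair) (z : ℂ) :
    (G.mon K t : ℂ) ^ z = ∏ ℓ, (t ℓ : ℂ) ^ ((G.expo K ℓ : ℂ) * z) := by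
  have h : ∀ S : Finset (Fin G.L), ((∏ ℓ ∈ S, t ℓ ^ G.expo K ℓ : ℝ) : ℂ) ^ z =
      ∏ ℓ ∈ S, (t ℓ : ℂ) ^ ((G.expo K ℓ : ℂ) * z) := by
    intro S
    induction S using Finset.induction_on with
    | empty => simp
    | insert ℓ S hℓ ih =>
      rw [Finset.prod_insert hℓ, Finset.prod_insert hℓ, ofReal_mul, mul_cpow_ofReal_nonneg
        (pow_nonneg (G.cube_pos ht ℓ).le _)
        (Finset.prod_nonneg fun ℓ _ => pow_nonneg (G.cube_pos ht ℓ).le _), ih,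
        ofReal_pow, ← cpow_nat_mul']
      · rw [arg_ofReal_of_nonneg (G.cube_pos ht ℓ).le, mul_zero]
        linarith [Real.pi_pos]
      · rw [arg_ofReal_of_nonneg (G.cube_pos ht ℓ).le, mul_zero]
        exact Real.pi_pos.le
  exact h Finset.univ

/-- Collecting the powers of each `t_ℓ` makes the integrand a product over `ℓ`; the `1` in `φ_ℓ` is
the shift of the Mellin measure. -/
theorem prod_cpow_phi {s : ℝ} {t : Fin G.L → ℝ} (ht : t ∈ G.cube) (z : G.MellinIdx s → ℂ) :
    ∏ ℓ, (t ℓ : ℂ) ^ (G.phi z ℓ - 1) = ∏ j, (G.mon (G.idxPair j) t : ℂ) ^ z j := by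
  simp only [G.mon_cpow ht]
  rw [Finset.prod_comm]
  refine Finset.prod_congr rfl fun ℓ _ => ?_
  rw [phi_eq_sum, add_sub_cancel_right, cpow_finset_sum (by exact_mod_cast (G.cube_pos ht ℓ).ne')]

end StarGraph

/-! ### Smearing products of complex powers with Schwartz functions -/

/-- A majorant of the modulus of `w ^ a` for `Re a = α` and `|x| ≤ |w| ≤ 1 + |x|`. -/
def powWeight (α x : ℝ) : ℝ := |x| ^ α + (1 + |x|) ^ α

theorem powWeight_nonneg (α x : ℝ) : 0 ≤ powWeight α x := by
  unfold powWeight; positivity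

theorem measurable_powWeight (α : ℝ) : Measurable (powWeight α) := by
  unfold powWeight; fun_prop

theorem one_add_abs_rpow_mul_inv_pow_le {α : ℝ} {p : ℕ} (hp : α + 2 ≤ p) (x : ℝ) :
    (1 + |x|) ^ α * ((1 + |x|) ^ p)⁻¹ ≤ ((1 + |x|) ^ 2)⁻¹ := by
  have h0 : 0 < 1 + |x| := by positivity
  rw [← Real.rpow_natCast, ← Real.rpow_natCast, ← Real.rpow_neg h0.le, ← Real.rpow_neg h0.le,
    ← Real.rpow_add h0]
  refine Real.rpow_le_rpow_of_exponent_le (by linarith [abs_nonneg x]) ?_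
  push_cast
  linarith

/-- At the origin `α > -1` suffices. Away from it both powers are at most `(1 + |x|) ^ |α|`, which
the inverse power turns into an inverse square. -/
theorem integrable_powWeight {α : ℝ} (hα : -1 < α) {p : ℕ} (hp : |α| + 2 ≤ p) :
    Integrable fun x : ℝ => powWeight α x * ((1 + |x|) ^ p)⁻¹ := by
  have h1 : Integrable ((Set.Ioc (0 : ℝ) 1).indicator fun x => x ^ α) := by
    rw [integrable_indicator_iff measurableSet_Ioc]
    exact (intervalIntegrable_iff_integrableOn_Ioc_of_le zero_le_one).1
      (intervalIntegral.intervalIntegrable_rpow' hα)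
  have h2 := h1.comp_neg
  refine ((h1.add h2).add (integrable_one_add_abs_pow_neg_two.const_mul 2)).mono'
    (((measurable_powWeight α).mul (by fun_prop)).aestronglyMeasurable)
    (Filter.Eventually.of_forall fun x => ?_)
  rw [Real.norm_eq_abs, abs_of_nonneg (mul_nonneg (powWeight_nonneg _ _) (by positivity)),
    powWeight, add_mul]
  have h0 : 0 < 1 + |x| := by positivity
  have hle := one_add_abs_rpow_mul_inv_pow_le (α := α) (p := p) (by linarith [le_abs_self α]) x
  have hle' := one_add_abs_rpow_mul_inv_pow_le (α := |α|) (p := p) hp x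
  have hinv : ((1 + |x|) ^ p)⁻¹ ≤ 1 :=
    inv_le_one_of_one_le₀ (one_le_pow₀ (by linarith [abs_nonneg x]))
  have hinv0 : 0 ≤ ((1 + |x|) ^ p)⁻¹ := by positivity
  have n1 : ∀ y : ℝ, 0 ≤ (Set.Ioc (0 : ℝ) 1).indicator (fun x => x ^ α) y := fun y =>
    Set.indicator_nonneg (fun y hy => Real.rpow_nonneg hy.1.le _) y
  have key : |x| ^ α ≤ (1 + |x|) ^ |α| ∨ |x| ^ α ≤ (Set.Ioc (0 : ℝ) 1).indicator (fun x => x ^ α) x +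
      (Set.Ioc (0 : ℝ) 1).indicator (fun x => x ^ α) (-x) := by
    rcases eq_or_ne x 0 with rfl | hx
    · left
      rw [abs_zero, add_zero, Real.one_rpow]
      rcases eq_or_ne α 0 with rfl | h
      · rw [Real.rpow_zero]
      · rw [Real.zero_rpow h]; exact zero_le_one
    · rcases le_or_gt |x| 1 with h | h
      · right
        rcases lt_or_gt_of_ne hx with hn | hp'
        · rw [abs_of_neg hn] at h ⊢
          rw [Set.indicator_of_mem (show -x ∈ Set.Ioc (0 : ℝ) 1 from ⟨by linarith, h⟩)]
          linarith [n1 x]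
        · rw [abs_of_pos hp'] at h ⊢
          rw [Set.indicator_of_mem (show x ∈ Set.Ioc (0 : ℝ) 1 from ⟨hp', h⟩)]
          linarith [n1 (-x)]
      · left
        calc |x| ^ α ≤ |x| ^ |α| := Real.rpow_le_rpow_of_exponent_le h.le (le_abs_self α)
          _ ≤ _ := Real.rpow_le_rpow (abs_nonneg x) (by linarith) (abs_nonneg α)
  have hx0 : 0 ≤ |x| ^ α := by positivity
  show _ ≤ (Set.Ioc (0 : ℝ) 1).indicator (fun x => x ^ α) x +
      (Set.Ioc (0 : ℝ) 1).indicator (fun x => x ^ α) (-x) + 2 * ((1 + |x|) ^ 2)⁻¹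
  rcases key with h | h
  · have := mul_le_mul_of_nonneg_right h hinv0
    linarith [n1 x, n1 (-x)]
  · have := mul_le_of_le_one_right hx0 hinv
    have h3 : 0 ≤ ((1 + |x|) ^ 2)⁻¹ := by positivity
    linarith

theorem SchwartzMap.exists_norm_le_prod {ι : Type*} [Fintype ι] (f : 𝓢(ι → ℝ, ℂ)) (p : ℕ) :
    ∃ C : ℝ, 0 ≤ C ∧ ∀ r, ‖f r‖ ≤ C * ∏ j, ((1 + |r j|) ^ p)⁻¹ := by
  set k := p * Fintype.card ι
  have h := fun r => SchwartzMap.one_add_le_sup_seminorm_apply (𝕜 := ℂ) (m := (k, 0)) le_rfl le_rfl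
    f r
  refine ⟨_, le_trans (by positivity) (h 0), fun r => ?_⟩
  rw [Finset.prod_inv_distrib, ← div_eq_mul_inv, le_div_iff₀ (by positivity), mul_comm]
  refine le_trans ?_ (h r)
  rw [norm_iteratedFDeriv_zero]
  refine mul_le_mul_of_nonneg_right ?_ (norm_nonneg _)
  calc ∏ j, (1 + |r j|) ^ p ≤ ∏ _j : ι, (1 + ‖r‖) ^ p := by
        refine Finset.prod_le_prod (fun j _ => by positivity) fun j _ => ?_
        have := norm_le_pi_norm r j
        rw [Real.norm_eq_abs] at this
        gcongr
    _ = (1 + ‖r‖) ^ k := by rw [Finset.prod_const, Finset.card_univ, ← pow_mul]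

theorem SchwartzMap.integrable_norm_mul_powWeight {ι : Type*} [Fintype ι] (f : 𝓢(ι → ℝ, ℂ))
    {α : ι → ℝ} (hα : ∀ j, -1 < α j) :
    Integrable fun r : ι → ℝ => ‖f r‖ * ∏ j, powWeight (α j) (r j) := by
  obtain ⟨p, hp⟩ : ∃ p : ℕ, ∀ j, |α j| + 2 ≤ p := by
    obtain ⟨p, hp⟩ := exists_nat_ge (∑ j, |α j| + 2)
    refine ⟨p, fun j => ?_⟩
    have := Finset.single_le_sum (f := fun j => |α j|) (fun j _ => abs_nonneg _)
      (Finset.mem_univ j)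
    linarith
  obtain ⟨C, hC, h⟩ := f.exists_norm_le_prod p
  have hi := (Integrable.fintype_prod (f := fun j x => powWeight (α j) x * ((1 + |x|) ^ p)⁻¹)
    fun j => integrable_powWeight (hα j) (hp j)).const_mul C
  have hw : Measurable fun r : ι → ℝ => ∏ j, powWeight (α j) (r j) :=
    Finset.measurable_prod _ fun j _ => (measurable_powWeight _).comp (measurable_pi_apply j)
  refine hi.mono' (f.continuous.norm.aestronglyMeasurable.mul hw.aestronglyMeasurable)
    (Filter.Eventually.of_forall fun r => ?_)
  have hw0 : 0 ≤ ∏ j, powWeight (α j) (r j) := Finset.prod_nonneg fun j _ => powWeight_nonneg _ _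
  rw [Real.norm_eq_abs, abs_of_nonneg (mul_nonneg (norm_nonneg _) hw0), Finset.prod_mul_distrib]
  calc _ ≤ (C * ∏ j, ((1 + |r j|) ^ p)⁻¹) * ∏ j, powWeight (α j) (r j) :=
        mul_le_mul_of_nonneg_right (h r) hw0
    _ = _ := by ring

/-- A base in the closed right half plane has argument at most `π/2` in modulus. The resulting
growth is just what the exponential decay of `Γ(-y)` compensates. -/
theorem norm_cpow_le_powWeight {w a : ℂ} {x : ℝ} (hre : 0 ≤ w.re) (hx : x ≠ 0) (h1 : |x| ≤ ‖w‖)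
    (h2 : ‖w‖ ≤ 1 + |x|) :
    ‖w ^ a‖ ≤ powWeight a.re x * Real.exp (Real.pi / 2 * |a.im|) := by
  have hx0 : 0 < |x| := abs_pos.2 hx
  have hw0 : 0 < ‖w‖ := hx0.trans_le h1
  refine (norm_cpow_le w a).trans ?_
  rw [div_eq_mul_inv, ← Real.exp_neg]
  have e1 : ‖w‖ ^ a.re ≤ powWeight a.re x := by
    unfold powWeight
    rcases le_or_gt 0 a.re with h | h
    · have := Real.rpow_le_rpow hw0.le h2 h
      have : 0 ≤ |x| ^ a.re := by positivity
      linarith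
    · have := Real.rpow_le_rpow_of_nonpos hx0 h1 h.le
      have : 0 ≤ (1 + |x|) ^ a.re := by positivity
      linarith
  have e2 : -(arg w * a.im) ≤ Real.pi / 2 * |a.im| := by
    have := abs_arg_le_pi_div_two_iff.2 hre
    calc -(arg w * a.im) ≤ |arg w * a.im| := neg_le_abs _
      _ = |arg w| * |a.im| := abs_mul _ _
      _ ≤ _ := by gcongr
  exact mul_le_mul e1 (Real.exp_le_exp.2 e2) (Real.exp_pos _).le (powWeight_nonneg _ _)

/-! ### Smeared powers of the regularized invariants -/

section Mixed

variable {A B : Type*}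

/-- The bases of the powers: the variables themselves in the first block, the variables rotated to
the (regularized) imaginary axis in the second one. -/
def mixedBase (ε : ℝ) (r : A ⊕ B → ℝ) : A ⊕ B → ℂ :=
  Sum.elim (fun K => (r (.inl K) : ℂ)) fun K => ε + I * r (.inr K)

/-- The domain where the variables of the first block are positive. -/
def mixedCone (A B : Type*) : Set (A ⊕ B → ℝ) := {r | ∀ K, 0 < r (.inl K)}

theorem measurable_mixedBase (ε : ℝ) (j : A ⊕ B) :
    Measurable fun r : A ⊕ B → ℝ => mixedBase ε r j := by
  unfold mixedBase
  rcases j with K | K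
  · simp only [Sum.elim_inl]; fun_prop
  · simp only [Sum.elim_inr]; fun_prop

theorem mixedBase_re_nonneg {ε : ℝ} (hε : 0 ≤ ε) {r : A ⊕ B → ℝ} (hr : r ∈ mixedCone A B)
    (j : A ⊕ B) : 0 ≤ (mixedBase ε r j).re := by
  rcases j with K | K
  · simpa [mixedBase] using (hr K).le
  · simpa [mixedBase] using hε

theorem mixedBase_re_pos {ε : ℝ} (hε : 0 < ε) {r : A ⊕ B → ℝ} (hr : r ∈ mixedCone A B)
    (j : A ⊕ B) : 0 < (mixedBase ε r j).re := by
  rcases j with K | K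
  · simpa [mixedBase] using hr K
  · simpa [mixedBase] using hε

theorem abs_le_norm_mixedBase (ε : ℝ) (r : A ⊕ B → ℝ) (j : A ⊕ B) :
    |r j| ≤ ‖mixedBase ε r j‖ := by
  rcases j with K | K
  · simp [mixedBase]
  · have := abs_im_le_norm (mixedBase ε r (.inr K))
    simpa [mixedBase] using this

theorem norm_mixedBase_le {ε : ℝ} (hε : 0 ≤ ε) (hε1 : ε ≤ 1) (r : A ⊕ B → ℝ) (j : A ⊕ B) :
    ‖mixedBase ε r j‖ ≤ 1 + |r j| := by
  rcases j with K | K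
  · simp [mixedBase]
  · refine (norm_add_le _ _).trans ?_
    simp only [norm_real, norm_mul, norm_I, one_mul, Real.norm_eq_abs, abs_of_nonneg hε]
    linarith

theorem measurableSet_mixedCone [Countable A] : MeasurableSet (mixedCone A B) := by
  have : mixedCone A B = ⋂ K : A, {r : A ⊕ B → ℝ | 0 < r (.inl K)} := by
    ext r; simp [mixedCone]
  rw [this]
  exact MeasurableSet.iInter fun K => measurableSet_lt measurable_const (measurable_pi_apply _)

variable [Fintype A] [Fintype B]

/-- The product of the powers of the bases. -/
def mixedPower (ε : ℝ) (a : A ⊕ B → ℂ) (r : A ⊕ B → ℝ) : ℂ := ∏ j, mixedBase ε r j ^ a j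

theorem measurable_mixedPower (ε : ℝ) :
    Measurable fun p : (A ⊕ B → ℂ) × (A ⊕ B → ℝ) => mixedPower ε p.1 p.2 := by
  unfold mixedPower
  exact Finset.measurable_prod _ fun j _ =>
    Measurable.pow ((measurable_mixedBase ε j).comp measurable_snd)
      ((measurable_pi_apply j).comp measurable_fst)

theorem measurable_mixedPower_right (ε : ℝ) (a : A ⊕ B → ℂ) : Measurable (mixedPower ε a) :=
  (measurable_mixedPower ε).comp (measurable_const.prodMk measurable_id)

theorem ae_forall_ne_zero {ι : Type*} [Fintype ι] : ∀ᵐ r : ι → ℝ, ∀ j, r j ≠ 0 := by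
  rw [ae_all_iff]
  intro j
  exact (Measure.quasiMeasurePreserving_eval (μ := fun _ : ι => (volume : Measure ℝ)) j).ae
    (compl_mem_ae_iff.2 (by simp : volume ({0} : Set ℝ) = 0))

theorem norm_mixedPower_le {ε : ℝ} (hε : 0 ≤ ε) (hε1 : ε ≤ 1) (a : A ⊕ B → ℂ) {r : A ⊕ B → ℝ}
    (hr : r ∈ mixedCone A B) (h0 : ∀ j, r j ≠ 0) : ‖mixedPower ε a r‖ ≤
      (∏ j, powWeight (a j).re (r j)) * ∏ K : B, Real.exp (Real.pi / 2 * |(a (.inr K)).im|) := by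
  rw [mixedPower, norm_prod, Fintype.prod_sum_type, Fintype.prod_sum_type, mul_assoc,
    ← Finset.prod_mul_distrib]
  refine mul_le_mul (Finset.prod_le_prod (fun K _ => norm_nonneg _) fun K _ => ?_)
    (Finset.prod_le_prod (fun K _ => norm_nonneg _) fun K _ => ?_)
    (Finset.prod_nonneg fun K _ => norm_nonneg _) (Finset.prod_nonneg fun K _ => powWeight_nonneg _ _)
  · show ‖(r (.inl K) : ℂ) ^ a (.inl K)‖ ≤ _
    rw [norm_cpow_eq_rpow_re_of_pos (hr K), powWeight, abs_of_pos (hr K)]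
    have := (hr K).le
    have : 0 ≤ (1 + r (.inl K)) ^ (a (.inl K)).re := by positivity
    linarith
  · exact norm_cpow_le_powWeight (mixedBase_re_nonneg hε hr _) (h0 _) (abs_le_norm_mixedBase _ _ _)
      (norm_mixedBase_le hε hε1 _ _)

theorem integrableOn_mul_mixedPower (f : 𝓢(A ⊕ B → ℝ, ℂ)) {ε : ℝ} (hε : 0 ≤ ε) (hε1 : ε ≤ 1)
    {a : A ⊕ B → ℂ} (ha : ∀ j, -1 < (a j).re) :
    IntegrableOn (fun r => f r * mixedPower ε a r) (mixedCone A B) := by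
  refine Integrable.mono' (((f.integrable_norm_mul_powWeight ha).mul_const
    (∏ K : B, Real.exp (Real.pi / 2 * |(a (.inr K)).im|))).integrableOn)
    (f.continuous.aestronglyMeasurable.mul
      (measurable_mixedPower_right ε a).aestronglyMeasurable) ?_
  filter_upwards [ae_restrict_mem measurableSet_mixedCone, ae_restrict_of_ae ae_forall_ne_zero]
    with r hr h0
  rw [norm_mul, mul_assoc]
  exact mul_le_mul_of_nonneg_left (norm_mixedPower_le hε hε1 a hr h0) (norm_nonneg _)

theorem norm_integral_mul_mixedPower_le (f : 𝓢(A ⊕ B → ℝ, ℂ)) {ε : ℝ} (hε : 0 ≤ ε) (hε1 : ε ≤ 1)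
    {α : A ⊕ B → ℝ} (hα : ∀ j, -1 < α j) {a : A ⊕ B → ℂ} (ha : ∀ j, (a j).re = α j) :
    ‖∫ r in mixedCone A B, f r * mixedPower ε a r‖ ≤
      (∫ r : A ⊕ B → ℝ in mixedCone A B, ‖f r‖ * ∏ j, powWeight (α j) (r j)) *
        ∏ K : B, Real.exp (Real.pi / 2 * |(a (.inr K)).im|) := by
  rw [← integral_mul_const]
  refine norm_integral_le_of_norm_le
    (((f.integrable_norm_mul_powWeight hα).mul_const _).integrableOn) ?_
  filter_upwards [ae_restrict_mem measurableSet_mixedCone, ae_restrict_of_ae ae_forall_ne_zero]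
    with r hr h0
  rw [norm_mul, mul_assoc]
  refine mul_le_mul_of_nonneg_left ?_ (norm_nonneg _)
  have := norm_mixedPower_le hε hε1 a hr h0
  simpa only [ha] using this

open Classical in
theorem hasLineDerivAt_mixedPower {ε : ℝ} (hε : 0 < ε) (a : A ⊕ B → ℂ) (k : B) (r : A ⊕ B → ℝ) :
    HasLineDerivAt ℝ (mixedPower ε (Function.update a (.inr k) (a (.inr k) + 1)))
      ((a (.inr k) + 1) * I * mixedPower ε a r) r (Pi.single (.inr k) 1) := by
  set v : A ⊕ B → ℝ := Pi.single (.inr k) 1 with hv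
  have hb : ∀ t : ℝ, ∀ j, j ≠ .inr k → mixedBase ε (r + t • v) j = mixedBase ε r j := by
    intro t j hj
    have : (r + t • v) j = r j := by
      rw [Pi.add_apply, Pi.smul_apply, hv, Pi.single_eq_of_ne hj, smul_zero, add_zero]
    rcases j with K | K
    · simp only [mixedBase, Sum.elim_inl, this]
    · simp only [mixedBase, Sum.elim_inr, this]
  have hk : ∀ t : ℝ, mixedBase ε (r + t • v) (.inr k) = ε + I * (r (.inr k) + t) := by
    intro t
    simp [mixedBase, hv]
  have hsplit : ∀ (c : A ⊕ B → ℂ) (x : A ⊕ B → ℝ), mixedPower ε c x =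
      mixedBase ε x (.inr k) ^ c (.inr k) *
        ∏ j ∈ Finset.univ.erase (.inr k), mixedBase ε x j ^ c j := fun c x =>
    (Finset.mul_prod_erase Finset.univ (fun j => mixedBase ε x j ^ c j) (Finset.mem_univ _)).symm
  have hfun : (fun t : ℝ => mixedPower ε (Function.update a (.inr k) (a (.inr k) + 1)) (r + t • v)) =
      fun t : ℝ => ((ε : ℂ) + I * (r (.inr k) + (t : ℂ))) ^ (a (.inr k) + 1) *
        ∏ j ∈ Finset.univ.erase (.inr k), mixedBase ε r j ^ a j := by
    funext t
    rw [hsplit, hk, Function.update_self]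
    congr 1
    refine Finset.prod_congr rfl fun j hj => ?_
    rw [Finset.mem_erase] at hj
    rw [hb t j hj.1, Function.update_of_ne hj.1]
  rw [HasLineDerivAt, hfun, hsplit a r]
  -- The regularization `ε > 0` keeps the base in the slit plane, even where the variable vanishes.
  have hslit : (ε : ℂ) + I * (r (.inr k) + ((0 : ℝ) : ℂ)) ∈ slitPlane := by
    left
    simpa using hε
  have hd : HasDerivAt (fun z : ℂ => (ε : ℂ) + I * (r (.inr k) + z)) I ((0 : ℝ) : ℂ) := by
    simpa using (((hasDerivAt_id ((0 : ℝ) : ℂ)).const_add (r (.inr k) : ℂ)).const_mul I).const_add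
      (ε : ℂ)
  have hd2 := ((hd.cpow_const (c := a (.inr k) + 1) hslit).comp_ofReal).mul_const
    (∏ j ∈ Finset.univ.erase (.inr k), mixedBase ε r j ^ a j)
  refine hd2.congr_deriv ?_
  simp only [mixedBase, Sum.elim_inr, ofReal_zero, add_zero, add_sub_cancel_right]
  ring

open Classical LineDeriv in
-- Integration by parts in one imaginary invariant raises its exponent by one and extracts the
-- factor `a + 1`, at the price of a derivative on the test function. The imaginary part of the
-- exponent is unchanged, so this can be repeated.
theorem integral_mul_mixedPower_eq (f : 𝓢(A ⊕ B → ℝ, ℂ)) {ε : ℝ} (hε : 0 < ε) (hε1 : ε ≤ 1)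
    {a : A ⊕ B → ℂ} (ha : ∀ j, -1 < (a j).re) (k : B) :
    (a (.inr k) + 1) * I * ∫ r in mixedCone A B, f r * mixedPower ε a r =
      -∫ r in mixedCone A B, (∂_{(Pi.single (.inr k) 1 : A ⊕ B → ℝ)} f) r *
        mixedPower ε (Function.update a (.inr k) (a (.inr k) + 1)) r := by
  set v : A ⊕ B → ℝ := Pi.single (.inr k) 1 with hv
  set a' := Function.update a (.inr k) (a (.inr k) + 1) with ha'
  have hre : ∀ j, -1 < (a' j).re := by
    intro j
    by_cases hj : j = .inr k
    · subst hj
      rw [ha', Function.update_self, add_re, one_re]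
      linarith [ha (.inr k)]
    · rw [ha', Function.update_of_ne hj]
      exact ha j
  set S := mixedCone A B with hS
  have hSm : MeasurableSet S := measurableSet_mixedCone
  have i1 := (integrable_indicator_iff hSm).2 (integrableOn_mul_mixedPower (∂_{v} f) hε.le hε1 hre)
  have i2 := (integrable_indicator_iff hSm).2
    ((integrableOn_mul_mixedPower f hε.le hε1 ha).const_mul ((a (.inr k) + 1) * I))
  have i3 := (integrable_indicator_iff hSm).2 (integrableOn_mul_mixedPower f hε.le hε1 hre)
  -- The direction of differentiation does not leave the cone, so its indicator is constant along
  -- the lines and no boundary term appears.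
  have hcone : ∀ (r : A ⊕ B → ℝ) (t : ℝ), r + t • v ∈ S ↔ r ∈ S := by
    intro r t
    simp [hS, mixedCone, hv]
  have key := integral_bilinear_hasLineDerivAt_right_eq_neg_left_of_integrable
    (μ := (volume : Measure (A ⊕ B → ℝ))) (f := f) (f' := fun r => (∂_{v} f : 𝓢(A ⊕ B → ℝ, ℂ)) r)
    (g := S.indicator (mixedPower ε a'))
    (g' := S.indicator fun r => (a (.inr k) + 1) * I * mixedPower ε a r) (v := v)
    (B := ContinuousLinearMap.mul ℝ ℂ) ?_ ?_ ?_ ?_ ?_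
  · simp only [ContinuousLinearMap.mul_apply'] at key
    rw [← integral_const_mul, ← integral_indicator hSm, ← integral_indicator hSm]
    refine (integral_congr_ae (Filter.Eventually.of_forall fun r => ?_)).trans (key.trans
      (congrArg Neg.neg (integral_congr_ae (Filter.Eventually.of_forall fun r => ?_))))
    · by_cases hr : r ∈ S
      · simp only [Set.indicator_of_mem hr]; ring
      · simp only [Set.indicator_of_notMem hr, mul_zero]
    · by_cases hr : r ∈ S
      · simp only [Set.indicator_of_mem hr]
      · simp only [Set.indicator_of_notMem hr, mul_zero]
  · refine i1.congr (Filter.Eventually.of_forall fun r => ?_)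
    by_cases hr : r ∈ S
    · simp [Set.indicator_of_mem hr]
    · simp [Set.indicator_of_notMem hr]
  · refine i2.congr (Filter.Eventually.of_forall fun r => ?_)
    by_cases hr : r ∈ S
    · simp only [Set.indicator_of_mem hr, ContinuousLinearMap.mul_apply']; ring
    · simp [Set.indicator_of_notMem hr]
  · refine i3.congr (Filter.Eventually.of_forall fun r => ?_)
    by_cases hr : r ∈ S
    · simp [Set.indicator_of_mem hr]
    · simp [Set.indicator_of_notMem hr]
  · intro r _
    rw [SchwartzMap.lineDerivOp_apply_eq_fderiv]
    exact f.differentiableAt.hasFDerivAt.hasLineDerivAt v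
  · intro r _
    rw [HasLineDerivAt]
    by_cases hr : r ∈ S
    · rw [Set.indicator_of_mem hr]
      have hd : HasDerivAt (fun t : ℝ => mixedPower ε a' (r + t • v)) _ 0 :=
        hasLineDerivAt_mixedPower hε a k r
      refine hd.congr_of_eventuallyEq
        (Filter.Eventually.of_forall fun t => ?_)
      exact Set.indicator_of_mem ((hcone r t).2 hr) _
    · rw [Set.indicator_of_notMem hr]
      refine (hasDerivAt_const (0 : ℝ) (0 : ℂ)).congr_of_eventuallyEq
        (Filter.Eventually.of_forall fun t => ?_)
      exact Set.indicator_of_notMem (fun h => hr ((hcone r t).1 h)) _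

/-- The multiset records how often to integrate by parts in each imaginary invariant. The constants
involve `f`, the real parts and these multiplicities, but not `ε`, which is what the limit requires.
-/
theorem exists_norm_integral_mul_multiset_prod_le (m : Multiset B) :
    ∀ (f : 𝓢(A ⊕ B → ℝ, ℂ)) (α : A ⊕ B → ℝ), (∀ j, -1 < α j) → ∃ C : ℝ, 0 ≤ C ∧
      ∀ ε : ℝ, 0 < ε → ε ≤ 1 → ∀ a : A ⊕ B → ℂ, (∀ j, (a j).re = α j) →
        ‖∫ r in mixedCone A B, f r * mixedPower ε a r‖ *
          (m.map fun K => 1 + |(a (.inr K)).im|).prod ≤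
            C * ∏ K : B, Real.exp (Real.pi / 2 * |(a (.inr K)).im|) := by
  classical
  induction m using Multiset.induction_on with
  | empty =>
    intro f α hα
    refine ⟨∫ r : A ⊕ B → ℝ in mixedCone A B, ‖f r‖ * ∏ j, powWeight (α j) (r j),
      setIntegral_nonneg measurableSet_mixedCone fun r _ => mul_nonneg (norm_nonneg _)
        (Finset.prod_nonneg fun j _ => powWeight_nonneg _ _), fun ε hε hε1 a ha => ?_⟩
    simpa using norm_integral_mul_mixedPower_le f hε.le hε1 hα ha
  | cons k m ih =>
    intro f α hα
    obtain ⟨C, hC, h⟩ := ih (LineDeriv.lineDerivOp (Pi.single (.inr k) 1 : A ⊕ B → ℝ) f)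
      (Function.update α (.inr k) (α (.inr k) + 1)) (fun j => by
        by_cases hj : j = .inr k
        · subst hj; rw [Function.update_self]; linarith [hα (.inr k)]
        · rw [Function.update_of_ne hj]; exact hα j)
    have hk1 : 0 < α (.inr k) + 1 := by linarith [hα (.inr k)]
    refine ⟨(1 / (α (.inr k) + 1) + 1) * C, by positivity, fun ε hε hε1 a ha => ?_⟩
    set a' := Function.update a (.inr k) (a (.inr k) + 1) with ha'
    have him : ∀ j, (a' j).im = (a j).im := by
      intro j
      by_cases hj : j = .inr k
      · subst hj; rw [ha', Function.update_self, add_im, one_im, add_zero]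
      · rw [ha', Function.update_of_ne hj]
    have hb := h ε hε hε1 a' (fun j => by
      by_cases hj : j = .inr k
      · subst hj; rw [ha', Function.update_self, Function.update_self, add_re, one_re, ha]
      · rw [ha', Function.update_of_ne hj, Function.update_of_ne hj, ha])
    simp only [him] at hb
    have heq := congrArg norm (integral_mul_mixedPower_eq f hε hε1 (a := a)
      (fun j => by rw [ha]; exact hα j) k)
    rw [norm_neg, norm_mul, norm_mul, norm_I, mul_one] at heq
    rw [← heq] at hb
    have hle := one_add_abs_im_le (a := a (.inr k) + 1) (by rw [add_re, one_re, ha]; exact hk1)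
    rw [add_re, one_re, ha, add_im, one_im, add_zero] at hle
    rw [Multiset.map_cons, Multiset.prod_cons]
    have hp : 0 ≤ (m.map fun K => 1 + |(a (.inr K)).im|).prod :=
      Multiset.prod_nonneg fun x hx => by
        obtain ⟨K, -, rfl⟩ := Multiset.mem_map.1 hx
        positivity
    calc _ ≤ ‖∫ r in mixedCone A B, f r * mixedPower ε a r‖ *
          ((1 / (α (.inr k) + 1) + 1) * ‖a (.inr k) + 1‖ *
            (m.map fun K => 1 + |(a (.inr K)).im|).prod) := by gcongr
      _ = (1 / (α (.inr k) + 1) + 1) * (‖a (.inr k) + 1‖ *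
          ‖∫ r in mixedCone A B, f r * mixedPower ε a r‖ *
            (m.map fun K => 1 + |(a (.inr K)).im|).prod) := by ring
      _ ≤ (1 / (α (.inr k) + 1) + 1) * (C * ∏ K : B, Real.exp (Real.pi / 2 * |(a (.inr K)).im|)) :=
          by gcongr
      _ = _ := by ring

theorem exists_norm_integral_mul_mixedPower_le (f : 𝓢(A ⊕ B → ℝ, ℂ)) {α : A ⊕ B → ℝ}
    (hα : ∀ j, -1 < α j) (k : ℕ) : ∃ C : ℝ, 0 ≤ C ∧
      ∀ ε : ℝ, 0 < ε → ε ≤ 1 → ∀ a : A ⊕ B → ℂ, (∀ j, (a j).re = α j) →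
        ‖∫ r in mixedCone A B, f r * mixedPower ε a r‖ * ∏ K : B, (1 + |(a (.inr K)).im|) ^ k ≤
          C * ∏ K : B, Real.exp (Real.pi / 2 * |(a (.inr K)).im|) := by
  obtain ⟨C, hC, h⟩ :=
    exists_norm_integral_mul_multiset_prod_le (k • (Finset.univ : Finset B).val) f α hα
  refine ⟨C, hC, fun ε hε hε1 a ha => ?_⟩
  have := h ε hε hε1 a ha
  rwa [Multiset.map_nsmul, Multiset.prod_nsmul, ← Finset.prod_eq_multiset_prod,
    ← Finset.prod_pow] at this

end Mixed

/-! ### Majorants for the Mellin integrand -/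

namespace StarGraph

variable (G : StarGraph)

theorem invPower_eq {s : ℝ} (z : G.MellinIdx s → ℂ) (r : G.Inv s) :
    G.invPower z r = mixedPower 0 (fun j => z (.inr j)) r := by
  rw [mixedPower, Fintype.prod_sum_type, invPower]
  congr 1
  refine Finset.prod_congr rfl fun K _ => ?_
  simp [mixedBase]

theorem prod_freeIdx {s : ℝ} (K₀ : G.KU) {f : G.MellinIdx s → ℝ} (h : f (.inl K₀) ≠ 0) :
    ∏ j : G.FreeIdx s K₀, f j.1 =
      (∏ K ∈ (Finset.univ : Finset G.KU).erase K₀, f (.inl K)) * ∏ j, f (.inr j) := by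
  refine mul_left_cancel₀ h ?_
  rw [← G.prod_eq_mul_prod_freeIdx K₀ f, Fintype.prod_sum_type, ← mul_assoc,
    Finset.mul_prod_erase Finset.univ (fun K : G.KU => f (.inl K)) (Finset.mem_univ K₀)]

/-- Domination of the smeared integrand, uniform in the regularization. -/
theorem exists_norm_mellinKernel_mul_integral_le {s : ℝ} (hs : 0 < s) {D : ℂ} (hD : D ∈ dimStrip)
    {σ : G.MellinIdx s → ℝ} (hσ : σ ∈ G.Delta s D) (K₀ : G.KU) (f : 𝓢(G.Inv s, ℂ)) :
    ∃ C : ℝ, 0 ≤ C ∧ ∀ ε : ℝ, 0 < ε → ε ≤ 1 → ∀ z : G.MellinIdx s → ℂ,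
      (∀ j, (z j).re = σ j) → ∑ j, z j = -D / 2 →
        ‖G.mellinKernel s D z * ∫ r in G.invCone s, f r * mixedPower ε (fun j => z (.inr j)) r‖ ≤
          C * ∏ j : G.FreeIdx s K₀, ((1 + |(z j.1).im|) ^ 2)⁻¹ := by
  obtain ⟨C₁, hC₁, M, h₁⟩ := G.exists_norm_barnesFactor_le hs hσ K₀
  obtain ⟨C₂, hC₂, h₂⟩ := G.exists_norm_phiFactor_le hD hσ
  -- Of the `M + 3` powers, `M` absorb the growth of the Barnes factor, one the linear loss in the
  -- bound for `Γ(-y)`, and two ensure integrability.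
  obtain ⟨C₃, hC₃, h₃⟩ := exists_norm_integral_mul_mixedPower_le f
    (α := fun j => σ (.inr j)) (fun j => G.Delta_gt_neg_one hD hσ _) (M + 3)
  have h₄ : ∀ K : G.KR s, ∃ C : ℝ, 0 ≤ C ∧ ∀ a : ℂ, a.re = -σ (.inr (.inl K)) →
      ‖Gamma a‖ * (1 + |a.im|) ^ (M + 2) ≤ C := fun K =>
    exists_norm_Gamma_mul_pow_le (by linarith [G.Delta_neg hσ (.inr (.inl K))]) _
  have h₅ : ∀ K : G.KI s, ∃ C : ℝ, 0 ≤ C ∧ ∀ a : ℂ, a.re = -σ (.inr (.inr K)) →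
      ‖Gamma a‖ * Real.exp (Real.pi / 2 * |a.im|) ≤ C * (1 + |a.im|) := fun K =>
    exists_norm_Gamma_mul_exp_le (by linarith [G.Delta_neg hσ (.inr (.inr K))])
      (by linarith [G.Delta_gt_neg_one hD hσ (.inr (.inr K))])
  choose C₄ hC₄ h₄ using h₄
  choose C₅ hC₅ h₅ using h₅
  have hP₄ : 0 ≤ ∏ K, C₄ K := Finset.prod_nonneg fun K _ => hC₄ K
  have hP₅ : 0 ≤ ∏ K, C₅ K := Finset.prod_nonneg fun K _ => hC₅ K
  refine ⟨C₁ * C₂ * C₃ * (∏ K, C₄ K) * ∏ K, C₅ K, by positivity, fun ε hε hε1 z hz hsum => ?_⟩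
  set S := ∫ r in G.invCone s, f r * mixedPower ε (fun j => z (.inr j)) r with hS
  rw [Finset.prod_inv_distrib, ← div_eq_mul_inv,
    le_div_iff₀ (Finset.prod_pos fun j _ => by positivity),
    G.prod_freeIdx K₀ (f := fun j => (1 + |(z j).im|) ^ 2) (by positivity), mellinKernel_eq,
    norm_mul, norm_mul, norm_mul, norm_prod, Fintype.prod_sum_type, Fintype.prod_sum_type]
  have b₁ := h₁ z hz hsum
  have b₂ := h₂ z hz
  have b₃ := h₃ ε hε hε1 (fun j => z (.inr j)) fun j => hz _
  rw [Fintype.prod_sum_type] at b₁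
  have b₄ : (∏ K : G.KR s, ‖Gamma (-z (.inr (.inl K)))‖) *
      ∏ K : G.KR s, (1 + |(z (.inr (.inl K))).im|) ^ (M + 2) ≤ ∏ K, C₄ K := by
    rw [← Finset.prod_mul_distrib]
    refine Finset.prod_le_prod (fun K _ => by positivity) fun K _ => ?_
    simpa using h₄ K (-z (.inr (.inl K))) (by rw [neg_re, hz])
  have b₅ : (∏ K : G.KI s, ‖Gamma (-z (.inr (.inr K)))‖) *
      ∏ K : G.KI s, Real.exp (Real.pi / 2 * |(z (.inr (.inr K))).im|) ≤
        (∏ K, C₅ K) * ∏ K : G.KI s, (1 + |(z (.inr (.inr K))).im|) := by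
    rw [← Finset.prod_mul_distrib, ← Finset.prod_mul_distrib]
    refine Finset.prod_le_prod (fun K _ => by positivity) fun K _ => ?_
    simpa using h₅ K (-z (.inr (.inr K))) (by rw [neg_re, hz])
  simp only [Finset.prod_pow] at b₁ b₃ b₄ ⊢
  set p := ∏ K : G.KI s, (1 + |(z (.inr (.inr K))).im|) with hp
  set q := ∏ K : G.KR s, (1 + |(z (.inr (.inl K))).im|) with hq
  set g := ∏ K : G.KI s, ‖Gamma (-z (.inr (.inr K)))‖ with hg
  set g' := ∏ K : G.KR s, ‖Gamma (-z (.inr (.inl K)))‖ with hg'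
  set e := ∏ K : G.KI s, Real.exp (Real.pi / 2 * |(z (.inr (.inr K))).im|) with he
  set X := ∏ K ∈ (Finset.univ : Finset G.KU).erase K₀, (1 + |(z (.inl K)).im|) with hX
  have hp0 : 0 < p := Finset.prod_pos fun K _ => by positivity
  have hq0 : 0 < q := Finset.prod_pos fun K _ => by positivity
  have hg0 : 0 ≤ g := Finset.prod_nonneg fun K _ => norm_nonneg _
  have hg'0 : 0 ≤ g' := Finset.prod_nonneg fun K _ => norm_nonneg _
  -- Here the exponential decay of the Gamma factors cancels the exponential growth of the smeared
  -- powers.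
  have b₆ : g * p ^ (M + 2) * ‖S‖ ≤ C₃ * ∏ K, C₅ K := by
    refine le_of_mul_le_mul_right ?_ hp0
    calc g * p ^ (M + 2) * ‖S‖ * p = g * (‖S‖ * p ^ (M + 3)) := by ring
      _ ≤ g * (C₃ * e) := mul_le_mul_of_nonneg_left b₃ hg0
      _ = C₃ * (g * e) := by ring
      _ ≤ C₃ * ((∏ K, C₅ K) * p) := mul_le_mul_of_nonneg_left b₅ hC₃
      _ = _ := by ring
  calc _ = (‖G.barnesFactor s z‖ * X ^ 2) * ‖G.phiFactor s D z‖ * (g' * q ^ 2) *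
        (g * p ^ 2 * ‖S‖) := by ring
    _ ≤ (C₁ * (q ^ M * p ^ M)) * C₂ * (g' * q ^ 2) * (g * p ^ 2 * ‖S‖) := by gcongr
    _ = C₁ * C₂ * (g' * q ^ (M + 2)) * (g * p ^ (M + 2) * ‖S‖) := by ring
    _ ≤ C₁ * C₂ * (∏ K, C₄ K) * (C₃ * ∏ K, C₅ K) := by gcongr
    _ = _ := by ring

/-- Domination of the regularized integrand before smearing. -/
theorem exists_norm_barnesFactor_mul_le {s : ℝ} (hs : 0 < s) {D : ℂ} (hD : D ∈ dimStrip)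
    {σ : G.MellinIdx s → ℝ} (hσ : σ ∈ G.Delta s D) (K₀ : G.KU) {ε : ℝ} (hε : 0 < ε) (hε1 : ε ≤ 1) :
    ∃ β : G.KR s ⊕ G.KI s → ℝ, (∀ j, -1 < β j) ∧ ∃ C : ℝ, 0 ≤ C ∧ ∀ r ∈ G.invCone s,
      ∀ z : G.MellinIdx s → ℂ, (∀ j, (z j).re = σ j) → ∑ j, z j = -D / 2 →
        ‖G.barnesFactor s z * (∏ j, Gamma (-z (.inr j))) *
            mixedPower ε (fun j => z (.inr j)) r‖ ≤
          (C * ∏ j, powWeight (β j) (r j)) *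
            ∏ j : G.FreeIdx s K₀, ((1 + |(z j.1).im|) ^ 2)⁻¹ := by
  obtain ⟨C₁, hC₁, M, h₁⟩ := G.exists_norm_barnesFactor_le hs hσ K₀
  have h₂ : ∀ j : G.KR s ⊕ G.KI s, ∃ C : ℝ, 0 ≤ C ∧ ∀ a w : ℂ, a.re = -σ (.inr j) → 0 < w.re →
      ‖Gamma a * w ^ (-a)‖ * (1 + |a.im|) ^ (M + 2) ≤
        C * ‖w‖ ^ (M + 2) * w.re ^ (-(-σ (.inr j) + (M + 2 : ℕ))) := fun j =>
    exists_norm_Gamma_mul_cpow_mul_pow_le (by linarith [G.Delta_neg hσ (.inr j)]) _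
  choose C₂ hC₂ h₂ using h₂
  -- At fixed `ε` the bound on `Γ(-y) w^y` costs `‖w‖ ^ (M + 2)` and a power of `1 / Re w`. For an
  -- imaginary invariant this means polynomial growth and a constant depending on `ε`; for a real
  -- one the powers recombine to `r ^ σ`.
  let β : G.KR s ⊕ G.KI s → ℝ := Sum.elim (fun K => σ (.inr (.inl K))) fun _ => (M + 2 : ℕ)
  let c : G.KR s ⊕ G.KI s → ℝ := Sum.elim (fun _ => 1)
    fun K => ε ^ (-(-σ (.inr (.inr K)) + (M + 2 : ℕ)))
  have hc : ∀ j, 0 ≤ c j := by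
    rintro (K | K)
    · exact zero_le_one
    · exact Real.rpow_nonneg hε.le _
  have hbase : ∀ r ∈ G.invCone s, ∀ j, ‖mixedBase ε r j‖ ^ (M + 2) *
      (mixedBase ε r j).re ^ (-(-σ (.inr j) + (M + 2 : ℕ))) ≤ c j * powWeight (β j) (r j) := by
    intro r hr j
    rcases j with K | K
    · have hK : 0 < r (.inl K) := hr K
      simp only [mixedBase, Sum.elim_inl, norm_real, Real.norm_eq_abs, abs_of_pos hK, ofReal_re, c,
        β, one_mul, powWeight]
      rw [← Real.rpow_natCast, ← Real.rpow_add hK]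
      have : 0 ≤ (1 + r (.inl K)) ^ σ (.inr (.inl K)) := by positivity
      rw [show (((M + 2 : ℕ) : ℝ) + -(-σ (.inr (.inl K)) + ((M + 2 : ℕ) : ℝ))) =
        σ (.inr (.inl K)) by ring]
      linarith
    · have h1 := norm_mixedBase_le hε.le hε1 r (.inr K)
      have h2 : (mixedBase ε r (.inr K)).re = ε := by simp [mixedBase]
      rw [h2, mul_comm]
      refine mul_le_mul_of_nonneg_left ?_ (Real.rpow_nonneg hε.le _)
      simp only [β, Sum.elim_inr, powWeight, Real.rpow_natCast]
      have h3 := pow_le_pow_left₀ (norm_nonneg _) h1 (M + 2)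
      have h4 : 0 ≤ |r (.inr K)| ^ (M + 2) := by positivity
      linarith
  refine ⟨β, ?_, C₁ * ∏ j, C₂ j * c j, ?_, fun r hr z hz hsum => ?_⟩
  · rintro (K | K)
    · exact G.Delta_gt_neg_one hD hσ _
    · have : (0 : ℝ) ≤ (M + 2 : ℕ) := Nat.cast_nonneg _
      show -1 < ((M + 2 : ℕ) : ℝ)
      linarith
  · exact mul_nonneg hC₁ (Finset.prod_nonneg fun j _ => mul_nonneg (hC₂ j) (hc j))
  rw [Finset.prod_inv_distrib, ← div_eq_mul_inv,
    le_div_iff₀ (Finset.prod_pos fun j _ => by positivity),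
    G.prod_freeIdx K₀ (f := fun j => (1 + |(z j).im|) ^ 2) (by positivity), mul_assoc, mixedPower,
    ← Finset.prod_mul_distrib, norm_mul, norm_prod]
  have b₁ := h₁ z hz hsum
  have b₂ : ∏ j, (‖Gamma (-z (.inr j)) * mixedBase ε r j ^ z (.inr j)‖ *
      (1 + |(z (.inr j)).im|) ^ (M + 2)) ≤ ∏ j, (C₂ j * c j * powWeight (β j) (r j)) := by
    refine Finset.prod_le_prod (fun j _ => by positivity) fun j _ => ?_
    have h3 := h₂ j (-z (.inr j)) (mixedBase ε r j) (by rw [neg_re, hz])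
      (mixedBase_re_pos hε hr j)
    rw [neg_neg, neg_im, abs_neg] at h3
    refine h3.trans ?_
    rw [mul_assoc, mul_assoc]
    exact mul_le_mul_of_nonneg_left (hbase r hr j) (hC₂ j)
  rw [Finset.prod_mul_distrib, Finset.prod_mul_distrib] at b₂
  simp only [Finset.prod_pow] at b₁ b₂ ⊢
  set p := ∏ j, (1 + |(z (.inr j)).im|) with hp
  have hp0 : 0 < p := Finset.prod_pos fun K _ => by positivity
  set g := ∏ j, ‖Gamma (-z (.inr j)) * mixedBase ε r j ^ z (.inr j)‖ with hg
  have hg0 : 0 ≤ g := Finset.prod_nonneg fun K _ => norm_nonneg _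
  calc _ = (‖G.barnesFactor s z‖ *
        (∏ K ∈ (Finset.univ : Finset G.KU).erase K₀, (1 + |(z (.inl K)).im|)) ^ 2) *
          (g * p ^ 2) := by ring
    _ ≤ (C₁ * p ^ M) * (g * p ^ 2) := by gcongr
    _ = C₁ * (g * p ^ (M + 2)) := by ring
    _ ≤ C₁ * ((∏ j, C₂ j * c j) * ∏ j, powWeight (β j) (r j)) := by gcongr
    _ = _ := by ring

/-! ### The Mellin–Barnes representation of the regularized parametric integrand -/

section FreeIdx

variable (s : ℝ) (K₀ : G.KU)

open Classical in
/-- The free Mellin variables: those of `HU` other than `x_{K₀}`, and those of `HV`. -/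
def freeIdxEquiv : {K : G.KU // K ≠ K₀} ⊕ (G.KR s ⊕ G.KI s) ≃ G.FreeIdx s K₀ where
  toFun := Sum.elim (fun K => ⟨.inl K.1, fun h => K.2 (Sum.inl_injective h)⟩)
    fun j => ⟨.inr j, Sum.inr_ne_inl⟩
  invFun j := match j with
    | ⟨.inl K, h⟩ => .inl ⟨K, fun h' => h (congrArg Sum.inl h')⟩
    | ⟨.inr j, _⟩ => .inr j
  left_inv := by rintro (K | j) <;> rfl
  right_inv := by rintro ⟨K | j, h⟩ <;> rfl

instance : Fintype {K : G.KU // K ≠ K₀} := Fintype.ofFinite _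

/-- The imaginary parts of the free Mellin variables as pairs. -/
def freeIdxPiEquiv : ({K : G.KU // K ≠ K₀} → ℝ) × (G.KR s ⊕ G.KI s → ℝ) ≃ᵐ
    (G.FreeIdx s K₀ → ℝ) :=
  (MeasurableEquiv.sumPiEquivProdPi fun _ => ℝ).symm.trans
    (MeasurableEquiv.piCongrLeft (fun _ => ℝ) (G.freeIdxEquiv s K₀))

theorem measurePreserving_freeIdxPiEquiv : MeasurePreserving (G.freeIdxPiEquiv s K₀) :=
  (volume_measurePreserving_sumPiEquivProdPi_symm fun _ => ℝ).trans
    (volume_measurePreserving_piCongrLeft (fun _ => ℝ) (G.freeIdxEquiv s K₀))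

theorem freeIdxPiEquiv_apply (p : ({K : G.KU // K ≠ K₀} → ℝ) × (G.KR s ⊕ G.KI s → ℝ))
    (i : {K : G.KU // K ≠ K₀} ⊕ (G.KR s ⊕ G.KI s)) :
    G.freeIdxPiEquiv s K₀ p (G.freeIdxEquiv s K₀ i) = Sum.elim p.1 p.2 i := by
  rw [freeIdxPiEquiv, MeasurableEquiv.trans_apply, MeasurableEquiv.piCongrLeft_apply_apply]
  rcases i with i | i <;> rfl

end FreeIdx

end StarGraph

namespace StarGraph

variable (G : StarGraph)

theorem card_freeIdx (s : ℝ) (K₀ : G.KU) : Fintype.card (G.FreeIdx s K₀) =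
    Fintype.card {K : G.KU // K ≠ K₀} + Fintype.card (G.KR s ⊕ G.KI s) := by
  rw [← Fintype.card_congr (G.freeIdxEquiv s K₀), Fintype.card_sum]

theorem prod_KU_eq_mul_prod_ne (K₀ : G.KU) {M : Type*} [CommMonoid M] (f : G.KU → M) :
    ∏ K, f K = f K₀ * ∏ K : {K : G.KU // K ≠ K₀}, f K := by
  classical
  convert Fintype.prod_eq_mul_prod_subtype_ne f K₀

theorem sum_KU_eq_add_sum_ne (K₀ : G.KU) {M : Type*} [AddCommMonoid M] (f : G.KU → M) :
    ∑ K, f K = f K₀ + ∑ K : {K : G.KU // K ≠ K₀}, f K := by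
  classical
  convert Fintype.sum_eq_add_sum_subtype_ne f K₀

section

variable {s : ℝ} (D : ℂ) (σ : G.MellinIdx s → ℝ) (K₀ : G.KU)
  (p : ({K : G.KU // K ≠ K₀} → ℝ) × (G.KR s ⊕ G.KI s → ℝ))

theorem contourPoint_pair_inl (K : {K : G.KU // K ≠ K₀}) :
    G.contourPoint D σ K₀ (G.freeIdxPiEquiv s K₀ p) (.inl K.1) =
      (σ (.inl K.1) : ℂ) + I * p.1 K := by
  rw [contourPoint_of_ne _ _ _ _ _ (fun h => K.2 (Sum.inl_injective h))]
  have := G.freeIdxPiEquiv_apply s K₀ p (.inl K)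
  rw [Sum.elim_inl] at this
  rw [← this]
  rfl

theorem contourPoint_pair_inr (j : G.KR s ⊕ G.KI s) :
    G.contourPoint D σ K₀ (G.freeIdxPiEquiv s K₀ p) (.inr j) = (σ (.inr j) : ℂ) + I * p.2 j := by
  rw [contourPoint_of_ne _ _ _ _ _ Sum.inr_ne_inl]
  have := G.freeIdxPiEquiv_apply s K₀ p (.inr j)
  rw [Sum.elim_inr] at this
  rw [← this]
  rfl

theorem contourPoint_pair_self :
    G.contourPoint D σ K₀ (G.freeIdxPiEquiv s K₀ p) (.inl K₀) =
      -(D / 2 + ∑ j, ((σ (.inr j) : ℂ) + I * p.2 j) +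
        ∑ K : {K : G.KU // K ≠ K₀}, ((σ (.inl K.1) : ℂ) + I * p.1 K)) := by
  have h := G.sum_contourPoint D σ K₀ (G.freeIdxPiEquiv s K₀ p)
  rw [Fintype.sum_sum_type, G.sum_KU_eq_add_sum_ne K₀] at h
  simp only [contourPoint_pair_inl, contourPoint_pair_inr] at h
  linear_combination h

theorem neg_sum_contourPoint_pair :
    -∑ K : G.KU, G.contourPoint D σ K₀ (G.freeIdxPiEquiv s K₀ p) (.inl K) =
      D / 2 + ∑ j, ((σ (.inr j) : ℂ) + I * p.2 j) := by
  have h := G.sum_contourPoint D σ K₀ (G.freeIdxPiEquiv s K₀ p)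
  rw [Fintype.sum_sum_type] at h
  simp only [contourPoint_pair_inr] at h
  linear_combination -h

end

/-- The regularized integrand of the representation at given invariants and parameters. -/
def regIntegrand (s ε : ℝ) (r : G.Inv s) (t : Fin G.L → ℝ) (z : G.MellinIdx s → ℂ) : ℂ :=
  G.barnesFactor s z * (∏ j, Gamma (-z (.inr j))) * mixedPower ε (fun j => z (.inr j)) r *
    ∏ j, (G.mon (G.idxPair j) t : ℂ) ^ z j

theorem measurable_contour {s : ℝ} (D : ℂ) (σ : G.MellinIdx s → ℝ) (K₀ : G.KU) :
    Measurable fun η => G.contourPoint D σ K₀ η :=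
  measurable_pi_iff.2 fun j => G.measurable_contourPoint D σ K₀ j

theorem measurable_regIntegrand {α : Type*} [MeasurableSpace α] (s ε : ℝ) {r : α → G.Inv s}
    (hr : Measurable r) {t : α → Fin G.L → ℝ} (ht : Measurable t) {z : α → G.MellinIdx s → ℂ}
    (hz : Measurable z) : Measurable fun a => G.regIntegrand s ε (r a) (t a) (z a) := by
  unfold regIntegrand
  refine Measurable.mul (Measurable.mul (((G.measurable_barnesFactor s).comp hz).mul
    ((G.measurable_prod_Gamma s).comp hz)) ?_) (Finset.measurable_prod _ fun j _ => ?_)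
  · refine (measurable_mixedPower ε).comp (Measurable.prodMk ?_ hr)
    exact measurable_pi_iff.2 fun j => (measurable_pi_apply _).comp hz
  · exact Measurable.pow (measurable_ofReal.comp ((G.measurable_mon _).comp ht))
      ((measurable_pi_apply j).comp hz)

theorem integrable_prod_inv_sq_contour {s : ℝ} (D : ℂ) (σ : G.MellinIdx s → ℝ) (K₀ : G.KU) :
    Integrable fun η : G.FreeIdx s K₀ → ℝ =>
      ∏ j : G.FreeIdx s K₀, ((1 + |(G.contourPoint D σ K₀ η j.1).im|) ^ 2)⁻¹ := by
  simp only [contourPoint_im_of_ne]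
  exact integrable_prod_one_add_abs_pow_neg_two _

theorem norm_prod_mon_cpow {s : ℝ} {t : Fin G.L → ℝ} (ht : t ∈ G.cube) {σ : G.MellinIdx s → ℝ}
    {z : G.MellinIdx s → ℂ} (hz : ∀ j, (z j).re = σ j) :
    ‖∏ j, (G.mon (G.idxPair j) t : ℂ) ^ z j‖ = ∏ ℓ, t ℓ ^ (G.phi σ ℓ - 1) := by
  rw [← G.prod_cpow_phi ht, norm_prod]
  refine Finset.prod_congr rfl fun ℓ _ => ?_
  rw [norm_cpow_eq_rpow_re_of_pos (G.cube_pos ht ℓ), sub_re, G.phi_re hz, one_re]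

theorem integrable_regIntegrand {s : ℝ} (hs : 0 < s) {D : ℂ} (hD : D ∈ dimStrip)
    {σ : G.MellinIdx s → ℝ} (hσ : σ ∈ G.Delta s D) (K₀ : G.KU) {ε : ℝ} (hε : 0 < ε) (hε1 : ε ≤ 1)
    {r : G.Inv s} (hr : r ∈ G.invCone s) {t : Fin G.L → ℝ} (ht : t ∈ G.cube) :
    Integrable fun η => G.regIntegrand s ε r t (G.contourPoint D σ K₀ η) := by
  obtain ⟨β, -, C, hC, h⟩ := G.exists_norm_barnesFactor_mul_le hs hD hσ K₀ hε hε1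
  refine (((G.integrable_prod_inv_sq_contour D σ K₀).const_mul
    (C * ∏ j, powWeight (β j) (r j))).mul_const (∏ ℓ, t ℓ ^ (G.phi σ ℓ - 1))).mono'
    (G.measurable_regIntegrand s ε measurable_const measurable_const
      (G.measurable_contour D σ K₀)).aestronglyMeasurable (Filter.Eventually.of_forall fun η => ?_)
  have hre := G.contourPoint_re K₀ η (G.Delta_sum hσ)
  rw [regIntegrand, norm_mul, G.norm_prod_mon_cpow ht hre]
  exact mul_le_mul_of_nonneg_right (h r hr _ hre (G.sum_contourPoint D σ K₀ η))
    (Finset.prod_nonneg fun ℓ _ => Real.rpow_nonneg (G.cube_pos ht ℓ).le _)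

/-- For fixed `y`, the dependence on the remaining `x` has the form of the Barnes splitting, with
`K₀` as the distinguished summand. -/
theorem regIntegrand_pair {s : ℝ} (hs : 0 < s) (D : ℂ) (σ : G.MellinIdx s → ℝ) (K₀ : G.KU) (ε : ℝ)
    (r : G.Inv s) {t : Fin G.L → ℝ} (ht : t ∈ G.cube)
    (x : {K : G.KU // K ≠ K₀} → ℝ) (y : G.KR s ⊕ G.KI s → ℝ) :
    G.regIntegrand s ε r t (G.contourPoint D σ K₀ (G.freeIdxPiEquiv s K₀ (x, y))) =
      (∏ j, (Gamma (-(σ (.inr j) + I * y j)) * mixedBase ε r j ^ ((σ (.inr j) : ℂ) + I * y j) *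
        (G.mon (G.idxPair (.inr j : G.MellinIdx s)) t : ℂ) ^ ((σ (.inr j) : ℂ) + I * y j))) /
        Gamma (D / 2 + ∑ j, ((σ (.inr j) : ℂ) + I * y j)) *
      ((∏ K : {K : G.KU // K ≠ K₀}, (Gamma (-(σ (.inl K.1) + I * x K)) *
        ((G.aCoef s K.1 * G.mon K.1 t : ℝ) : ℂ) ^ ((σ (.inl K.1) : ℂ) + I * x K))) *
        (Gamma (D / 2 + ∑ j, ((σ (.inr j) : ℂ) + I * y j) +
            ∑ K : {K : G.KU // K ≠ K₀}, ((σ (.inl K.1) : ℂ) + I * x K)) *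
          ((G.aCoef s K₀ * G.mon K₀ t : ℝ) : ℂ) ^ (-(D / 2 + ∑ j, ((σ (.inr j) : ℂ) + I * y j) +
            ∑ K : {K : G.KU // K ≠ K₀}, ((σ (.inl K.1) : ℂ) + I * x K))))) := by
  have hmul : ∀ (K : G.KU) (w : ℂ), ((G.aCoef s K * G.mon K t : ℝ) : ℂ) ^ w =
      (G.aCoef s K : ℂ) ^ w * (G.mon K t : ℂ) ^ w := fun K w => by
    rw [ofReal_mul, mul_cpow_ofReal_nonneg (G.aCoef_pos hs K).le (G.mon_pos ht K).le]
  have hsplit : ∀ z : G.MellinIdx s → ℂ, ∏ j, (G.mon (G.idxPair j) t : ℂ) ^ z j =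
      (G.mon K₀ t : ℂ) ^ z (.inl K₀) *
        (∏ K : {K : G.KU // K ≠ K₀}, (G.mon K.1 t : ℂ) ^ z (.inl K.1)) *
        ∏ j, (G.mon (G.idxPair (.inr j : G.MellinIdx s)) t : ℂ) ^ z (.inr j) := fun z => by
    rw [Fintype.prod_sum_type, G.prod_KU_eq_mul_prod_ne K₀]
    rfl
  rw [regIntegrand, barnesFactor, neg_sum_contourPoint_pair, mixedPower, hsplit,
    G.prod_KU_eq_mul_prod_ne K₀]
  simp only [contourPoint_pair_inl, contourPoint_pair_inr, contourPoint_pair_self, hmul,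
    Finset.prod_mul_distrib, neg_neg]
  ring

/-- Mellin inversion of all the exponentials leaves a negative power of `HU` with exponent `D/2 + ∑
y`; its Barnes splitting supplies the variables `x`. Absolute convergence assembles the iterated
integral into one over all free variables. -/
theorem prod_exp_div_HU_cpow_eq_integral {s : ℝ} (hs : 0 < s) {D : ℂ} (hD : D ∈ dimStrip)
    {σ : G.MellinIdx s → ℝ} (hσ : σ ∈ G.Delta s D) (K₀ : G.KU) {ε : ℝ} (hε : 0 < ε) (hε1 : ε ≤ 1)
    {r : G.Inv s} (hr : r ∈ G.invCone s) {t : Fin G.L → ℝ} (ht : t ∈ G.cube) :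
    (∏ j, exp (-(mixedBase ε r j *
        ((G.mon (G.idxPair (.inr j : G.MellinIdx s)) t / G.HU s t : ℝ) : ℂ)))) /
          (G.HU s t : ℂ) ^ (D / 2) =
      (1 / (2 * (Real.pi : ℂ))) ^ Fintype.card (G.FreeIdx s K₀) *
        ∫ η, G.regIntegrand s ε r t (G.contourPoint D σ K₀ η) := by
  have hU := G.HU_pos hs ht
  have hU0 : (G.HU s t : ℂ) ≠ 0 := by exact_mod_cast hU.ne'
  have hsum := G.Delta_sum hσ
  rw [Fintype.sum_sum_type, G.sum_KU_eq_add_sum_ne K₀] at hsum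
  have hzre : ∀ y : G.KR s ⊕ G.KI s → ℝ, (D / 2 + ∑ j, ((σ (.inr j) : ℂ) + I * y j)).re =
      D.re / 2 + ∑ j, σ (.inr j) := fun y => by
    simp [re_sum]
  have hσX : ∑ K : {K : G.KU // K ≠ K₀}, σ (.inl K.1) ≤ 0 :=
    Finset.sum_nonpos fun K _ => (G.Delta_neg hσ _).le
  have hσ₀ := G.Delta_neg hσ (.inl K₀)
  have hpos : ∀ y : G.KR s ⊕ G.KI s → ℝ, 0 < (D / 2 + ∑ j, ((σ (.inr j) : ℂ) + I * y j)).re +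
      ∑ K : {K : G.KU // K ≠ K₀}, σ (.inl K.1) := fun y => by
    rw [hzre]; linarith
  have hint := (G.measurePreserving_freeIdxPiEquiv s K₀).integrable_comp_emb
    (G.freeIdxPiEquiv s K₀).measurableEmbedding |>.2
    (G.integrable_regIntegrand hs hD hσ K₀ hε hε1 hr ht)
  rw [Measure.volume_eq_prod, Function.comp_def] at hint
  rw [← (G.measurePreserving_freeIdxPiEquiv s K₀).integral_comp'
      (fun η => G.regIntegrand s ε r t (G.contourPoint D σ K₀ η)), Measure.volume_eq_prod,
    integral_prod_symm _ hint, card_freeIdx, pow_add, mul_assoc]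
  have hinner : ∀ y : G.KR s ⊕ G.KI s → ℝ,
      (∏ j, (Gamma (-(σ (.inr j) + I * y j)) * mixedBase ε r j ^ ((σ (.inr j) : ℂ) + I * y j) *
        ((G.mon (G.idxPair (.inr j : G.MellinIdx s)) t / G.HU s t : ℝ) : ℂ) ^
          ((σ (.inr j) : ℂ) + I * y j))) / (G.HU s t : ℂ) ^ (D / 2) =
      (1 / (2 * (Real.pi : ℂ))) ^ Fintype.card {K : G.KU // K ≠ K₀} *
        ∫ x, G.regIntegrand s ε r t (G.contourPoint D σ K₀ (G.freeIdxPiEquiv s K₀ (x, y))) := by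
    intro y
    have hΓ : Gamma (D / 2 + ∑ j, ((σ (.inr j) : ℂ) + I * y j)) ≠ 0 :=
      Gamma_ne_zero_of_re_pos (by linarith [hpos y])
    -- Its condition on real parts says `-σ(K₀) > 0`, because the real parts sum to `-Re D / 2`.
    have hmb := Gamma_mul_sum_cpow_eq_integral
      (σ := fun K : {K : G.KU // K ≠ K₀} => σ (.inl K.1)) (fun K => G.Delta_neg hσ _) (hpos y)
      (b₀ := G.aCoef s K₀ * G.mon K₀ t) (mul_pos (G.aCoef_pos hs K₀) (G.mon_pos ht K₀))
      (b := fun K : {K : G.KU // K ≠ K₀} => G.aCoef s K.1 * G.mon K.1 t)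
      (fun K => mul_pos (G.aCoef_pos hs K.1) (G.mon_pos ht K.1))
    rw [← G.sum_KU_eq_add_sum_ne K₀ fun K => G.aCoef s K * G.mon K t, ← G.HU_eq_sum hs ht] at hmb
    simp only [G.regIntegrand_pair hs D σ K₀ ε r ht]
    rw [integral_const_mul, mul_left_comm, ← hmb, neg_add, cpow_add _ _ hU0, cpow_neg]
    have hdiv : ∀ j, ((G.mon (G.idxPair (.inr j : G.MellinIdx s)) t / G.HU s t : ℝ) : ℂ) ^
        ((σ (.inr j) : ℂ) + I * y j) =
        (G.mon (G.idxPair (.inr j : G.MellinIdx s)) t : ℂ) ^ ((σ (.inr j) : ℂ) + I * y j) *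
          (G.HU s t : ℂ) ^ (-((σ (.inr j) : ℂ) + I * y j)) := by
      intro j
      rw [div_eq_mul_inv, ofReal_mul, mul_cpow_ofReal_nonneg (G.mon_pos ht _).le
        (inv_nonneg.2 hU.le), ofReal_inv, inv_cpow _ _ (by
          rw [arg_ofReal_of_nonneg hU.le]; exact Real.pi_pos.ne), cpow_neg]
    simp only [hdiv]
    rw [← Finset.sum_neg_distrib, cpow_finset_sum hU0]
    simp only [Finset.prod_mul_distrib]
    rw [div_mul_eq_mul_div, eq_div_iff hΓ]
    ring
  rw [prod_exp_neg_mul_eq_integral (τ := fun j => σ (.inr j)) (fun j => G.Delta_neg hσ _)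
    (fun j => mixedBase_re_pos hε hr j) (fun j => div_pos (G.mon_pos ht _) hU), mul_div_assoc,
    ← integral_div]
  simp only [hinner]
  rw [integral_const_mul]
  ring

end StarGraph

theorem continuous_mixedBase_left {A B : Type*} (r : A ⊕ B → ℝ) (j : A ⊕ B) :
    Continuous fun ε : ℝ => mixedBase ε r j := by
  rcases j with K | K
  · exact continuous_const
  · simp only [mixedBase, Sum.elim_inr]
    fun_prop

namespace StarGraph

variable (G : StarGraph)

/-! ### The smeared representation -/

/-- `HV / HU` with the imaginary invariants shifted off the imaginary axis. -/
def regHV (s ε : ℝ) (r : G.Inv s) (t : Fin G.L → ℝ) : ℂ :=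
  (∑ j, mixedBase ε r j * (G.mon (G.idxPair (.inr j : G.MellinIdx s)) t : ℂ)) / G.HU s t

theorem regHV_zero (s : ℝ) (r : G.Inv s) (t : Fin G.L → ℝ) :
    G.regHV s 0 r t = G.HVoverHU s r t := by
  rw [regHV, HVoverHU, HVre, HVim, Fintype.sum_sum_type]
  push_cast
  rw [Finset.mul_sum]
  congr 2
  refine Finset.sum_congr rfl fun K _ => ?_
  simp only [mixedBase, Sum.elim_inr, ofReal_zero, zero_add, idxPair]
  ring

theorem regHV_re_nonneg {s : ℝ} (hs : 0 < s) {ε : ℝ} (hε : 0 ≤ ε) {r : G.Inv s}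
    (hr : r ∈ G.invCone s) {t : Fin G.L → ℝ} (ht : t ∈ G.cube) : 0 ≤ (G.regHV s ε r t).re := by
  rw [regHV, Complex.div_ofReal_re, re_sum]
  refine div_nonneg (Finset.sum_nonneg fun j _ => ?_) (G.HU_pos hs ht).le
  rw [re_mul_ofReal]
  exact mul_nonneg (mixedBase_re_nonneg hε hr j) (G.mon_pos ht _).le

theorem measurable_regHV (s ε : ℝ) :
    Measurable fun p : G.Inv s × (Fin G.L → ℝ) => G.regHV s ε p.1 p.2 := by
  unfold regHV
  refine Measurable.div (Finset.measurable_sum _ fun j _ => ?_)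
    (measurable_ofReal.comp ((G.measurable_HU s).comp measurable_snd))
  exact ((measurable_mixedBase ε j).comp measurable_fst).mul
    (measurable_ofReal.comp ((G.measurable_mon _).comp measurable_snd))

theorem paramIntegrand_regHV {s : ℝ} (D : ℂ) (ε : ℝ) (r : G.Inv s) (t : Fin G.L → ℝ) :
    G.paramIntegrand s D (G.regHV s ε r) t = (∏ ℓ, ((1 - t ℓ ^ 2 : ℝ) : ℂ) ^ (D / 2 - 1)) *
      ((∏ j, exp (-(mixedBase ε r j *
        ((G.mon (G.idxPair (.inr j : G.MellinIdx s)) t / G.HU s t : ℝ) : ℂ)))) /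
          (G.HU s t : ℂ) ^ (D / 2)) := by
  rw [paramIntegrand, regHV, ← Complex.exp_sum, Finset.sum_neg_distrib, Finset.sum_div,
    mul_div_assoc]
  simp only [ofReal_div, mul_div_assoc]

theorem continuous_paramIntegrand_regHV (s : ℝ) (D : ℂ) (r : G.Inv s) (t : Fin G.L → ℝ) :
    Continuous fun ε : ℝ => G.paramIntegrand s D (G.regHV s ε r) t := by
  unfold paramIntegrand regHV
  refine Continuous.div_const (continuous_const.mul (Complex.continuous_exp.comp
    (Continuous.neg (Continuous.div_const (continuous_finsetSum _ fun j _ => ?_) _)))) _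
  exact (continuous_mixedBase_left r j).mul continuous_const

/-- The measure of the invariants and the parameters. -/
def invCubeMeasure (s : ℝ) : Measure (G.Inv s × (Fin G.L → ℝ)) :=
  ((volume : Measure (G.Inv s)).restrict (G.invCone s)).prod (volume.restrict G.cube)

instance (s : ℝ) : SFinite (G.invCubeMeasure s) := by
  unfold invCubeMeasure; infer_instance

theorem ae_invCubeMeasure (s : ℝ) :
    ∀ᵐ q ∂G.invCubeMeasure s, q.1 ∈ G.invCone s ∧ q.2 ∈ G.cube := by
  rw [invCubeMeasure, Measure.prod_restrict]
  exact ae_restrict_mem ((G.measurableSet_invCone s).prod G.measurableSet_cube)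

theorem integrable_regularized {s : ℝ} (hs : 0 < s) {D : ℂ} (hD : D ∈ dimStrip)
    {σ : G.MellinIdx s → ℝ} (hσ : σ ∈ G.Delta s D) (K₀ : G.KU) {ε : ℝ} (hε : 0 < ε) (hε1 : ε ≤ 1)
    (f : 𝓢(G.Inv s, ℂ)) :
    Integrable (fun p : (G.Inv s × (Fin G.L → ℝ)) × (G.FreeIdx s K₀ → ℝ) =>
      f p.1.1 * (∏ ℓ, ((1 - p.1.2 ℓ ^ 2 : ℝ) : ℂ) ^ (D / 2 - 1)) *
        G.regIntegrand s ε p.1.1 p.1.2 (G.contourPoint D σ K₀ p.2))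
      ((G.invCubeMeasure s).prod volume) := by
  obtain ⟨β, hβ, C, hC, h⟩ := G.exists_norm_barnesFactor_mul_le hs hD hσ K₀ hε hε1
  have i1 : IntegrableOn (fun r => C * (‖f r‖ * ∏ j, powWeight (β j) (r j))) (G.invCone s) :=
    ((f.integrable_norm_mul_powWeight hβ).const_mul C).integrableOn
  have i2 := G.integrableOn_cube_prod (α := fun ℓ => G.phi σ ℓ) (β := fun _ => D.re / 2)
    hσ.2.2.2.2 (fun _ => by linarith [hD.1])
  refine ((i1.mul_prod i2).mul_prod (G.integrable_prod_inv_sq_contour D σ K₀)).mono' ?_ ?_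
  · refine Measurable.aestronglyMeasurable (Measurable.mul (Measurable.mul ?_ ?_) ?_)
    · exact f.continuous.measurable.comp (measurable_fst.comp measurable_fst)
    · refine Finset.measurable_prod _ fun ℓ _ => Measurable.pow (measurable_ofReal.comp ?_)
        measurable_const
      exact measurable_const.sub (((measurable_pi_apply ℓ).comp
        (measurable_snd.comp measurable_fst)).pow_const 2)
    · exact G.measurable_regIntegrand s ε (measurable_fst.comp measurable_fst)
        (measurable_snd.comp measurable_fst) ((G.measurable_contour D σ K₀).comp measurable_snd)
  · filter_upwards [Measure.quasiMeasurePreserving_fst.ae (G.ae_invCubeMeasure s)] with p hp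
    obtain ⟨hr, ht⟩ := hp
    have hre := G.contourPoint_re K₀ p.2 (G.Delta_sum hσ)
    have hb := h _ hr _ hre (G.sum_contourPoint D σ K₀ p.2)
    have hk : ‖∏ ℓ, ((1 - p.1.2 ℓ ^ 2 : ℝ) : ℂ) ^ (D / 2 - 1)‖ =
        ∏ ℓ, (1 - p.1.2 ℓ ^ 2) ^ (D.re / 2 - 1) := by
      rw [norm_prod]
      refine Finset.prod_congr rfl fun ℓ _ => ?_
      rw [norm_cpow_eq_rpow_re_of_pos (G.one_sub_sq_pos ht ℓ)]
      simp
    rw [norm_mul, norm_mul, regIntegrand, norm_mul, G.norm_prod_mon_cpow ht hre, hk]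
    have p1 : 0 ≤ ∏ ℓ, (1 - p.1.2 ℓ ^ 2) ^ (D.re / 2 - 1) :=
      Finset.prod_nonneg fun ℓ _ => Real.rpow_nonneg (G.one_sub_sq_pos ht ℓ).le _
    have p2 : 0 ≤ ∏ ℓ, p.1.2 ℓ ^ (G.phi σ ℓ - 1) :=
      Finset.prod_nonneg fun ℓ _ => Real.rpow_nonneg (G.cube_pos ht ℓ).le _
    rw [Finset.prod_mul_distrib]
    calc _ ≤ ‖f p.1.1‖ * (∏ ℓ, (1 - p.1.2 ℓ ^ 2) ^ (D.re / 2 - 1)) *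
          ((C * ∏ j, powWeight (β j) (p.1.1 j)) *
            (∏ j : G.FreeIdx s K₀, ((1 + |(G.contourPoint D σ K₀ p.2 j.1).im|) ^ 2)⁻¹) *
              ∏ ℓ, p.1.2 ℓ ^ (G.phi σ ℓ - 1)) :=
          mul_le_mul_of_nonneg_left (mul_le_mul_of_nonneg_right hb p2)
            (mul_nonneg (norm_nonneg _) p1)
      _ = _ := by ring

/-- Fubini moves the Mellin variables outside. For fixed ones, the integrals over `t` and over the
invariants factorize into beta integrals and a smeared power. -/
theorem integral_regularized {s : ℝ} (hs : 0 < s) {D : ℂ} (hD : D ∈ dimStrip)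
    {σ : G.MellinIdx s → ℝ} (hσ : σ ∈ G.Delta s D) (K₀ : G.KU) {ε : ℝ} (hε : 0 < ε) (hε1 : ε ≤ 1)
    (f : 𝓢(G.Inv s, ℂ)) :
    ∫ q, f q.1 * G.paramIntegrand s D (G.regHV s ε q.1) q.2 ∂G.invCubeMeasure s =
      (1 / (2 * (Real.pi : ℂ))) ^ Fintype.card (G.FreeIdx s K₀) *
        ∫ η, G.mellinKernel s D (G.contourPoint D σ K₀ η) *
          ∫ r in G.invCone s, f r * mixedPower ε (fun j => G.contourPoint D σ K₀ η (.inr j)) r := by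
  have hswap := integral_integral_swap (μ := G.invCubeMeasure s)
    (ν := (volume : Measure (G.FreeIdx s K₀ → ℝ)))
    (f := fun q η => f q.1 * (∏ ℓ, ((1 - q.2 ℓ ^ 2 : ℝ) : ℂ) ^ (D / 2 - 1)) *
        G.regIntegrand s ε q.1 q.2 (G.contourPoint D σ K₀ η))
    (G.integrable_regularized hs hD hσ K₀ hε hε1 f)
  have hη : ∀ η, ∫ q, f q.1 * (∏ ℓ, ((1 - q.2 ℓ ^ 2 : ℝ) : ℂ) ^ (D / 2 - 1)) *
        G.regIntegrand s ε q.1 q.2 (G.contourPoint D σ K₀ η) ∂G.invCubeMeasure s =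
      G.mellinKernel s D (G.contourPoint D σ K₀ η) *
        ∫ r in G.invCone s, f r * mixedPower ε (fun j => G.contourPoint D σ K₀ η (.inr j)) r := by
    intro η
    set z := G.contourPoint D σ K₀ η with hz
    have hre := G.contourPoint_re K₀ η (G.Delta_sum hσ)
    have hphi := G.integral_cube_prod (φ := fun ℓ => G.phi z ℓ) (v := D / 2)
      (fun ℓ => by rw [G.phi_re hre]; exact hσ.2.2.2.2 ℓ) (by simpa using hD.1)
    have hprod := integral_prod_mul (μ := volume.restrict (G.invCone s))
      (ν := volume.restrict G.cube) (fun r => f r * mixedPower ε (fun j => z (.inr j)) r)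
      (fun t => ∏ ℓ, ((t ℓ : ℂ) ^ (G.phi z ℓ - 1) * ((1 - t ℓ ^ 2 : ℝ) : ℂ) ^ (D / 2 - 1)))
    rw [hphi] at hprod
    rw [mellinKernel_eq, phiFactor]
    simp only [add_div]
    rw [mul_assoc, mul_comm (∏ ℓ, _) (∫ r in _, _), ← hprod, ← integral_const_mul]
    refine integral_congr_ae ?_
    filter_upwards [G.ae_invCubeMeasure s] with q hq
    rw [regIntegrand, ← G.prod_cpow_phi hq.2, Finset.prod_mul_distrib]
    ring
  rw [integral_congr_ae (Filter.Eventually.of_forall hη)] at hswap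
  rw [← hswap, ← integral_const_mul]
  refine integral_congr_ae ?_
  filter_upwards [G.ae_invCubeMeasure s] with q hq
  rw [integral_const_mul, paramIntegrand_regHV,
    G.prod_exp_div_HU_cpow_eq_integral hs hD hσ K₀ hε hε1 hq.1 hq.2]
  ring

/-- The shift by `ε` keeps the real part of the exponent nonnegative, so a single majorant serves
all `ε ≥ 0`. -/
theorem norm_paramIntegrand_mul_le {s : ℝ} (hs : 0 < s) {D : ℂ} (hD : D ∈ dimStrip)
    (f : 𝓢(G.Inv s, ℂ)) : ∃ bound : G.Inv s × (Fin G.L → ℝ) → ℝ,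
      Integrable bound (G.invCubeMeasure s) ∧ ∀ ε : ℝ, 0 ≤ ε → ∀ᵐ q ∂G.invCubeMeasure s,
        ‖f q.1 * G.paramIntegrand s D (G.regHV s ε q.1) q.2‖ ≤ bound q := by
  obtain ⟨ρ, hρ, -, bound, hb, h⟩ := G.exists_ball_bound hs hD
  refine ⟨fun q => ‖f q.1‖ * bound q.2,
    ((f.integrable (μ := volume)).norm.integrableOn (s := G.invCone s)).mul_prod hb,
    fun ε hε => ?_⟩
  filter_upwards [G.ae_invCubeMeasure s] with q hq
  rw [norm_mul]
  exact mul_le_mul_of_nonneg_left (h D (Metric.mem_ball_self hρ) _ _ hq.2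
    (G.regHV_re_nonneg hs hε hq.1 hq.2)) (norm_nonneg _)

theorem aestronglyMeasurable_mul_paramIntegrand {s : ℝ} (D : ℂ) (ε : ℝ) (f : 𝓢(G.Inv s, ℂ)) :
    AEStronglyMeasurable (fun q : G.Inv s × (Fin G.L → ℝ) =>
      f q.1 * G.paramIntegrand s D (G.regHV s ε q.1) q.2) (G.invCubeMeasure s) :=
  ((f.continuous.measurable.comp measurable_fst).mul
    (G.measurable_paramIntegrand s D measurable_snd
      (G.measurable_regHV s ε))).aestronglyMeasurable

open Filter Topology in
theorem tendsto_integral_paramIntegrand_regHV {s : ℝ} (hs : 0 < s) {D : ℂ} (hD : D ∈ dimStrip)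
    (f : 𝓢(G.Inv s, ℂ)) :
    Tendsto (fun ε : ℝ => ∫ q, f q.1 * G.paramIntegrand s D (G.regHV s ε q.1) q.2
        ∂G.invCubeMeasure s) (𝓝[>] 0)
      (𝓝 (∫ q, f q.1 * G.paramIntegrand s D (G.regHV s 0 q.1) q.2 ∂G.invCubeMeasure s)) := by
  obtain ⟨bound, hb, h⟩ := G.norm_paramIntegrand_mul_le hs hD f
  refine tendsto_integral_filter_of_dominated_convergence bound
    (Eventually.of_forall fun ε => G.aestronglyMeasurable_mul_paramIntegrand D ε f) ?_ hb
    (Eventually.of_forall fun q => ?_)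
  · filter_upwards [self_mem_nhdsWithin] with ε hε
    exact h ε (le_of_lt hε)
  · exact (((G.continuous_paramIntegrand_regHV s D q.1 q.2).tendsto 0).mono_left
      nhdsWithin_le_nhds).const_mul _

theorem integral_invCubeMeasure {s : ℝ} (hs : 0 < s) (K' : ℂ) {D : ℂ} (hD : D ∈ dimStrip)
    (f : 𝓢(G.Inv s, ℂ)) :
    K' * ∫ q, f q.1 * G.paramIntegrand s D (G.regHV s 0 q.1) q.2 ∂G.invCubeMeasure s =
      ∫ r in G.invCone s, f r * G.invAmplitude s K' D r := by
  obtain ⟨bound, hb, h⟩ := G.norm_paramIntegrand_mul_le hs hD f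
  have hi := hb.mono' (G.aestronglyMeasurable_mul_paramIntegrand D 0 f) (h 0 le_rfl)
  rw [invCubeMeasure] at hi ⊢
  rw [integral_prod _ hi, ← integral_const_mul]
  refine integral_congr_ae (Filter.Eventually.of_forall fun r => ?_)
  simp only
  rw [integral_const_mul, invAmplitude, show G.regHV s 0 r = G.HVoverHU s r from
    funext fun t => G.regHV_zero s r t]
  ring

end StarGraph

/-! ### Removal of the regularization -/

open Filter Topology in
-- Away from the coordinate hyperplanes the limiting base `i r` is off the negative axis, so the
-- principal power is continuous there.
theorem tendsto_mixedPower {A B : Type*} [Fintype A] [Fintype B] (a : A ⊕ B → ℂ) {r : A ⊕ B → ℝ}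
    (hr : r ∈ mixedCone A B) (h0 : ∀ j, r j ≠ 0) :
    Tendsto (fun ε : ℝ => mixedPower ε a r) (𝓝[>] 0) (𝓝 (mixedPower 0 a r)) := by
  unfold mixedPower
  refine tendsto_finsetProd _ fun j _ => ?_
  have hb := ((continuous_mixedBase_left r j).tendsto 0).mono_left
    (nhdsWithin_le_nhds (s := Set.Ioi 0))
  refine hb.cpow tendsto_const_nhds ?_
  rcases j with K | K
  · left
    simpa [mixedBase] using hr K
  · right
    simpa [mixedBase] using h0 (.inr K)

open Filter Topology in
theorem tendsto_integral_mul_mixedPower {A B : Type*} [Fintype A] [Fintype B]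
    (f : 𝓢(A ⊕ B → ℝ, ℂ)) {a : A ⊕ B → ℂ} (ha : ∀ j, -1 < (a j).re) :
    Tendsto (fun ε : ℝ => ∫ r in mixedCone A B, f r * mixedPower ε a r) (𝓝[>] 0)
      (𝓝 (∫ r in mixedCone A B, f r * mixedPower 0 a r)) := by
  refine tendsto_integral_filter_of_dominated_convergence _
    (Eventually.of_forall fun ε => (f.continuous.measurable.mul
      (measurable_mixedPower_right ε a)).aestronglyMeasurable) ?_
    (((f.integrable_norm_mul_powWeight ha).mul_const
      (∏ K : B, Real.exp (Real.pi / 2 * |(a (.inr K)).im|))).integrableOn) ?_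
  · filter_upwards [Ioc_mem_nhdsGT (zero_lt_one' ℝ)] with ε hε
    filter_upwards [ae_restrict_mem measurableSet_mixedCone, ae_restrict_of_ae ae_forall_ne_zero]
      with r hr h0
    rw [norm_mul, mul_assoc]
    exact mul_le_mul_of_nonneg_left (norm_mixedPower_le hε.1.le hε.2 a hr h0) (norm_nonneg _)
  · filter_upwards [ae_restrict_mem measurableSet_mixedCone, ae_restrict_of_ae ae_forall_ne_zero]
      with r hr h0
    exact (tendsto_mixedPower a hr h0).const_mul _

namespace StarGraph

variable (G : StarGraph)

theorem aestronglyMeasurable_mellinKernel_mul {s : ℝ} (D : ℂ) (σ : G.MellinIdx s → ℝ) (K₀ : G.KU)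
    (ε : ℝ) (f : 𝓢(G.Inv s, ℂ)) :
    AEStronglyMeasurable (fun η : G.FreeIdx s K₀ → ℝ =>
      G.mellinKernel s D (G.contourPoint D σ K₀ η) *
        ∫ r in G.invCone s, f r * mixedPower ε (fun j => G.contourPoint D σ K₀ η (.inr j)) r) := by
  have hc := G.measurable_contour D σ K₀
  refine AEStronglyMeasurable.mul ?_ ?_
  · simp only [mellinKernel_eq]
    exact ((((G.measurable_barnesFactor s).comp hc).mul ((G.measurable_prod_Gamma s).comp hc)).mul
      ((G.measurable_phiFactor s D).comp hc)).aestronglyMeasurable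
  · refine (StronglyMeasurable.integral_prod_right (f := fun (η : G.FreeIdx s K₀ → ℝ) r =>
      f r * mixedPower ε (fun j => G.contourPoint D σ K₀ η (.inr j)) r) ?_).aestronglyMeasurable
    refine Measurable.stronglyMeasurable ((f.continuous.measurable.comp measurable_snd).mul ?_)
    refine (measurable_mixedPower ε).comp (Measurable.prodMk ?_ measurable_snd)
    exact measurable_pi_iff.2 fun j => (measurable_pi_apply (Sum.inr j)).comp (hc.comp measurable_fst)

theorem mellinIntegrand_eq {s : ℝ} (D : ℂ) (f : 𝓢(G.Inv s, ℂ)) (z : G.MellinIdx s → ℂ) :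
    G.mellinIntegrand D f z = G.mellinKernel s D z *
      ∫ r in G.invCone s, f r * mixedPower 0 (fun j => z (.inr j)) r := by
  rw [mellinIntegrand]
  simp only [invPower_eq]

open Filter Topology in
-- The regularized identity is passed to the limit on both sides: in the parametric integral by the
-- bound on the exponential, in the Mellin integral by the majorant uniform in `ε`.
theorem integrable_and_integral_mellinIntegrand {s : ℝ} (hs : 0 < s) {D : ℂ} (hD : D ∈ dimStrip)
    {σ : G.MellinIdx s → ℝ} (hσ : σ ∈ G.Delta s D) (K₀ : G.KU) (f : 𝓢(G.Inv s, ℂ)) :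
    Integrable (fun η : G.FreeIdx s K₀ → ℝ =>
        G.mellinIntegrand D f (G.contourPoint D σ K₀ η)) ∧
      ∫ q, f q.1 * G.paramIntegrand s D (G.regHV s 0 q.1) q.2 ∂G.invCubeMeasure s =
        (1 / (2 * (Real.pi : ℂ))) ^ Fintype.card (G.FreeIdx s K₀) *
          ∫ η, G.mellinIntegrand D f (G.contourPoint D σ K₀ η) := by
  obtain ⟨C, hC, h⟩ := G.exists_norm_mellinKernel_mul_integral_le hs hD hσ K₀ f
  have hbound := (G.integrable_prod_inv_sq_contour D σ K₀).const_mul C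
  have hre := fun η => G.contourPoint_re K₀ η (G.Delta_sum hσ)
  have hle : ∀ ε ∈ Set.Ioc (0 : ℝ) 1, ∀ η, _ := fun ε hε η =>
    h ε hε.1 hε.2 _ (hre η) (G.sum_contourPoint D σ K₀ η)
  have hlim : ∀ η, Tendsto (fun ε : ℝ => G.mellinKernel s D (G.contourPoint D σ K₀ η) *
      ∫ r in G.invCone s, f r * mixedPower ε (fun j => G.contourPoint D σ K₀ η (.inr j)) r)
      (𝓝[>] 0) (𝓝 (G.mellinIntegrand D f (G.contourPoint D σ K₀ η))) := fun η => by
    rw [mellinIntegrand_eq]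
    exact (tendsto_integral_mul_mixedPower f fun j => by
      rw [hre]; exact G.Delta_gt_neg_one hD hσ _).const_mul _
  constructor
  · refine hbound.mono' ?_ (Eventually.of_forall fun η => ?_)
    · simp only [mellinIntegrand_eq]
      exact G.aestronglyMeasurable_mellinKernel_mul D σ K₀ 0 f
    -- Integration by parts was available only for `ε > 0`; at `ε = 0` the majorant is inherited
    -- through the pointwise limit.
    · refine le_of_tendsto (hlim η).norm ?_
      filter_upwards [Ioc_mem_nhdsGT (zero_lt_one' ℝ)] with ε hε
      exact hle ε hε η
  · have h1 := G.tendsto_integral_paramIntegrand_regHV hs hD f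
    have h2 : Tendsto (fun ε : ℝ => ∫ η, G.mellinKernel s D (G.contourPoint D σ K₀ η) *
        ∫ r in G.invCone s, f r * mixedPower ε (fun j => G.contourPoint D σ K₀ η (.inr j)) r)
        (𝓝[>] 0) (𝓝 (∫ η, G.mellinIntegrand D f (G.contourPoint D σ K₀ η))) := by
      refine tendsto_integral_filter_of_dominated_convergence _
        (Eventually.of_forall fun ε => G.aestronglyMeasurable_mellinKernel_mul D σ K₀ ε f) ?_
        hbound (Eventually.of_forall hlim)
      filter_upwards [Ioc_mem_nhdsGT (zero_lt_one' ℝ)] with ε hε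
      exact Eventually.of_forall (hle ε hε)
    refine tendsto_nhds_unique h1 ((h2.const_mul _).congr' ?_)
    filter_upwards [Ioc_mem_nhdsGT (zero_lt_one' ℝ)] with ε hε
    exact (G.integral_regularized hs hD hσ K₀ hε.1 hε.2 f).symm

theorem ampDistribution_eq_integral {s : ℝ} (hs : 0 < s) (K' : ℂ) {D : ℂ} (hD : D ∈ dimStrip)
    {σ : G.MellinIdx s → ℝ} (hσ : σ ∈ G.Delta s D) (K₀ : G.KU) (f : 𝓢(G.Inv s, ℂ)) :
    G.ampDistribution hs K' D f = K' * ∫ η : G.FreeIdx s K₀ → ℝ,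
      G.mellinIntegrand D f (G.contourPoint D σ K₀ η) /
        (2 * (Real.pi : ℂ)) ^ (Fintype.card (G.FreeIdx s K₀)) := by
  rw [G.ampDistribution_apply hs K' hD, ← G.integral_invCubeMeasure hs K' hD,
    (G.integrable_and_integral_mellinIntegrand hs hD hσ K₀ f).2, integral_div, one_div, inv_pow,
    div_eq_inv_mul]

theorem integrableOn_mul_invPower {s : ℝ} {D : ℂ} (hD : D ∈ dimStrip)
    {σ : G.MellinIdx s → ℝ} (hσ : σ ∈ G.Delta s D) (K₀ : G.KU) (f : 𝓢(G.Inv s, ℂ))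
    (η : G.FreeIdx s K₀ → ℝ) :
    IntegrableOn (fun r => f r * G.invPower (G.contourPoint D σ K₀ η) r) (G.invCone s) := by
  simp only [invPower_eq]
  exact integrableOn_mul_mixedPower f le_rfl zero_le_one fun j => by
    rw [G.contourPoint_re K₀ η (G.Delta_sum hσ)]
    exact G.Delta_gt_neg_one hD hσ _

end StarGraph

end

theorem mainTheorem11 (G : StarGraph) (s Ω : ℝ) (hs : 0 < s) (hΩ : 0 < Ω) (K' : ℂ) (m : ℕ) :
    -- the monomials of `HU` and of the real and imaginary parts of `HV`
    (∀ t ∈ G.cube, 0 < G.HU s t ∧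
      G.HU s t = ∑ K : G.KU, G.aCoef s K * G.mon K t) ∧
    (∀ t ∈ G.cube, ∀ X : G.ExtConf m,
      ((Ω / 2 : ℝ) : ℂ) * G.extForm s t X =
        ((Ω / 2 : ℝ) : ℂ) * G.pureExtForm s X + G.HVoverHU s (G.invariants s Ω X) t) ∧
    -- the amplitude is well defined and analytic in the strip
    (∀ X : G.ExtConf m,
      (∀ D ∈ dimStrip, IntegrableOn
        (G.paramIntegrand s D fun t => ((Ω / 2 : ℝ) : ℂ) * G.extForm s t X) G.cube volume) ∧
      (∀ D ∈ dimStrip, G.amplitude s Ω K' D X =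
        Complex.exp (-(((Ω / 2 : ℝ) : ℂ) * G.pureExtForm s X)) *
          G.invAmplitude s K' D (G.invariants s Ω X)) ∧
      AnalyticOnNhd ℂ (fun D => G.amplitude s Ω K' D X) dimStrip) ∧
    (∀ r : G.Inv s, (∀ K : G.KR s, 0 ≤ r (.inl K)) →
      (∀ D ∈ dimStrip, IntegrableOn (G.paramIntegrand s D (G.HVoverHU s r)) G.cube volume) ∧
      AnalyticOnNhd ℂ (fun D => G.invAmplitude s K' D r) dimStrip) ∧
    -- the complete Mellin representation, as tempered distribution of the invariants
    (∀ D ∈ dimStrip, (G.Delta s D).Nonempty) ∧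
    ∃ T : ℂ → 𝓢'(G.Inv s, ℂ),
      (∀ f : 𝓢(G.Inv s, ℂ), AnalyticOnNhd ℂ (fun D => T D f) dimStrip) ∧
      ∀ D ∈ dimStrip, ∀ f : 𝓢(G.Inv s, ℂ),
        (IntegrableOn (fun r => f r * G.invAmplitude s K' D r) (G.invCone s) volume ∧
          T D f = ∫ r in G.invCone s, f r * G.invAmplitude s K' D r) ∧
        ∀ σ ∈ G.Delta s D, ∀ K₀ : G.KU,
          (∀ η : G.FreeIdx s K₀ → ℝ, IntegrableOn (fun r => f r * G.invPower (G.contourPoint D σ K₀ η) r)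
            (G.invCone s) volume) ∧
          Integrable (fun η : G.FreeIdx s K₀ → ℝ => G.mellinIntegrand D f (G.contourPoint D σ K₀ η)) volume ∧
          T D f = K' * ∫ η : G.FreeIdx s K₀ → ℝ, G.mellinIntegrand D f (G.contourPoint D σ K₀ η) /
            (2 * (Real.pi : ℂ)) ^ (Fintype.card (G.FreeIdx s K₀)) := by
  refine ⟨fun t ht => ⟨G.HU_pos hs ht, G.HU_eq_sum hs ht⟩,
    fun t ht X => G.half_mul_extForm hs Ω ht X, fun X => ?_, fun r hr => ?_,
    fun D hD => G.Delta_nonempty s hD, G.ampDistribution hs K',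
    fun f => G.analyticOnNhd_ampDistribution hs K' f, fun D hD f =>
      ⟨⟨G.integrableOn_mul_invAmplitude hs K' hD f, G.ampDistribution_apply hs K' hD f⟩,
        fun σ hσ K₀ => ⟨fun η => G.integrableOn_mul_invPower hD hσ K₀ f η,
          (G.integrable_and_integral_mellinIntegrand hs hD hσ K₀ f).1,
          G.ampDistribution_eq_integral hs K' hD hσ K₀ f⟩⟩⟩
  · have hr := fun K => G.invariants_nonneg hΩ s X K
    refine ⟨fun D hD => ?_, fun D _ => G.amplitude_eq hs Ω K' D X, ?_⟩
    · exact IntegrableOn.congr_fun ((G.integrableOn_paramIntegrand hs hD hr).const_mul _)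
        (fun t ht => (G.paramIntegrand_extForm hs Ω D X ht).symm) G.measurableSet_cube
    · simp only [G.amplitude_eq hs Ω]
      exact ((G.differentiableOn_invAmplitude hs K' hr).const_mul _).analyticOnNhd dimStrip_isOpen
  · exact ⟨fun D hD => G.integrableOn_paramIntegrand hs hD hr,
      (G.differentiableOn_invAmplitude hs K' hr).analyticOnNhd dimStrip_isOpen⟩
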